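/- **Setting.** Let $n,m\ge 0$ be integers. Let $\Upsilon\subset\mathbb R$, $\mathcal I\subset\mathbb R^n$ be non-empty and bounded, let $\Xi\subset\mathbb R$ be a non-empty bounded interval, and let $r,\rho,\xi,s,\delta>0$. For a set $A$ of real points, $A_\theta$ is the union of the complex (Euclidean) balls of radius $\theta$ centred at the points of $A$; $\mathbb T^n_s$ is the set of $\varphi\in(\mathbb C/2\pi\mathbb Z)^n$ with $|\mathrm{Im}\,\varphi_i|<s$; $B^{2m}_\delta=\{(p,q)\in\mathbb C^{m}\times\mathbb C^m: |p_i|<\delta,\ |q_i|<\delta\}$; and $$\mathcal P_{r,\rho,\xi,s,\delta}=\Upsilon_r\times\mathcal I_\rho\times\Xi_\xi\times\mathbb T^n_s\times B^{2m}_\delta\ni(y,I,x,\varphi,(p,q)),$$ with the two-form $dy\wedge dx+dI\wedge d\varphi+dp\wedge dq$. Let $\mathcal O_{r,\rho,\xi,s,\delta}$ be the set of the functions holomorphic on $\mathcal P_{\hat r,\hat\rho,\hat\xi,\hat s,\hat\delta}$ for some $\hat r>r$, $\hat\rho>\rho$, $\hat\xi>\xi$, $\hat s>s$, $\hat\delta>\delta$.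 With the Taylor–Fourier expansion $\phi=\sum_{k\in\mathbb Z^n,\,h,j\in\mathbb N^m}\phi_{khj}(y,I,x)e^{\mathrm i k\cdot\varphi}p^hq^j$ put $$\|\phi\|_{r,\rho,\xi,s,\delta}=\sum_{k,h,j}\ \sup_{\Upsilon_r\times\mathcal I_\rho\times\Xi_\xi}|\phi_{khj}|\ e^{s|k|_1}\delta^{|h|_1+|j|_1}\in[0,\infty],\qquad \widetilde\phi=\sum_{(k,h-j)\ne(0,0)}\phi_{khj}e^{\mathrm i k\cdot\varphi}p^hq^j,\qquad \overline\phi=\phi-\widetilde\phi,$$ and let $\mathcal N_{r,\rho,\xi,s,\delta}=\{\phi\in\mathcal O_{r,\rho,\xi,s,\delta}:\phi=\overline\phi\}$. For vector-valued functions, $\|\cdot\|$ is the maximum of the norms of the components (and $0$ if there are none). Below, $\|\cdot\|$ without index is $\|\cdot\|_{r,\rho,\xi,s,\delta}$. Let $J(p,q)=(p_1q_1,\dots,p_mq_m)$ and $$H=h_0(y,I,J(p,q))+f_0(y,I,p,x,\varphi,q),$$ where $f_0\in\mathcal O_{r,\rho,\xi,s,\delta}$ and $h_0$ is holomorphic on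 $\Upsilon_{\hat r}\times\mathcal I_{\hat\rho}\times\{J\in\mathbb C^m:|J_i|<\hat\delta^2\}$ for some $\hat r>r$, $\hat\rho>\rho$, $\hat\delta>\delta$. Let $\omega_y,\omega_I,\omega_J$ be the partial derivatives of $h_0$ with respect to $y,I,J$, regarded as functions on the phase space through $J=J(p,q)$, and assume that $\omega_y$ does not vanish on $\Upsilon_r\times\mathcal I_\rho\times\{|J_i|<\delta^2\}$. Put $\mathtt d=\min\{\rho s,\,r\xi,\,\delta^2\}$ and $\mathcal X=\sup\{|x|:x\in\Xi_\xi\}$. **Lemma (normal form without small divisors).** For all $n,m$ there is a number $\mathtt c_{n,m}\ge1$, depending only on $n,m$, such that, in this setting, for every integer $N\ge1$ with $$4N\mathcal X\Big\|\frac{\omega_I}{\omega_y}\Big\|<s,\qquad 4N\mathcal X\Big\|\frac{\omega_J}{\omega_y}\Big\|<1,\qquad \mathtt c_{n,m}N\frac{\mathcal X}{\mathtt d}\Big\|\frac1{\omega_y}\Big\|\,\|f_0\|<1,$$ there are $\hat r>\frac r3$, $\hat\rho>\frac\rho3$, $\hat\xi>\frac\xi3$, $\hat s>\frac s3$, $\hat\delta>\frac\delta3$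 and a canonical transformation (a holomorphic, injective, symplectic map, whose lift to the covering in which the angles vary in $\mathbb C^n$ commutes with the translations of the angles by $2\pi\mathbb Z^n$) $$\Psi_N:\ \mathcal P_{\hat r,\hat\rho,\hat\xi,\hat s,\hat\delta}\to\mathcal P_{r,\rho,\xi,s,\delta}$$ such that $F\mapsto F\circ\Psi_N$ maps $\mathcal O_{r,\rho,\xi,s,\delta}$ to $\mathcal O_{\frac13(r,\rho,\xi,s,\delta)}$ and, on $\mathcal P_{\frac13(r,\rho,\xi,s,\delta)}$, $$H\circ\Psi_N=h_0+\overline{f_0}+g_N+f_N,\qquad g_N\in\mathcal N_{\frac13(r,\rho,\xi,s,\delta)},\quad f_N\in\mathcal O_{\frac13(r,\rho,\xi,s,\delta)},$$ $$\|g_N\|_{\frac13(r,\rho,\xi,s,\delta)}\le\mathtt c_{n,m}\frac{\mathcal X}{\mathtt d}\Big\|\frac{\widetilde f_0}{\omega_y}\Big\|\,\|f_0\|,\qquad \|f_N\|_{\frac13(r,\rho,\xi,s,\delta)}\le\frac1{2^{N+1}}\|f_0\|.$$ Moreover, if $(y,I,p,x,\varphi,q)=\Psi_N(y_N,I_N,p_N,x_N,\varphi_N,q_N)$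 with $(y_N,I_N,p_N,x_N,\varphi_N,q_N)$ in $\mathcal P_{\frac13(r,\rho,\xi,s,\delta)}$ (the angles being lifted to $\mathbb C^n$), then, with Euclidean norms $|\cdot|$, $$\mathtt d\max\Big\{\frac{|I-I_N|}\rho,\frac{|\varphi-\varphi_N|}s,\frac{|p-p_N|}\delta,\frac{|q-q_N|}\delta,\frac{|y-y_N|}r,\frac{|x-x_N|}\xi\Big\}$$ $$\le\max\big\{s|I-I_N|,\ \rho|\varphi-\varphi_N|,\ \delta|p-p_N|,\ \delta|q-q_N|,\ \xi|y-y_N|,\ r|x-x_N|\big\}\le 4\mathcal X\Big\|\frac{f_0}{\omega_y}\Big\|.$$ -/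

import Mathlib

open scoped ENNReal

noncomputable section

namespace NormalForm

/-- Points `((y, I, p), (x, φ, q))` of the complexified phase space; the angles `φ` are lifted from
the torus to `ℂⁿ`. The second factor is conjugate to the first one. -/
abbrev Phase (n m : ℕ) : Type :=
  (ℂ × (Fin n → ℂ) × (Fin m → ℂ)) × (ℂ × (Fin n → ℂ) × (Fin m → ℂ))

namespace Phase

variable {n m : ℕ}

def y (z : Phase n m) : ℂ := z.1.1
def I (z : Phase n m) : Fin n → ℂ := z.1.2.1
def p (z : Phase n m) : Fin m → ℂ := z.1.2.2
def x (z : Phase n m) : ℂ := z.2.1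
def φ (z : Phase n m) : Fin n → ℂ := z.2.2.1
def q (z : Phase n m) : Fin m → ℂ := z.2.2.2

/-- `J(p,q) = (p₁q₁, …, pₘqₘ)`. -/
def J (z : Phase n m) : Fin m → ℂ := fun i => z.p i * z.q i

/-- The arguments `(y, I, J(p,q))` of the unperturbed Hamiltonian. -/
def yIJ (z : Phase n m) : ℂ × (Fin n → ℂ) × (Fin m → ℂ) := (z.y, z.I, z.J)

/-- The arguments `(y, I, x)` of the Taylor-Fourier coefficients. -/
def yIx (z : Phase n m) : ℂ × (Fin n → ℂ) × ℂ := (z.y, z.I, z.x)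

/-- Translation of the angles by `2πl`, `l ∈ ℤⁿ`. -/
def shift (l : Fin n → ℤ) (z : Phase n m) : Phase n m :=
  (z.1, (z.x, (fun i => z.φ i + 2 * (Real.pi : ℂ) * (l i : ℂ)), z.q))

end Phase

/-- The Euclidean (Hermitian) norm on `ℂᵏ`. -/
def euclNorm {k : ℕ} (v : Fin k → ℂ) : ℝ := Real.sqrt (∑ i, ‖v i‖ ^ 2)

/-- The real sets `Υ`, `𝓘`, `Ξ` in which `y`, `I`, `x` vary. -/
structure Base (n : ℕ) where
  Υ : Set ℝ
  𝓘 : Set (Fin n → ℝ)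
  Ξ : Set ℝ

/-- The analyticity widths `(r, ρ, ξ, s, δ)`. -/
structure Widths where
  r : ℝ
  ρ : ℝ
  ξ : ℝ
  s : ℝ
  δ : ℝ

namespace Widths

def Pos (w : Widths) : Prop := 0 < w.r ∧ 0 < w.ρ ∧ 0 < w.ξ ∧ 0 < w.s ∧ 0 < w.δ

/-- All widths of `w` are strictly smaller than those of `w'`. -/
def Lt (w w' : Widths) : Prop :=
  w.r < w'.r ∧ w.ρ < w'.ρ ∧ w.ξ < w'.ξ ∧ w.s < w'.s ∧ w.δ < w'.δ

/-- `1/3 (r, ρ, ξ, s, δ)`. -/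
def third (w : Widths) : Widths := ⟨w.r / 3, w.ρ / 3, w.ξ / 3, w.s / 3, w.δ / 3⟩

/-- `d = min {ρ s, r ξ, δ²}`. -/
def d (w : Widths) : ℝ := min (w.ρ * w.s) (min (w.r * w.ξ) (w.δ ^ 2))

end Widths

/-- `A_θ`, the union of the complex discs of radius `θ` centred at the points of `A ⊆ ℝ`. -/
def nhd₁ (A : Set ℝ) (θ : ℝ) : Set ℂ := {z | ∃ a ∈ A, ‖z - (a : ℂ)‖ < θ}

/-- `A_θ`, the union of the complex Euclidean balls of radius `θ` centred at the points of
`A ⊆ ℝⁿ`. -/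
def nhd {n : ℕ} (A : Set (Fin n → ℝ)) (θ : ℝ) : Set (Fin n → ℂ) :=
  {z | ∃ a ∈ A, euclNorm (fun i => z i - (a i : ℂ)) < θ}

variable {n m : ℕ}

/-- `Υ_r × 𝓘_ρ × Ξ_ξ`. -/
def baseDomain (D : Base n) (w : Widths) : Set (ℂ × (Fin n → ℂ) × ℂ) :=
  {b | b.1 ∈ nhd₁ D.Υ w.r ∧ b.2.1 ∈ nhd D.𝓘 w.ρ ∧ b.2.2 ∈ nhd₁ D.Ξ w.ξ}

/-- `Υ_r × 𝓘_ρ × {J : |J_i| < δ²}`, the set of the values of `(y, I, J(p,q))`. -/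
def actionDomain (m : ℕ) (D : Base n) (w : Widths) : Set (ℂ × (Fin n → ℂ) × (Fin m → ℂ)) :=
  {u | u.1 ∈ nhd₁ D.Υ w.r ∧ u.2.1 ∈ nhd D.𝓘 w.ρ ∧ ∀ i, ‖u.2.2 i‖ < w.δ ^ 2}

/-- `Υ_r × 𝓘_ρ × Ξ_ξ × 𝕋ⁿ_s × B_δ`, with the angles lifted to the strip `|Im φ_i| < s` of `ℂⁿ` and
`B_δ` the ball of radius `δ` for the maximum norm in the variables `(p, q)`. -/
def domain (m : ℕ) (D : Base n) (w : Widths) : Set (Phase n m) :=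
  {z | z.yIx ∈ baseDomain D w ∧ (∀ i, |(z.φ i).im| < w.s) ∧
    (∀ i, ‖z.p i‖ < w.δ) ∧ (∀ i, ‖z.q i‖ < w.δ)}

/-- The class `𝒪` of the functions that are holomorphic, and `2π`-periodic in the angles, on a
domain with strictly larger widths. -/
def ClassO (D : Base n) (w : Widths) (F : Phase n m → ℂ) : Prop :=
  ∃ w' : Widths, w.Lt w' ∧ DifferentiableOn ℂ F (domain m D w') ∧
    ∀ z ∈ domain m D w', ∀ l : Fin n → ℤ, F (z.shift l) = F z

/-- The indices `(k, h, j)` of the Taylor-Fourier expansion. -/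
abbrev Idx (n m : ℕ) : Type := (Fin n → ℤ) × (Fin m → ℕ) × (Fin m → ℕ)

/-- `e^{i k·φ} p^h q^j`. -/
def mono (κ : Idx n m) (z : Phase n m) : ℂ :=
  Complex.exp (Complex.I * ∑ i, (κ.1 i : ℂ) * z.φ i) *
    (∏ i, z.p i ^ κ.2.1 i) * ∏ i, z.q i ^ κ.2.2 i

/-- `a` is the family of the coefficients `a_{khj}(y, I, x)` of the Taylor-Fourier expansion
`F = ∑ a_{khj}(y, I, x) e^{i k·φ} p^h q^j` on the domain. -/
def IsExpansion (D : Base n) (w : Widths) (F : Phase n m → ℂ)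
    (a : Idx n m → ℂ × (Fin n → ℂ) × ℂ → ℂ) : Prop :=
  ∀ z ∈ domain m D w, HasSum (fun κ => a κ z.yIx * mono κ z) (F z)

open Classical in
/-- The Taylor-Fourier coefficients of `F`; they are determined by `F` on `baseDomain D w`. -/
def coeff (D : Base n) (w : Widths) (F : Phase n m → ℂ) : Idx n m → ℂ × (Fin n → ℂ) × ℂ → ℂ :=
  if h : ∃ a, IsExpansion D w F a then h.choose else 0

open Classical in
/-- `‖F‖ = ∑ sup |F_{khj}| e^{s|k|} δ^{|h|+|j|}`, with `|·|` the `ℓ¹` norm of multi-indices; infinite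
if `F` has no expansion or the series diverges. -/
def norm (D : Base n) (w : Widths) (F : Phase n m → ℂ) : ℝ≥0∞ :=
  if ∃ a, IsExpansion D w F a then
    ∑' κ : Idx n m, (⨆ b ∈ baseDomain D w, ‖coeff D w F κ b‖ₑ) *
      ENNReal.ofReal (Real.exp (w.s * ∑ i, |(κ.1 i : ℝ)|) *
        w.δ ^ (∑ i, κ.2.1 i + ∑ i, κ.2.2 i))
  else ⊤

open Classical in
/-- The off-average of `F`: the terms of the expansion with `(k, h - j) ≠ (0, 0)`. -/
def offAverage (D : Base n) (w : Widths) (F : Phase n m → ℂ) : Phase n m → ℂ := fun z =>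
  ∑' κ : Idx n m, if κ.1 = 0 ∧ κ.2.1 = κ.2.2 then 0 else coeff D w F κ z.yIx * mono κ z

/-- The average of `F`. -/
def average (D : Base n) (w : Widths) (F : Phase n m → ℂ) : Phase n m → ℂ := fun z =>
  F z - offAverage D w F z

/-- The normal class `𝒩`: the functions of class `𝒪` that agree with their average. -/
def ClassN (D : Base n) (w : Widths) (F : Phase n m → ℂ) : Prop :=
  ClassO D w F ∧ Set.EqOn F (average D w F) (domain m D w)

/-- `h₀` is holomorphic in `(y, I, J)` on a domain with strictly larger widths. -/
def HolomorphicAction (D : Base n) (w : Widths) (h₀ : ℂ × (Fin n → ℂ) × (Fin m → ℂ) → ℂ) : Prop :=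
  ∃ w' : Widths, w.Lt w' ∧ DifferentiableOn ℂ h₀ (actionDomain m D w')

/-- `ω_y = ∂_y h₀`. -/
def omegaY (h₀ : ℂ × (Fin n → ℂ) × (Fin m → ℂ) → ℂ) (u : ℂ × (Fin n → ℂ) × (Fin m → ℂ)) : ℂ :=
  deriv (fun t : ℂ => h₀ (t, u.2.1, u.2.2)) u.1

/-- `ω_{I_i} = ∂_{I_i} h₀`. -/
def omegaI (h₀ : ℂ × (Fin n → ℂ) × (Fin m → ℂ) → ℂ) (i : Fin n)
    (u : ℂ × (Fin n → ℂ) × (Fin m → ℂ)) : ℂ :=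
  deriv (fun t : ℂ => h₀ (u.1, Function.update u.2.1 i t, u.2.2)) (u.2.1 i)

/-- `ω_{J_i} = ∂_{J_i} h₀`. -/
def omegaJ (h₀ : ℂ × (Fin n → ℂ) × (Fin m → ℂ) → ℂ) (i : Fin m)
    (u : ℂ × (Fin n → ℂ) × (Fin m → ℂ)) : ℂ :=
  deriv (fun t : ℂ => h₀ (u.1, u.2.1, Function.update u.2.2 i t)) (u.2.2 i)

/-- `𝒳 = sup {|x| : x ∈ Ξ_ξ}`. -/
def supX (D : Base n) (w : Widths) : ℝ≥0∞ := ⨆ x ∈ nhd₁ D.Ξ w.ξ, ‖x‖ₑ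

/-- The standard two-form `dy ∧ dx + dI ∧ dφ + dp ∧ dq`. -/
def twoForm (u v : Phase n m) : ℂ :=
  (u.y * v.x - v.y * u.x) + ∑ i, (u.I i * v.φ i - v.I i * u.φ i) +
    ∑ i, (u.p i * v.q i - v.p i * u.q i)

/-- `Ψ` is a canonical transformation from the domain of widths `w'` into the domain of widths `w`:
holomorphic, injective, symplectic, and compatible with the periodicity of the angles. -/
structure IsCanonical (D : Base n) (w' w : Widths) (Ψ : Phase n m → Phase n m) : Prop where
  holomorphic : DifferentiableOn ℂ Ψ (domain m D w')
  mapsTo : Set.MapsTo Ψ (domain m D w') (domain m D w)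
  injOn : Set.InjOn Ψ (domain m D w')
  symplectic : ∀ z ∈ domain m D w', ∀ u v : Phase n m,
    twoForm (fderiv ℂ Ψ z u) (fderiv ℂ Ψ z v) = twoForm u v
  periodic : ∀ z ∈ domain m D w', ∀ l : Fin n → ℤ, Ψ (z.shift l) = (Ψ z).shift l

/-- `max {|I-I'|/ρ, |φ-φ'|/s, |p-p'|/δ, |q-q'|/δ, |y-y'|/r, |x-x'|/ξ}`. -/
def relDist (w : Widths) (z z' : Phase n m) : ℝ :=
  max (euclNorm (z.I - z'.I) / w.ρ) (max (euclNorm (z.φ - z'.φ) / w.s)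
    (max (euclNorm (z.p - z'.p) / w.δ) (max (euclNorm (z.q - z'.q) / w.δ)
      (max (‖z.y - z'.y‖ / w.r) (‖z.x - z'.x‖ / w.ξ)))))

/-- `max {s|I-I'|, ρ|φ-φ'|, δ|p-p'|, δ|q-q'|, ξ|y-y'|, r|x-x'|}`. -/
def symplDist (w : Widths) (z z' : Phase n m) : ℝ :=
  max (w.s * euclNorm (z.I - z'.I)) (max (w.ρ * euclNorm (z.φ - z'.φ))
    (max (w.δ * euclNorm (z.p - z'.p)) (max (w.δ * euclNorm (z.q - z'.q))
      (max (w.ξ * ‖z.y - z'.y‖) (w.r * ‖z.x - z'.x‖)))))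

end NormalForm

end

/-! The perturbation is averaged `N` times by time-one flows of Hamiltonians χ. At each step f = f̄
+ f̃, where f̄ collects the resonant indices (0, h, h), and χ is chosen with L_χ h₀ = -f̃. Put A =
ω_I/ω_y and B = ω_J/ω_y; the equation reads ∂_x χ + A·∂_φ χ + B·(q ∂_q - p ∂_p) χ = f̃/ω_y. Along
its characteristics y, I and J are constant and x moves with unit speed, so it is solved by
integration in x from a point x₀ of Ξ. A Taylor-Fourier term is never divided by a combination of
frequencies; it is multiplied by an exponential whose rate is linear in the index. Such a growth is
exactly a change of weights: s decreases by 𝒳α and δ by the factor e^{𝒳β}, if α and β bound A and B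
(`hasMajorant_homTerm`, `exists_homological`). The two slope hypotheses make this a loss of the
fraction 1/(4N) of the widths, hence `N` steps are affordable.

Since L_χ h₀ is exactly -f̃, the Lie series of h₀ is controlled by that of f̃, and h₀ itself is
never estimated (`hasSum_lie_remainder`). The new remainder is of the size of {χ, g + f}, g being
the normal form found so far (`Unperturbed.exists_step`).

The smallness condition is linear in `N` for the following reason. The first step gives up fixed
fractions of the widths beyond the loss 1/(4N) of the homological equation, which bounds the
gradient of the average of f₀ without a factor `N` and leaves a remainder ε₁ ≲ q ε₀, where q = (𝒳/d)
‖1/ω_y‖ ‖f₀‖. The later steps lose a fraction of order τ ~ 1/N each. They need the size of χ below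
τ² d, but χ already carries q², and they divide the remainder by 4 as soon as q ≲ τ. The increments
of g have total gradient of order ε₁/τ ≲ ε₀, so the gradient stays bounded
(`Unperturbed.exists_first_stage`, `Unperturbed.exists_next_stage`,
`Unperturbed.exists_normalForm`).

Estimates are made with `HasMajorant`, a series with possibly repeated indices and a bound for its
weighted sum; it is stable under sums, products, Cauchy estimates and Lie series. The norm of the
statement enters at the two ends only, through `hasMajorant_norm` and `HasMajorant.norm_le_ofReal`.
The dimension-free constant 4 in the displacement comes from Cauchy estimates for Euclidean
gradients (`hamField_bounds`) and from taking for x₀ the midpoint of Ξ (`exists_center`). -/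

open scoped ENNReal

noncomputable section

namespace NormalForm

/-! ### Cauchy estimates and holomorphic dependence on parameters. -/

section ComplexAnalysis

open Metric Set MeasureTheory Filter Topology

variable {E F : Type*} [NormedAddCommGroup E] [NormedSpace ℂ E] [NormedAddCommGroup F]
  [NormedSpace ℂ F]

/-- Cauchy's estimate for a directional derivative. -/
lemma norm_fderiv_apply_le {f : E → F} {z v : E} {R C : ℝ} (hR : 0 < R)
    (hd : ∀ ζ : ℂ, ‖ζ‖ < R → DifferentiableAt ℂ f (z + ζ • v))
    (hC : ∀ ζ : ℂ, ‖ζ‖ < R → ‖f (z + ζ • v)‖ ≤ C) : ‖fderiv ℂ f z v‖ ≤ C / R := by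
  have hg : ∀ ζ : ℂ, ‖ζ‖ < R → HasDerivAt (fun ζ : ℂ => f (z + ζ • v))
      (fderiv ℂ f (z + ζ • v) v) ζ := by
    intro ζ hζ
    have h1 : HasDerivAt (fun ζ : ℂ => z + ζ • v) v ζ := by
      simpa using ((hasDerivAt_id ζ).smul_const v).const_add z
    exact (hd ζ hζ).hasFDerivAt.comp_hasDerivAt ζ h1
  have h0 := (hg 0 (by simpa using hR)).deriv
  simp only [zero_smul, add_zero] at h0
  -- The hypotheses hold on the open disc only: the estimate is obtained on the circles of radius R'
  -- < R, and then R' tends to R.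
  have key : ∀ R' : ℝ, 0 < R' → R' < R → ‖fderiv ℂ f z v‖ * R' ≤ C := by
    intro R' h1 h2
    have := Complex.norm_deriv_le_of_forall_mem_sphere_norm_le (c := 0)
      (f := fun ζ : ℂ => f (z + ζ • v)) (C := C) h1 ?_ ?_
    · rw [h0] at this
      rwa [le_div_iff₀ h1] at this
    · refine DifferentiableOn.diffContOnCl ?_
      intro ζ hζ
      have : ‖ζ‖ ≤ R' := by
        simpa using (closure_ball_subset_closedBall hζ)
      exact (hg ζ (by linarith)).differentiableAt.differentiableWithinAt
    · intro ζ hζ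
      refine hC ζ ?_
      have : ‖ζ‖ = R' := by simpa using hζ
      linarith
  rw [le_div_iff₀ hR]
  have ht : Tendsto (fun R' : ℝ => ‖fderiv ℂ f z v‖ * R') (𝓝[<] R)
      (𝓝 (‖fderiv ℂ f z v‖ * R)) :=
    ((continuous_const.mul continuous_id).tendsto R).mono_left nhdsWithin_le_nhds
  refine le_of_tendsto ht ?_
  filter_upwards [Ioo_mem_nhdsLT hR] with R' hR'
  exact key R' hR'.1 hR'.2

lemma norm_fderiv_le_of_ball {f : E → F} {z : E} {R C : ℝ} (hR : 0 < R)
    (hd : DifferentiableOn ℂ f (ball z R)) (hC : ∀ x ∈ ball z R, ‖f x‖ ≤ C) :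
    ‖fderiv ℂ f z‖ ≤ C / R := by
  have hC0 : 0 ≤ C := (norm_nonneg _).trans (hC z (mem_ball_self hR))
  refine ContinuousLinearMap.opNorm_le_bound _ (by positivity) fun v => ?_
  rcases eq_or_ne v 0 with rfl | hv
  · simp
  have hv' : 0 < ‖v‖ := norm_pos_iff.mpr hv
  have hmem : ∀ ζ : ℂ, ‖ζ‖ < R / ‖v‖ → z + ζ • v ∈ ball z R := by
    intro ζ hζ
    rw [mem_ball, dist_eq_norm, add_sub_cancel_left, norm_smul]
    rwa [lt_div_iff₀ hv'] at hζ
  have := norm_fderiv_apply_le (f := f) (z := z) (v := v) (R := R / ‖v‖) (C := C)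
    (by positivity)
    (fun ζ hζ => (hd _ (hmem ζ hζ)).differentiableAt (isOpen_ball.mem_nhds (hmem ζ hζ)))
    (fun ζ hζ => hC _ (hmem ζ hζ))
  calc _ ≤ _ := this
    _ = _ := by field_simp

/-- A series of holomorphic functions with summable bounds may be differentiated termwise. -/
lemma hasFDerivAt_tsum_of_bounded {ι : Type*} [CompleteSpace F] {U : Set E} (hU : IsOpen U)
    {f : ι → E → F} {c : ι → ℝ} (hc : Summable c) (hf : ∀ i, DifferentiableOn ℂ (f i) U)
    (hb : ∀ i, ∀ z ∈ U, ‖f i z‖ ≤ c i) {z : E} (hz : z ∈ U) :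
    HasFDerivAt (fun z => ∑' i, f i z) (∑' i, fderiv ℂ (f i) z) z ∧
      Summable (fun i => fderiv ℂ (f i) z) := by
  obtain ⟨R, hR, hRU⟩ := Metric.isOpen_iff.mp hU z hz
  have hR2 : 0 < R / 2 := by positivity
  have hsub : ∀ x ∈ ball z (R / 2), ball x (R / 2) ⊆ U := fun x hx =>
    (ball_subset_ball' (by have := mem_ball.mp hx; linarith)).trans hRU
  have hbd : ∀ i, ∀ x ∈ ball z (R / 2), ‖fderiv ℂ (f i) x‖ ≤ c i * (R / 2)⁻¹ := fun i x hx =>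
    norm_fderiv_le_of_ball hR2 ((hf i).mono (hsub x hx)) fun y hy => hb i y (hsub x hx hy)
  have hs : Summable fun i => c i * (R / 2)⁻¹ := hc.mul_right _
  have hzb := mem_ball_self (x := z) hR2
  refine ⟨hasFDerivAt_tsum_of_isPreconnected (s := ball z (R / 2)) (x₀ := z) hs isOpen_ball
    (convex_ball z _).isPreconnected (fun i x hx => ?_) hbd hzb
    (Summable.of_norm_bounded hc fun i => hb i z hz) hzb,
    Summable.of_norm_bounded hs fun i => hbd i z hzb⟩
  have hxU := hsub x hx (mem_ball_self hR2)
  exact ((hf i x hxU).differentiableAt (hU.mem_nhds hxU)).hasFDerivAt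

lemma differentiableOn_tsum_of_bounded {ι : Type*} [CompleteSpace F] {U : Set E} (hU : IsOpen U)
    {f : ι → E → F} {c : ι → ℝ} (hc : Summable c) (hf : ∀ i, DifferentiableOn ℂ (f i) U)
    (hb : ∀ i, ∀ z ∈ U, ‖f i z‖ ≤ c i) : DifferentiableOn ℂ (fun z => ∑' i, f i z) U :=
  fun _ hz => (hasFDerivAt_tsum_of_bounded hU hc hf hb hz).1.differentiableAt.differentiableWithinAt

/-- Differentiation under the integral sign for holomorphic integrands. -/
lemma hasFDerivAt_setIntegral [ProperSpace E] [CompleteSpace F] {T : Type*}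
    [TopologicalSpace T] [T2Space T] [MeasurableSpace T] [OpensMeasurableSpace T] {μ : Measure T}
    [IsFiniteMeasureOnCompacts μ] {K : Set T} (hK : IsCompact K) {U : Set E} (hU : IsOpen U)
    {f : T → E → F} (hc : ContinuousOn (Function.uncurry f) (K ×ˢ U))
    (hf : ∀ t ∈ K, DifferentiableOn ℂ (f t) U) {z : E} (hz : z ∈ U) :
    HasFDerivAt (fun z => ∫ t in K, f t z ∂μ) (∫ t in K, fderiv ℂ (f t) z ∂μ) z ∧
      ContinuousOn (fun t => fderiv ℂ (f t) z) K := by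
  obtain ⟨R, hR, hRU⟩ := Metric.nhds_basis_closedBall.mem_iff.mp (hU.mem_nhds hz)
  have hR2 : 0 < R / 2 := by positivity
  have hsub : ∀ x ∈ ball z (R / 2), ball x (R / 2) ⊆ closedBall z R := fun x hx =>
    (ball_subset_ball' (ε₂ := R) (y := z) (by have := mem_ball.mp hx; linarith)).trans
      ball_subset_closedBall
  have hcK : IsCompact (K ×ˢ closedBall z R) := hK.prod (isCompact_closedBall z R)
  have hcont := hc.mono (prod_mono_right (s := K) hRU)
  obtain ⟨B, hB⟩ := (hcK.image_of_continuousOn hcont).isBounded.exists_norm_le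
  have hB' : ∀ t ∈ K, ∀ x ∈ closedBall z R, ‖f t x‖ ≤ B := fun t ht x hx =>
    hB _ ⟨(t, x), ⟨ht, hx⟩, rfl⟩
  have hzR : z ∈ ball z (R / 2) := mem_ball_self hR2
  have hslice : ∀ x ∈ U, ContinuousOn (fun t => f t x) K := fun x hx =>
    hc.comp (f := fun t => (t, x)) (by fun_prop) fun t ht => ⟨ht, hx⟩
  -- Cauchy's estimate applied to f t - f t₀, which by compactness is small on the whole closed ball
  -- when t is close to t₀.
  have hder : ContinuousOn (fun t => fderiv ℂ (f t) z) K := by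
    intro t₀ ht₀
    rw [ContinuousWithinAt, Metric.tendsto_nhds]
    intro ε hε
    obtain ⟨v, hv, hv'⟩ := IsCompact.mem_uniformity_of_prod (isCompact_closedBall z R) hcont ht₀
      (Metric.dist_mem_uniformity (α := F) (show 0 < ε * (R / 4) by positivity))
    filter_upwards [hv, self_mem_nhdsWithin] with t htv htK
    have hdz : ∀ t ∈ K, DifferentiableAt ℂ (f t) z := fun t ht =>
      (hf t ht z hz).differentiableAt (hU.mem_nhds hz)
    have hb : ball z (R / 2) ⊆ closedBall z R :=
      (ball_subset_ball (by linarith)).trans ball_subset_closedBall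
    have := norm_fderiv_le_of_ball (f := fun x => f t x - f t₀ x) (C := ε * (R / 4)) hR2
      (((hf t htK).sub (hf t₀ ht₀)).mono (hb.trans hRU)) fun x hx => by
        have := hv' t htv x (hb hx)
        simp only [mem_ofPred_eq, dist_eq_norm] at this
        exact this.le
    rw [fderiv_fun_sub (hdz t htK) (hdz t₀ ht₀)] at this
    rw [dist_eq_norm]
    refine this.trans_lt ?_
    have : ε * (R / 4) / (R / 2) = ε / 2 := by field_simp; norm_num
    rw [this]; linarith
  refine ⟨?_, hder⟩
  have hKm := hK.measurableSet
  refine hasFDerivAt_integral_of_dominated_of_fderiv_le (F := fun z t => f t z)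
    (F' := fun x t => fderiv ℂ (f t) x)
    (s := ball z (R / 2)) (bound := fun _ => B / (R / 2)) (isOpen_ball.mem_nhds hzR) ?_ ?_ ?_ ?_ ?_ ?_
  · filter_upwards [hU.mem_nhds hz] with x hx
    exact (hslice x hx).aestronglyMeasurable_of_isCompact hK hKm
  · exact (hslice z hz).integrableOn_compact hK
  · exact hder.aestronglyMeasurable_of_isCompact hK hKm
  · refine (ae_restrict_iff' hKm).mpr (Eventually.of_forall fun t ht x hx => ?_)
    exact norm_fderiv_le_of_ball hR2 ((hf t ht).mono ((hsub x hx).trans hRU)) fun y hy =>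
      hB' t ht y (hsub x hx hy)
  · exact continuousOn_const.integrableOn_compact hK
  · refine (ae_restrict_iff' hKm).mpr (Eventually.of_forall fun t ht x hx => ?_)
    have hxU := hRU (hsub x hx (mem_ball_self hR2))
    exact ((hf t ht x hxU).differentiableAt (hU.mem_nhds hxU)).hasFDerivAt

lemma differentiableOn_setIntegral [ProperSpace E] [CompleteSpace F] {T : Type*}
    [TopologicalSpace T] [T2Space T] [MeasurableSpace T] [OpensMeasurableSpace T] {μ : Measure T}
    [IsFiniteMeasureOnCompacts μ] {K : Set T} (hK : IsCompact K) {U : Set E} (hU : IsOpen U)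
    {f : T → E → F} (hc : ContinuousOn (Function.uncurry f) (K ×ˢ U))
    (hf : ∀ t ∈ K, DifferentiableOn ℂ (f t) U) :
    DifferentiableOn ℂ (fun z => ∫ t in K, f t z ∂μ) U :=
  fun _ hz => (hasFDerivAt_setIntegral hK hU hc hf hz).1.differentiableAt.differentiableWithinAt

/-- Directional derivatives of a holomorphic function are holomorphic. -/
lemma DifferentiableOn.fderiv_apply [ProperSpace E] [CompleteSpace F] {f : E → F} {U : Set E}
    (hU : IsOpen U) (hf : DifferentiableOn ℂ f U) (v : E) :
    DifferentiableOn ℂ (fun z => fderiv ℂ f z v) U := by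
  intro z₀ hz₀
  obtain ⟨R, hR, hRU⟩ := Metric.nhds_basis_closedBall.mem_iff.mp (hU.mem_nhds hz₀)
  obtain ⟨ε, hε, hεR⟩ : ∃ ε : ℝ, 0 < ε ∧ ε * ‖v‖ < R / 2 :=
    ⟨R / 2 / (‖v‖ + 1), by positivity, by
      rw [div_mul_eq_mul_div, div_lt_iff₀ (by positivity)]
      nlinarith [norm_nonneg v]⟩
  have hmem : ∀ z ∈ ball z₀ (R / 2), ∀ ζ : ℂ, ‖ζ‖ ≤ ε → z + ζ • v ∈ U := by
    intro z hz ζ hζ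
    refine hRU ?_
    rw [mem_closedBall, dist_eq_norm]
    rw [mem_ball, dist_eq_norm] at hz
    calc ‖z + ζ • v - z₀‖ = ‖(z - z₀) + ζ • v‖ := by congr 1; abel
      _ ≤ ‖z - z₀‖ + ‖ζ‖ * ‖v‖ := (norm_add_le _ _).trans (by rw [norm_smul])
      _ ≤ R := by nlinarith [norm_nonneg v]
  have hline : ∀ z ∈ ball z₀ (R / 2), ∀ ζ : ℂ, ‖ζ‖ ≤ ε →
      HasDerivAt (fun ζ : ℂ => f (z + ζ • v)) (fderiv ℂ f (z + ζ • v) v) ζ := by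
    intro z hz ζ hζ
    have h1 : HasDerivAt (fun ζ : ℂ => z + ζ • v) v ζ := by
      simpa using ((hasDerivAt_id ζ).smul_const v).const_add z
    have hm := hmem z hz ζ hζ
    exact ((hf _ hm).differentiableAt (hU.mem_nhds hm)).hasFDerivAt.comp_hasDerivAt ζ h1
  -- Cauchy's formula for the derivative on the complex line through z in the direction v. The
  -- radius ε does not depend on z, so that the integrand is holomorphic in z and
  -- `differentiableOn_setIntegral` applies.
  let G : ℝ → E → F := fun θ z => deriv (circleMap 0 ε) θ •
    ((1 / (circleMap 0 ε θ - 0) ^ 2) • f (z + circleMap 0 ε θ • v))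
  have hcm : ∀ θ, ‖circleMap 0 ε θ‖ = ε := fun θ => by
    simp [abs_of_pos hε]
  have hcm0 : ∀ θ, circleMap 0 ε θ ≠ 0 := fun θ h => by
    have := hcm θ; rw [h, norm_zero] at this; linarith
  have hformula : ∀ z ∈ ball z₀ (R / 2), fderiv ℂ f z v =
      (2 * (Real.pi : ℂ) * Complex.I)⁻¹ • ∫ θ in Icc 0 (2 * Real.pi), G θ z := by
    intro z hz
    have := DiffContOnCl.deriv_eq_smul_circleIntegral (c := 0)
      (f := fun ζ : ℂ => f (z + ζ • v)) hε (DifferentiableOn.diffContOnCl fun ζ hζ => by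
        have : ‖ζ‖ ≤ ε := by simpa using (closure_ball_subset_closedBall hζ)
        exact (hline z hz ζ this).differentiableAt.differentiableWithinAt)
    rw [circleIntegral_def_Icc] at this
    rw [this, (hline z hz 0 (by simpa using hε.le)).deriv, smul_smul, inv_mul_cancel₀
      Complex.two_pi_I_ne_zero, one_smul, zero_smul, add_zero]
  have hGc : ContinuousOn (Function.uncurry G) (Icc 0 (2 * Real.pi) ×ˢ ball z₀ (R / 2)) := by
    have h1 : Continuous fun θ : ℝ => deriv (circleMap 0 ε) θ := by
      simp only [deriv_circleMap]; fun_prop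
    have h2 : Continuous fun θ : ℝ => (1 / (circleMap 0 ε θ - 0) ^ 2) :=
      continuous_const.div (by fun_prop) fun θ => by simpa using hcm0 θ
    refine ((h1.comp continuous_fst).continuousOn).smul
      (((h2.comp continuous_fst).continuousOn).smul
        (hf.continuousOn.comp (Continuous.continuousOn (by fun_prop)) ?_))
    rintro ⟨θ, z⟩ ⟨-, hz⟩
    exact hmem z hz _ (hcm θ).le
  have hGd : ∀ θ ∈ Icc 0 (2 * Real.pi), DifferentiableOn ℂ (G θ) (ball z₀ (R / 2)) := by
    intro θ _
    refine DifferentiableOn.const_smul (DifferentiableOn.const_smul ?_ _) _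
    exact hf.comp (by fun_prop) fun z hz => hmem z hz _ (hcm θ).le
  have hz₀' := mem_ball_self (x := z₀) (half_pos hR)
  have := (differentiableOn_setIntegral (μ := volume) isCompact_Icc isOpen_ball hGc hGd).const_smul
    ((2 * (Real.pi : ℂ) * Complex.I)⁻¹)
  refine ((this.congr hformula) z₀ hz₀').differentiableAt
    (isOpen_ball.mem_nhds hz₀') |>.differentiableWithinAt

/-- In finite dimension a linear map is a fixed linear combination of its values on a basis, so
directional derivatives suffice. -/
lemma DifferentiableOn.fderiv_of_isOpen [FiniteDimensional ℂ E] [CompleteSpace F] {f : E → F}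
    {U : Set E} (hU : IsOpen U) (hf : DifferentiableOn ℂ f U) :
    DifferentiableOn ℂ (fderiv ℂ f) U := by
  have : ProperSpace E := FiniteDimensional.proper ℂ E
  let b := Module.finBasis ℂ E
  have h : ∀ L : E →L[ℂ] F, L = ∑ i, (LinearMap.toContinuousLinearMap (b.coord i)).smulRight
      (L (b i)) := by
    intro L
    ext v
    conv_lhs => rw [← b.sum_repr v, map_sum]
    simp
  have : fderiv ℂ f = fun z => ∑ i, (LinearMap.toContinuousLinearMap (b.coord i)).smulRight
      (fderiv ℂ f z (b i)) := funext fun z => h _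
  rw [this]
  refine DifferentiableOn.fun_sum fun i _ => ?_
  have hi := DifferentiableOn.fderiv_apply hU hf (b i)
  exact (((ContinuousLinearMap.smulRightL ℂ E F)
    (LinearMap.toContinuousLinearMap (b.coord i))).differentiable.comp_differentiableOn hi)

/-- `s ↦ s ∫₀¹ G(ts) dt` is a primitive of `G` where `G` is holomorphic on a star-shaped set. -/
lemma hasDerivAt_smul_integral [CompleteSpace F] {G : ℂ → F} {U : Set ℂ} (hU : IsOpen U)
    (hstar : StarConvex ℝ 0 U) (hG : DifferentiableOn ℂ G U) {s : ℂ} (hs : s ∈ U) :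
    HasDerivAt (fun s : ℂ => s • ∫ t in Icc (0 : ℝ) 1, G (t • s)) (G s) s := by
  have hmem : ∀ t ∈ Icc (0 : ℝ) 1, ∀ s ∈ U, t • s ∈ U := fun t ht s hs =>
    hstar.smul_mem hs ht.1 ht.2
  have hc : ContinuousOn (Function.uncurry fun (t : ℝ) (s : ℂ) => G (t • s)) (Icc 0 1 ×ˢ U) :=
    hG.continuousOn.comp (Continuous.continuousOn (by fun_prop)) fun x hx => hmem _ hx.1 _ hx.2
  have hd : ∀ t ∈ Icc (0 : ℝ) 1, DifferentiableOn ℂ (fun s : ℂ => G (t • s)) U := by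
    intro t ht
    exact hG.comp (differentiable_id.const_smul t).differentiableOn (hmem t ht)
  obtain ⟨h1, h2⟩ := hasFDerivAt_setIntegral (μ := volume) isCompact_Icc hU hc hd hs
  have h3 := h1.hasDerivAt
  have hG' : ∀ t ∈ Icc (0 : ℝ) 1, HasDerivAt G (deriv G (t • s)) (t • s) := fun t ht =>
    ((hG _ (hmem t ht s hs)).differentiableAt (hU.mem_nhds (hmem t ht s hs))).hasDerivAt
  have hfd : ∀ t ∈ Icc (0 : ℝ) 1, fderiv ℂ (fun s : ℂ => G (t • s)) s 1 = (t : ℂ) • deriv G (t • s) := by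
    intro t ht
    rw [fderiv_apply_one_eq_deriv]
    have h4 : HasDerivAt (fun s : ℂ => t • s) (t : ℂ) s := by
      simpa using (hasDerivAt_id s).const_mul (t : ℂ)
    exact (HasDerivAt.scomp s (hG' t ht) h4).deriv
  have hGint : ContinuousOn (fun t : ℝ => G (t • s)) (Icc 0 1) :=
    hG.continuousOn.comp (Continuous.continuousOn (by fun_prop)) fun t ht => hmem t ht s hs
  have hdint : ContinuousOn (fun t : ℝ => (t : ℂ) • deriv G (t • s)) (Icc 0 1) :=
    (h2.clm_apply continuousOn_const).congr fun t ht => (hfd t ht).symm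
  have h5 := (hasDerivAt_id s).smul h3
  refine HasDerivAt.congr_deriv (f := fun s : ℂ => s • ∫ t in Icc (0 : ℝ) 1, G (t • s)) h5 ?_
  symm
  rw [ContinuousLinearMap.integral_apply (h2.integrableOn_compact isCompact_Icc),
    setIntegral_congr_fun measurableSet_Icc hfd]
  -- The product rule gives ∫ G(ts) dt + s ∫ t G'(ts) dt, which is the integral of d/dt (t G(ts)).
  have hftc : ∫ t in (0 : ℝ)..1, (G (t • s) + t • (s • deriv G (t • s))) =
      (1 : ℝ) • G ((1 : ℝ) • s) - (0 : ℝ) • G ((0 : ℝ) • s) := by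
    refine intervalIntegral.integral_eq_sub_of_hasDerivAt (f := fun t : ℝ => t • G (t • s)) ?_ ?_
    · intro t ht
      rw [uIcc_of_le zero_le_one] at ht
      have h6 : HasDerivAt (fun t : ℝ => t • s) s t := by
        simpa using (hasDerivAt_id t).smul_const s
      have h7 := HasDerivAt.scomp t ((hG' t ht)) h6
      have h8 := (hasDerivAt_id t).smul h7
      simp only [id, one_smul] at h8
      rw [add_comm]
      exact h8
    · refine ContinuousOn.intervalIntegrable ?_
      rw [uIcc_of_le zero_le_one]
      refine hGint.add ?_
      refine (hdint.const_smul s).congr fun t _ => ?_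
      simp only [Pi.smul_apply, smul_smul, mul_comm, ← Complex.coe_smul]
  rw [intervalIntegral.integral_of_le zero_le_one, ← integral_Icc_eq_integral_Ioc] at hftc
  simp only [one_smul, zero_smul, sub_zero] at hftc
  rw [← hftc, integral_add (hGint.integrableOn_compact isCompact_Icc), add_comm]
  · congr 1
    · simp only [id]
      rw [← integral_smul]
      refine integral_congr_ae (Eventually.of_forall fun t => ?_)
      simp only [smul_smul, mul_comm, ← Complex.coe_smul]
    · simp
  · refine ContinuousOn.integrableOn_compact isCompact_Icc ?_
    refine (hdint.const_smul s).congr fun t _ => ?_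
    simp only [Pi.smul_apply, smul_smul, mul_comm, ← Complex.coe_smul]

end ComplexAnalysis

end NormalForm

namespace NormalForm

/-! ### Flows of small holomorphic vector fields in complex time, and Lie series. -/

section Flow

open Metric Set MeasureTheory Filter Topology

variable {E : Type*} [NormedAddCommGroup E] [NormedSpace ℂ E]

/-- Picard iterates, in complex time, for the autonomous equation `ż = X z`. -/
def picardIter (X : E → E) : ℕ → ℂ × E → E
  | 0 => fun p => p.2
  | k + 1 => fun p => p.2 + p.1 • ∫ t in Icc (0 : ℝ) 1, X (picardIter X k (t • p.1, p.2))

/-- The limit of the Picard iterates. -/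
def picardFlow (X : E → E) (t : ℂ) (z : E) : E :=
  z + ∑' k, (picardIter X (k + 1) (t, z) - picardIter X k (t, z))

/-- Lie derivative of a function along a vector field. -/
def lieDeriv (X : E → E) (G : E → ℂ) : E → ℂ := fun z => fderiv ℂ G z (X z)

/-- A holomorphic vector field on `U`, small with respect to the distance `3η` between `V` and the
complement of `U`. -/
structure SmallField (X : E → E) (U V : Set E) (η : ℝ) : Prop where
  pos : 0 < η
  openU : IsOpen U
  openV : IsOpen V
  diff : DifferentiableOn ℂ X U
  bound : ∀ z ∈ U, ‖X z‖ ≤ η / 8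
  ball_subset : ∀ z ∈ V, ball z (3 * η) ⊆ U

namespace SmallField

variable {X : E → E} {U V : Set E} {η : ℝ}

lemma smul_time_mem {t : ℝ} (ht : t ∈ Icc (0 : ℝ) 1) {p : ℂ × E} (hp : p ∈ ball (0 : ℂ) 2 ×ˢ V) :
    (t • p.1, p.2) ∈ ball (0 : ℂ) 2 ×ˢ V := by
  refine ⟨?_, hp.2⟩
  have h1 := hp.1
  simp only [mem_ball, dist_zero_right, norm_smul, Real.norm_eq_abs, abs_of_nonneg ht.1] at h1 ⊢
  calc t * ‖p.1‖ ≤ 1 * ‖p.1‖ := by gcongr; exact ht.2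
    _ < 2 := by linarith

lemma mem_of_norm_sub_le (h : SmallField X U V η) {z x : E} (hz : z ∈ V)
    (hx : ‖x - z‖ ≤ η / 4) : x ∈ U :=
  h.ball_subset z hz (by rw [mem_ball, dist_eq_norm]; linarith [h.pos])

/-- Cauchy's estimate on balls of radius η turns the bound η/8 of the field into the Lipschitz
constant 1/8; the collar of width 3η contains all these balls. -/
lemma lipschitz (h : SmallField X U V η) {z x x' : E} (hz : z ∈ V) (hx : ‖x - z‖ ≤ η / 4)
    (hx' : ‖x' - z‖ ≤ η / 4) : ‖X x - X x'‖ ≤ 1 / 8 * ‖x - x'‖ := by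
  have hη := h.pos
  have hsub : ∀ y ∈ ball z η, ball y η ⊆ U := fun y hy =>
    (ball_subset_ball' (by have := mem_ball.mp hy; linarith)).trans (h.ball_subset z hz)
  refine Convex.norm_image_sub_le_of_norm_fderiv_le (𝕜 := ℂ) (s := ball z η) (fun y hy => ?_)
    (fun y hy => ?_) (convex_ball z η) ?_ ?_
  · have hyU := hsub y hy (mem_ball_self hη)
    exact (h.diff y hyU).differentiableAt (h.openU.mem_nhds hyU)
  · calc _ ≤ η / 8 / η := norm_fderiv_le_of_ball hη (h.diff.mono (hsub y hy)) fun x hx =>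
          h.bound x (hsub y hy hx)
      _ = 1 / 8 := by field_simp
  · rw [mem_ball, dist_eq_norm]; linarith
  · rw [mem_ball, dist_eq_norm]; linarith

variable [FiniteDimensional ℂ E]

/-- The two claims are proved together, because the displacement bound keeps the iterate in U, where
the field is defined. It reproduces itself: a time below 2 and a speed at most η/8 give η/4. -/
lemma picardIter_spec (h : SmallField X U V η) (k : ℕ) :
    DifferentiableOn ℂ (picardIter X k) (ball (0 : ℂ) 2 ×ˢ V) ∧
      ∀ p ∈ ball (0 : ℂ) 2 ×ˢ V, ‖picardIter X k p - p.2‖ ≤ η / 4 := by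
  have : ProperSpace E := FiniteDimensional.proper ℂ E
  induction k with
  | zero =>
    refine ⟨differentiableOn_snd, fun p _ => ?_⟩
    have := h.pos
    simp only [picardIter, sub_self, norm_zero]
    positivity
  | succ k ih =>
    obtain ⟨ih1, ih2⟩ := ih
    have hmem : ∀ t ∈ Icc (0 : ℝ) 1, ∀ p ∈ ball (0 : ℂ) 2 ×ˢ V,
        picardIter X k (t • p.1, p.2) ∈ U := fun t ht p hp =>
      h.mem_of_norm_sub_le hp.2 (ih2 _ (smul_time_mem ht hp))
    constructor
    · refine differentiableOn_snd.add (differentiableOn_fst.smul ?_)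
      refine differentiableOn_setIntegral (μ := volume)
        (f := fun (t : ℝ) (p : ℂ × E) => X (picardIter X k (t • p.1, p.2))) isCompact_Icc
        (isOpen_ball.prod h.openV) ?_ ?_
      · refine h.diff.continuousOn.comp (ih1.continuousOn.comp (f := fun q : ℝ × (ℂ × E) =>
          (q.1 • q.2.1, q.2.2)) (Continuous.continuousOn (by fun_prop)) ?_) ?_
        · exact fun q hq => smul_time_mem hq.1 hq.2
        · exact fun q hq => hmem _ hq.1 _ hq.2
      · intro t ht
        refine h.diff.comp (ih1.comp (f := fun q : ℂ × E => (t • q.1, q.2)) ?_ ?_) ?_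
        · exact ((differentiable_fst.const_smul t).prodMk differentiable_snd).differentiableOn
        · exact fun q hq => smul_time_mem ht hq
        · exact fun q hq => hmem t ht q hq
    · intro p hp
      simp only [picardIter, add_sub_cancel_left, norm_smul]
      have h1 : ‖∫ t in Icc (0 : ℝ) 1, X (picardIter X k (t • p.1, p.2))‖ ≤ η / 8 := by
        have := norm_setIntegral_le_of_norm_le_const (μ := volume) (s := Icc (0 : ℝ) 1)
          (f := fun t => X (picardIter X k (t • p.1, p.2))) (C := η / 8) (by simp)
          fun t ht => h.bound _ (hmem t ht p hp)
        simpa using this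
      have h2 : ‖p.1‖ ≤ 2 := by simpa using (mem_ball.mp hp.1).le
      calc _ ≤ 2 * (η / 8) := by gcongr
        _ = _ := by ring

lemma integrand_mem (h : SmallField X U V η) (k : ℕ) {t : ℝ} (ht : t ∈ Icc (0 : ℝ) 1) {p : ℂ × E}
    (hp : p ∈ ball (0 : ℂ) 2 ×ˢ V) : picardIter X k (t • p.1, p.2) ∈ U :=
  h.mem_of_norm_sub_le hp.2 ((h.picardIter_spec k).2 _ (smul_time_mem ht hp))

lemma continuousOn_integrand (h : SmallField X U V η) (k : ℕ) {p : ℂ × E}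
    (hp : p ∈ ball (0 : ℂ) 2 ×ˢ V) :
    ContinuousOn (fun t : ℝ => X (picardIter X k (t • p.1, p.2))) (Icc 0 1) :=
  h.diff.continuousOn.comp ((h.picardIter_spec k).1.continuousOn.comp (f := fun t : ℝ =>
    (t • p.1, p.2)) (Continuous.continuousOn (by fun_prop)) fun _ ht => smul_time_mem ht hp)
    fun _ ht => h.integrand_mem k ht hp

/-- A Picard step contracts by 2 · 1/8 = 1/4; the ratio 1/2 is more than enough for convergence. -/
lemma norm_picardIter_succ_sub_le (h : SmallField X U V η) (k : ℕ) :
    ∀ p ∈ ball (0 : ℂ) 2 ×ˢ V,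
      ‖picardIter X (k + 1) p - picardIter X k p‖ ≤ η / 4 * (1 / 2) ^ k := by
  induction k with
  | zero =>
    intro p hp
    simpa [picardIter] using (h.picardIter_spec 1).2 p hp
  | succ k ih =>
    intro p hp
    have e : picardIter X (k + 1 + 1) p - picardIter X (k + 1) p =
        p.1 • ∫ t in Icc (0 : ℝ) 1, (X (picardIter X (k + 1) (t • p.1, p.2)) -
          X (picardIter X k (t • p.1, p.2))) := by
      rw [integral_sub ((h.continuousOn_integrand _ hp).integrableOn_compact isCompact_Icc)
        ((h.continuousOn_integrand _ hp).integrableOn_compact isCompact_Icc)]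
      simp only [picardIter, smul_sub]
      abel
    have hη := h.pos
    have h1 : ‖∫ t in Icc (0 : ℝ) 1, (X (picardIter X (k + 1) (t • p.1, p.2)) -
          X (picardIter X k (t • p.1, p.2)))‖ ≤ 1 / 8 * (η / 4 * (1 / 2) ^ k) := by
      have := norm_setIntegral_le_of_norm_le_const (μ := volume) (s := Icc (0 : ℝ) 1)
        (f := fun t => X (picardIter X (k + 1) (t • p.1, p.2)) -
          X (picardIter X k (t • p.1, p.2))) (C := 1 / 8 * (η / 4 * (1 / 2) ^ k)) (by simp)
        fun t ht => (h.lipschitz (z := p.2) hp.2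
          ((h.picardIter_spec (k + 1)).2 (t • p.1, p.2) (smul_time_mem ht hp))
          ((h.picardIter_spec k).2 (t • p.1, p.2) (smul_time_mem ht hp))).trans
            (mul_le_mul_of_nonneg_left (ih _ (smul_time_mem ht hp)) (by norm_num))
      simpa using this
    have h2 : ‖p.1‖ ≤ 2 := by simpa using (mem_ball.mp hp.1).le
    rw [e, norm_smul]
    calc _ ≤ 2 * (1 / 8 * (η / 4 * (1 / 2) ^ k)) := by gcongr
      _ ≤ η / 4 * (1 / 2) ^ (k + 1) := by
        rw [pow_succ]
        have : 0 ≤ η / 4 * (1 / 2) ^ k := by positivity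
        linarith

lemma summable_bound : Summable fun k : ℕ => η / 4 * (1 / 2 : ℝ) ^ k :=
  (summable_geometric_of_lt_one (by norm_num) (by norm_num)).mul_left _

lemma tendsto_picardIter (h : SmallField X U V η) {p : ℂ × E} (hp : p ∈ ball (0 : ℂ) 2 ×ˢ V) :
    Tendsto (fun k => picardIter X k p) atTop (𝓝 (picardFlow X p.1 p.2)) := by
  have : CompleteSpace E := FiniteDimensional.complete ℂ E
  have hs : Summable fun k => picardIter X (k + 1) p - picardIter X k p :=
    Summable.of_norm_bounded summable_bound fun k => h.norm_picardIter_succ_sub_le k p hp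
  have h2 := hs.hasSum.tendsto_sum_nat.const_add (picardIter X 0 p)
  refine h2.congr fun k => ?_
  rw [Finset.sum_range_sub (fun k => picardIter X k p)]
  abel

lemma differentiableOn_picardFlow (h : SmallField X U V η) :
    DifferentiableOn ℂ (Function.uncurry (picardFlow X)) (ball (0 : ℂ) 2 ×ˢ V) := by
  have : CompleteSpace E := FiniteDimensional.complete ℂ E
  refine differentiableOn_snd.add (differentiableOn_tsum_of_bounded
    (f := fun k p => picardIter X (k + 1) p - picardIter X k p)
    (isOpen_ball.prod h.openV) summable_bound (fun k => ?_)
    fun k p hp => h.norm_picardIter_succ_sub_le k p hp)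
  exact (h.picardIter_spec (k + 1)).1.sub (h.picardIter_spec k).1

lemma norm_picardFlow_sub_le (h : SmallField X U V η) {t : ℂ} (ht : t ∈ ball (0 : ℂ) 2) {z : E}
    (hz : z ∈ V) : ‖picardFlow X t z - z‖ ≤ η / 4 :=
  le_of_tendsto ((h.tendsto_picardIter (p := (t, z)) ⟨ht, hz⟩).sub_const z).norm
    (Eventually.of_forall fun k => (h.picardIter_spec k).2 (t, z) ⟨ht, hz⟩)

lemma picardFlow_mem (h : SmallField X U V η) {t : ℂ} (ht : t ∈ ball (0 : ℂ) 2) {z : E}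
    (hz : z ∈ V) : picardFlow X t z ∈ U :=
  h.mem_of_norm_sub_le hz (h.norm_picardFlow_sub_le ht hz)

lemma picardFlow_eq (h : SmallField X U V η) {t : ℂ} (ht : t ∈ ball (0 : ℂ) 2) {z : E}
    (hz : z ∈ V) : picardFlow X t z =
      z + t • ∫ u in Icc (0 : ℝ) 1, X (picardFlow X (u • t) z) := by
  have hp : (t, z) ∈ ball (0 : ℂ) 2 ×ˢ V := ⟨ht, hz⟩
  have h1 := (h.tendsto_picardIter hp).comp (tendsto_add_atTop_nat 1)
  refine tendsto_nhds_unique h1 ?_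
  refine Tendsto.const_add _ (Tendsto.const_smul ?_ _)
  refine tendsto_integral_of_dominated_convergence (fun _ => η / 8) (fun k => ?_)
    (integrable_const _) (fun k => ?_) ?_
  · exact (h.continuousOn_integrand k hp).aestronglyMeasurable_of_isCompact isCompact_Icc
      measurableSet_Icc
  · refine (ae_restrict_iff' measurableSet_Icc).mpr (Eventually.of_forall fun u hu => ?_)
    exact h.bound _ (h.integrand_mem k hu hp)
  · refine (ae_restrict_iff' measurableSet_Icc).mpr (Eventually.of_forall fun u hu => ?_)
    have hm := smul_time_mem hu hp
    have hU := h.picardFlow_mem hm.1 hm.2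
    exact ((h.diff _ hU).differentiableAt (h.openU.mem_nhds hU)).continuousAt.tendsto.comp
      (h.tendsto_picardIter hm)

lemma picardFlow_zero (h : SmallField X U V η) {z : E} (hz : z ∈ V) : picardFlow X 0 z = z := by
  simpa using h.picardFlow_eq (t := 0) (by simp) hz

lemma hasDerivAt_picardFlow (h : SmallField X U V η) {t : ℂ} (ht : t ∈ ball (0 : ℂ) 2) {z : E}
    (hz : z ∈ V) : HasDerivAt (fun t => picardFlow X t z) (X (picardFlow X t z)) t := by
  have : CompleteSpace E := FiniteDimensional.complete ℂ E
  have h1 : DifferentiableOn ℂ (fun t => X (picardFlow X t z)) (ball 0 2) := by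
    refine h.diff.comp (h.differentiableOn_picardFlow.comp (f := fun t : ℂ => (t, z))
      (by fun_prop) fun t ht => ⟨ht, hz⟩) fun t ht => h.picardFlow_mem ht hz
  have h2 := (hasDerivAt_smul_integral isOpen_ball
    ((convex_ball (0 : ℂ) 2).starConvex (by simp)) h1 ht).const_add z
  refine h2.congr_of_eventuallyEq ?_
  filter_upwards [isOpen_ball.mem_nhds ht] with s hs
  exact h.picardFlow_eq hs hz

/-- Equivariance holds for every Picard iterate and passes to the limit, without recourse to
uniqueness of solutions. It is needed for the translations of the angles by 2πℤⁿ. -/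
lemma picardFlow_add (h : SmallField X U V η) {c : E}
    (hc : ∀ x ∈ U, x + c ∈ U ∧ X (x + c) = X x) {z : E} (hz : z ∈ V) (hzc : z + c ∈ V) {t : ℂ}
    (ht : t ∈ ball (0 : ℂ) 2) : picardFlow X t (z + c) = picardFlow X t z + c := by
  have key : ∀ k : ℕ, ∀ t ∈ ball (0 : ℂ) 2,
      picardIter X k (t, z + c) = picardIter X k (t, z) + c := by
    intro k
    induction k with
    | zero => exact fun _ _ => rfl
    | succ k ih =>
      intro t ht
      have : ∫ u in Icc (0 : ℝ) 1, X (picardIter X k (u • t, z + c)) =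
          ∫ u in Icc (0 : ℝ) 1, X (picardIter X k (u • t, z)) := by
        refine setIntegral_congr_fun measurableSet_Icc fun u hu => ?_
        have hm := smul_time_mem hu (p := (t, z)) ⟨ht, hz⟩
        rw [ih _ hm.1, (hc _ (h.integrand_mem k hu ⟨ht, hz⟩)).2]
      simp only [picardIter, this]
      abel
  refine tendsto_nhds_unique (h.tendsto_picardIter (p := (t, z + c)) ⟨ht, hzc⟩) ?_
  have := (h.tendsto_picardIter (p := (t, z)) ⟨ht, hz⟩).add_const c
  exact this.congr fun k => (key k t ht).symm

lemma one_mem : (1 : ℂ) ∈ ball (0 : ℂ) 2 := by simp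

lemma differentiableOn_picardFlow_apply (h : SmallField X U V η) {t : ℂ}
    (ht : t ∈ ball (0 : ℂ) 2) : DifferentiableOn ℂ (picardFlow X t) V :=
  h.differentiableOn_picardFlow.comp (f := fun z : E => (t, z)) (by fun_prop) fun _ hz => ⟨ht, hz⟩

/-- Φ - id is bounded by η/4, so two points with the same image are at distance at most η/2. By
Cauchy's estimate Φ - id is 1/4-Lipschitz on the ball of radius η around one of them, and this
forces them to coincide. The second collar, between V' and V, makes room for that estimate. -/
lemma injOn_picardFlow (h : SmallField X U V η) {V' : Set E}
    (hV' : ∀ z ∈ V', ball z (3 * η) ⊆ V) : InjOn (picardFlow X 1) V' := by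
  intro z₁ hz₁ z₂ hz₂ heq
  have hη := h.pos
  have hsub : ∀ y ∈ ball z₁ η, ball y η ⊆ V := fun y hy =>
    (ball_subset_ball' (by have := mem_ball.mp hy; linarith)).trans (hV' z₁ hz₁)
  have hm1 : z₁ ∈ V := hV' z₁ hz₁ (mem_ball_self (by positivity))
  have hm2 : z₂ ∈ V := hV' z₂ hz₂ (mem_ball_self (by positivity))
  have hd : ‖z₂ - z₁‖ < η := by
    have e : z₂ - z₁ = (picardFlow X 1 z₁ - z₁) - (picardFlow X 1 z₂ - z₂) := by rw [heq]; abel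
    rw [e]
    have := norm_sub_le (picardFlow X 1 z₁ - z₁) (picardFlow X 1 z₂ - z₂)
    linarith [h.norm_picardFlow_sub_le one_mem hm1, h.norm_picardFlow_sub_le one_mem hm2]
  have hdiff := (h.differentiableOn_picardFlow_apply one_mem).sub (differentiableOn_id (𝕜 := ℂ))
  have := Convex.norm_image_sub_le_of_norm_fderiv_le (𝕜 := ℂ) (s := ball z₁ η) (C := 1 / 4)
    (f := picardFlow X 1 - id) (x := z₁) (y := z₂) (fun y hy => ?_)
    (fun y hy => ?_) (convex_ball z₁ η) (mem_ball_self hη) (by rwa [mem_ball, dist_eq_norm])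
  · simp only [Pi.sub_apply, id, heq] at this
    have e : picardFlow X 1 z₂ - z₂ - (picardFlow X 1 z₂ - z₁) = -(z₂ - z₁) := by abel
    rw [e, norm_neg] at this
    have h0 : ‖z₂ - z₁‖ = 0 := le_antisymm (by linarith) (norm_nonneg _)
    exact (sub_eq_zero.mp (norm_eq_zero.mp h0)).symm
  · have hyV := hsub y hy (mem_ball_self hη)
    exact (hdiff y hyV).differentiableAt (h.openV.mem_nhds hyV)
  · calc _ ≤ η / 4 / η := norm_fderiv_le_of_ball hη (hdiff.mono (hsub y hy)) fun x hx =>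
          h.norm_picardFlow_sub_le one_mem (hsub y hy hx)
      _ = 1 / 4 := by field_simp

/-- The equation of variations. -/
lemma hasDerivAt_fderiv_picardFlow (h : SmallField X U V η) {t : ℂ} (ht : t ∈ ball (0 : ℂ) 2)
    {z : E} (hz : z ∈ V) (u : E) :
    HasDerivAt (fun t => fderiv ℂ (picardFlow X t) z u)
      (fderiv ℂ X (picardFlow X t z) (fderiv ℂ (picardFlow X t) z u)) t := by
  have : CompleteSpace E := FiniteDimensional.complete ℂ E
  set Ψ := Function.uncurry (picardFlow X) with hΨ
  have hQ : IsOpen (ball (0 : ℂ) 2 ×ˢ V) := isOpen_ball.prod h.openV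
  have hΨd := h.differentiableOn_picardFlow
  have hat : ∀ q ∈ ball (0 : ℂ) 2 ×ˢ V, HasFDerivAt Ψ (fderiv ℂ Ψ q) q := fun q hq =>
    ((hΨd q hq).differentiableAt (hQ.mem_nhds hq)).hasFDerivAt
  have hq : (t, z) ∈ ball (0 : ℂ) 2 ×ˢ V := ⟨ht, hz⟩
  have hslice : ∀ s ∈ ball (0 : ℂ) 2, ∀ v, fderiv ℂ (picardFlow X s) z v =
      fderiv ℂ Ψ (s, z) (0, v) := by
    intro s hs v
    have h1 : HasFDerivAt (fun z : E => (s, z)) (ContinuousLinearMap.inr ℂ ℂ E) z :=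
      hasFDerivAt_prodMk_right s z
    have h2 := (hat (s, z) ⟨hs, hz⟩).comp z h1
    have h3 : HasFDerivAt (picardFlow X s) _ z := h2
    rw [h3.fderiv]
    simp
  have htime : ∀ q ∈ ball (0 : ℂ) 2 ×ˢ V, fderiv ℂ Ψ q (1, 0) = X (Ψ q) := by
    rintro ⟨s, x⟩ hsx
    have h1 : HasDerivAt (fun s : ℂ => (s, x)) (1, 0) s :=
      (hasDerivAt_id s).prodMk (hasDerivAt_const s x)
    have h2 := (hat (s, x) hsx).comp_hasDerivAt s h1
    exact h2.unique (h.hasDerivAt_picardFlow hsx.1 hsx.2)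
  have h2at : HasFDerivAt (fderiv ℂ Ψ) (fderiv ℂ (fderiv ℂ Ψ) (t, z)) (t, z) :=
    ((DifferentiableOn.fderiv_of_isOpen hQ hΨd _ hq).differentiableAt
      (hQ.mem_nhds hq)).hasFDerivAt
  -- The equation of variations is the symmetry of the mixed derivative of the joint flow Ψ(t, z):
  -- differentiating ∂_t Ψ = X(Ψ) along u gives the derivative in time of ∂_u Ψ.
  have hsymm := second_derivative_symmetric_of_eventually
    (Filter.eventually_of_mem (hQ.mem_nhds hq) hat) h2at (1, 0) (0, u)
  have hd1 : HasDerivAt (fun s : ℂ => fderiv ℂ Ψ (s, z) (0, u))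
      (fderiv ℂ (fderiv ℂ Ψ) (t, z) (1, 0) (0, u)) t := by
    have h1 : HasDerivAt (fun s : ℂ => (s, z)) (1, 0) t :=
      (hasDerivAt_id t).prodMk (hasDerivAt_const t z)
    have h3 := h2at.comp_hasDerivAt t h1
    have h4 := h3.clm_apply (hasDerivAt_const t ((0 : ℂ), u))
    simpa using h4
  have hd2 : fderiv ℂ (fderiv ℂ Ψ) (t, z) (0, u) (1, 0) =
      fderiv ℂ X (picardFlow X t z) (fderiv ℂ Ψ (t, z) (0, u)) := by
    have hU := h.picardFlow_mem ht hz
    have h5 : HasFDerivAt (fun q => fderiv ℂ Ψ q (1, 0)) _ (t, z) :=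
      h2at.clm_apply (hasFDerivAt_const ((1 : ℂ), (0 : E)) (t, z))
    have h6 : HasFDerivAt (fun q => X (Ψ q)) _ (t, z) :=
      ((h.diff _ hU).differentiableAt (h.openU.mem_nhds hU)).hasFDerivAt.comp (t, z) (hat _ hq)
    have h7 := h6.congr_of_eventuallyEq (Filter.eventually_of_mem (hQ.mem_nhds hq) htime)
    have h8 := congrArg (fun L => L (0, u)) (h5.unique h7)
    simpa using h8
  rw [hslice t ht, ← hd2, ← hsymm]
  refine hd1.congr_of_eventuallyEq ?_
  filter_upwards [isOpen_ball.mem_nhds ht] with s hs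
  exact hslice s hs u

/-- The flow of a vector field whose differential is infinitesimally symplectic is symplectic. -/
lemma form_fderiv_picardFlow (h : SmallField X U V η) (B : E →L[ℂ] E →L[ℂ] ℂ)
    (hB : ∀ x ∈ U, ∀ u v, B (fderiv ℂ X x u) v + B u (fderiv ℂ X x v) = 0) {z : E} (hz : z ∈ V)
    (u v : E) : B (fderiv ℂ (picardFlow X 1) z u) (fderiv ℂ (picardFlow X 1) z v) = B u v := by
  set f : ℂ → ℂ := fun t => B (fderiv ℂ (picardFlow X t) z u) (fderiv ℂ (picardFlow X t) z v)
  have hf : ∀ t ∈ ball (0 : ℂ) 2, HasDerivAt f 0 t := by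
    intro t ht
    have hu := h.hasDerivAt_fderiv_picardFlow ht hz u
    have hv := h.hasDerivAt_fderiv_picardFlow ht hz v
    have h1 := (B.hasFDerivAt.comp_hasDerivAt t hu).clm_apply hv
    refine h1.congr_deriv ?_
    exact hB _ (h.picardFlow_mem ht hz) _ _
  have hconst := isOpen_ball.is_const_of_deriv_eq_zero (𝕜 := ℂ) (f := f)
    (convex_ball (0 : ℂ) 2).isPreconnected
    (fun t ht => (hf t ht).differentiableAt.differentiableWithinAt)
    (fun t ht => (hf t ht).deriv) one_mem (mem_ball_self (by norm_num : (0 : ℝ) < 2))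
  have hid : fderiv ℂ (picardFlow X 0) z = ContinuousLinearMap.id ℂ E := by
    have : picardFlow X 0 =ᶠ[𝓝 z] id := by
      filter_upwards [h.openV.mem_nhds hz] with x hx
      exact h.picardFlow_zero hx
    rw [this.fderiv_eq, fderiv_id]
  simpa [f, hid] using hconst

lemma differentiableOn_lieDeriv_iterate (h : SmallField X U V η) {G : E → ℂ}
    (hG : DifferentiableOn ℂ G U) (k : ℕ) : DifferentiableOn ℂ ((lieDeriv X)^[k] G) U := by
  induction k with
  | zero => exact hG
  | succ k ih =>
    rw [Function.iterate_succ_apply']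
    exact (DifferentiableOn.fderiv_of_isOpen h.openU ih).clm_apply h.diff

/-- The Lie series. -/
lemma hasSum_lieDeriv (h : SmallField X U V η) {G : E → ℂ} (hG : DifferentiableOn ℂ G U) {z : E}
    (hz : z ∈ V) : HasSum (fun k : ℕ => ((k.factorial : ℂ))⁻¹ * (lieDeriv X)^[k] G z)
      (G (picardFlow X 1 z)) := by
  set f : ℂ → ℂ := fun t => G (picardFlow X t z)
  have hder : ∀ k, ∀ t ∈ ball (0 : ℂ) 2, HasDerivAt
      (fun t => (lieDeriv X)^[k] G (picardFlow X t z))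
      ((lieDeriv X)^[k + 1] G (picardFlow X t z)) t := by
    intro k t ht
    have hU := h.picardFlow_mem ht hz
    have h1 := ((h.differentiableOn_lieDeriv_iterate hG k _ hU).differentiableAt
      (h.openU.mem_nhds hU)).hasFDerivAt.comp_hasDerivAt t (h.hasDerivAt_picardFlow ht hz)
    rw [Function.iterate_succ_apply']
    exact h1
  have hit : ∀ k, ∀ t ∈ ball (0 : ℂ) 2,
      iteratedDeriv k f t = (lieDeriv X)^[k] G (picardFlow X t z) := by
    intro k
    induction k with
    | zero => intro t _; simp [f]
    | succ k ih =>
      intro t ht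
      rw [iteratedDeriv_succ]
      have : iteratedDeriv k f =ᶠ[𝓝 t] fun t => (lieDeriv X)^[k] G (picardFlow X t z) := by
        filter_upwards [isOpen_ball.mem_nhds ht] with s hs
        exact ih s hs
      rw [this.deriv_eq, (hder k t ht).deriv]
  have hfd : DifferentiableOn ℂ f (ball 0 2) := fun t ht =>
    (hder 0 t ht).differentiableAt.differentiableWithinAt
  -- The Lie series is the Taylor series at time 0 evaluated at time 1. This is why the flow is
  -- built on the disc of radius 2, which has 1 in its interior.
  have := Complex.hasSum_taylorSeries_on_ball hfd one_mem
  have h0 : (0 : ℂ) ∈ ball (0 : ℂ) 2 := by simp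
  simpa [hit _ 0 h0, h.picardFlow_zero hz] using this

end SmallField

end Flow

end NormalForm

namespace NormalForm

variable {n m : ℕ}

/-! ### Geometry of the complex domains. -/

section Geometry

open Metric Set

/-- Componentwise comparison of widths. -/
def Widths.Le (w w' : Widths) : Prop :=
  w.r ≤ w'.r ∧ w.ρ ≤ w'.ρ ∧ w.ξ ≤ w'.ξ ∧ w.s ≤ w'.s ∧ w.δ ≤ w'.δ

lemma Widths.Lt.le {w w' : Widths} (h : w.Lt w') : w.Le w' :=
  ⟨h.1.le, h.2.1.le, h.2.2.1.le, h.2.2.2.1.le, h.2.2.2.2.le⟩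

/-- The widths `(tr, tρ, tξ, ts, tδ)`. -/
def Widths.scale (w : Widths) (t : ℝ) : Widths :=
  ⟨t * w.r, t * w.ρ, t * w.ξ, t * w.s, t * w.δ⟩

lemma Widths.scale_one (w : Widths) : w.scale 1 = w := by simp [Widths.scale]

lemma Widths.third_eq_scale (w : Widths) : w.third = w.scale (1 / 3) := by
  simp only [Widths.scale, Widths.third, Widths.mk.injEq]
  refine ⟨?_, ?_, ?_, ?_, ?_⟩ <;> ring

lemma Widths.scale_le_scale {w : Widths} (hw : w.Pos) {t t' : ℝ} (h : t ≤ t') :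
    (w.scale t).Le (w.scale t') := by
  obtain ⟨h1, h2, h3, h4, h5⟩ := hw
  refine ⟨?_, ?_, ?_, ?_, ?_⟩ <;> simp only [Widths.scale] <;> gcongr

lemma Widths.scale_lt_scale {w : Widths} (hw : w.Pos) {t t' : ℝ} (h : t < t') :
    (w.scale t).Lt (w.scale t') := by
  obtain ⟨h1, h2, h3, h4, h5⟩ := hw
  refine ⟨?_, ?_, ?_, ?_, ?_⟩ <;> simp only [Widths.scale] <;> gcongr

lemma euclNorm_eq {k : ℕ} (v : Fin k → ℂ) : euclNorm v = ‖WithLp.toLp 2 v‖ := by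
  rw [EuclideanSpace.norm_eq]; rfl

lemma euclNorm_nonneg {k : ℕ} (v : Fin k → ℂ) : 0 ≤ euclNorm v := Real.sqrt_nonneg _

lemma euclNorm_add_le {k : ℕ} (u v : Fin k → ℂ) : euclNorm (u + v) ≤ euclNorm u + euclNorm v := by
  simp only [euclNorm_eq, WithLp.toLp_add]
  exact norm_add_le _ _

lemma euclNorm_smul {k : ℕ} (c : ℂ) (v : Fin k → ℂ) : euclNorm (c • v) = ‖c‖ * euclNorm v := by
  simp only [euclNorm_eq, WithLp.toLp_smul]
  exact norm_smul _ _

lemma norm_apply_le_euclNorm {k : ℕ} (v : Fin k → ℂ) (i : Fin k) : ‖v i‖ ≤ euclNorm v := by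
  rw [euclNorm_eq]
  exact PiLp.norm_apply_le (WithLp.toLp 2 v) i

lemma euclNorm_single {k : ℕ} (i : Fin k) (c : ℂ) : euclNorm (Pi.single i c) = ‖c‖ := by
  rw [euclNorm, Finset.sum_eq_single i]
  · simp
  · intro j _ hj; simp [hj]
  · simp

lemma euclNorm_le_mul {k : ℕ} {v : Fin k → ℂ} {C : ℝ} (hC : ∀ i, ‖v i‖ ≤ C) (hC0 : 0 ≤ C) :
    euclNorm v ≤ k * C := by
  rw [euclNorm, Real.sqrt_le_left (by positivity)]
  calc ∑ i, ‖v i‖ ^ 2 ≤ ∑ _i : Fin k, C ^ 2 := by gcongr with i _; exact hC i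
    _ = k * C ^ 2 := by simp
    _ ≤ (k * C) ^ 2 := by
      rw [mul_pow]
      gcongr
      exact_mod_cast Nat.le_self_pow two_ne_zero k

lemma continuous_euclNorm {k : ℕ} : Continuous (euclNorm : (Fin k → ℂ) → ℝ) := by
  unfold euclNorm; fun_prop

lemma isOpen_nhd₁ (A : Set ℝ) (θ : ℝ) : IsOpen (nhd₁ A θ) := by
  have : nhd₁ A θ = ⋃ a ∈ A, ball (a : ℂ) θ := by
    ext z; simp [nhd₁, dist_eq_norm]
  rw [this]
  exact isOpen_biUnion fun _ _ => isOpen_ball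

lemma isOpen_nhd (A : Set (Fin n → ℝ)) (θ : ℝ) : IsOpen (nhd A θ) := by
  have : nhd A θ = ⋃ a ∈ A, {z : Fin n → ℂ | euclNorm (fun i => z i - (a i : ℂ)) < θ} := by
    ext z; simp [nhd]
  rw [this]
  refine isOpen_biUnion fun a _ => ?_
  exact isOpen_lt (continuous_euclNorm.comp (by fun_prop)) continuous_const

lemma nhd₁_mono (A : Set ℝ) {θ θ' : ℝ} (h : θ ≤ θ') : nhd₁ A θ ⊆ nhd₁ A θ' :=
  fun _ ⟨a, ha, hz⟩ => ⟨a, ha, hz.trans_le h⟩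

lemma nhd_mono (A : Set (Fin n → ℝ)) {θ θ' : ℝ} (h : θ ≤ θ') : nhd A θ ⊆ nhd A θ' :=
  fun _ ⟨a, ha, hz⟩ => ⟨a, ha, hz.trans_le h⟩

lemma add_mem_nhd₁ {A : Set ℝ} {θ θ' : ℝ} {z v : ℂ} (hz : z ∈ nhd₁ A θ) (hv : θ + ‖v‖ ≤ θ') :
    z + v ∈ nhd₁ A θ' := by
  obtain ⟨a, ha, hz⟩ := hz
  refine ⟨a, ha, ?_⟩
  calc ‖z + v - a‖ = ‖(z - a) + v‖ := by congr 1; ring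
    _ ≤ ‖z - a‖ + ‖v‖ := norm_add_le _ _
    _ < θ' := by linarith

lemma add_mem_nhd {A : Set (Fin n → ℝ)} {θ θ' : ℝ} {z v : Fin n → ℂ} (hz : z ∈ nhd A θ)
    (hv : θ + euclNorm v ≤ θ') : z + v ∈ nhd A θ' := by
  obtain ⟨a, ha, hz⟩ := hz
  refine ⟨a, ha, ?_⟩
  have e : (fun i => (z + v) i - (a i : ℂ)) = (fun i => z i - (a i : ℂ)) + v := by
    ext i; simp; ring
  rw [e]
  linarith [euclNorm_add_le (fun i => z i - (a i : ℂ)) v]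

lemma isOpen_baseDomain (D : Base n) (w : Widths) : IsOpen (baseDomain D w) :=
  ((isOpen_nhd₁ _ _).preimage continuous_fst).inter
    (((isOpen_nhd _ _).preimage (by fun_prop : Continuous fun b : ℂ × (Fin n → ℂ) × ℂ => b.2.1)).inter
      ((isOpen_nhd₁ _ _).preimage (by fun_prop : Continuous fun b : ℂ × (Fin n → ℂ) × ℂ => b.2.2)))

lemma isOpen_actionDomain (D : Base n) (w : Widths) : IsOpen (actionDomain m D w) := by
  refine ((isOpen_nhd₁ _ _).preimage continuous_fst).inter
    (((isOpen_nhd _ _).preimage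
      (by fun_prop : Continuous fun b : ℂ × (Fin n → ℂ) × (Fin m → ℂ) => b.2.1)).inter ?_)
  have : {u : ℂ × (Fin n → ℂ) × (Fin m → ℂ) | ∀ i, ‖u.2.2 i‖ < w.δ ^ 2} =
      ⋂ i, {u | ‖u.2.2 i‖ < w.δ ^ 2} := by ext; simp
  change IsOpen {u : ℂ × (Fin n → ℂ) × (Fin m → ℂ) | ∀ i, ‖u.2.2 i‖ < w.δ ^ 2}
  rw [this]
  exact isOpen_iInter_of_finite fun i => isOpen_lt (by fun_prop) continuous_const

lemma continuous_yIx : Continuous (Phase.yIx : Phase n m → _) := by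
  unfold Phase.yIx Phase.y Phase.I Phase.x; fun_prop

lemma differentiable_yIx : Differentiable ℂ (Phase.yIx : Phase n m → _) := by
  unfold Phase.yIx Phase.y Phase.I Phase.x; fun_prop

lemma isOpen_domain (D : Base n) (w : Widths) : IsOpen (domain m D w) := by
  refine ((isOpen_baseDomain D w).preimage continuous_yIx).inter ?_
  have e : {z : Phase n m | (∀ i, |(z.φ i).im| < w.s) ∧ (∀ i, ‖z.p i‖ < w.δ) ∧
      (∀ i, ‖z.q i‖ < w.δ)} = (⋂ i, {z | |(z.φ i).im| < w.s}) ∩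
        ((⋂ i, {z | ‖z.p i‖ < w.δ}) ∩ (⋂ i, {z | ‖z.q i‖ < w.δ})) := by
    ext; simp
  have h1 : IsOpen (⋂ i, {z : Phase n m | |(z.φ i).im| < w.s}) :=
    isOpen_iInter_of_finite fun i => isOpen_lt (by unfold Phase.φ; fun_prop) continuous_const
  have h2 : IsOpen (⋂ i, {z : Phase n m | ‖z.p i‖ < w.δ}) :=
    isOpen_iInter_of_finite fun i => isOpen_lt (by unfold Phase.p; fun_prop) continuous_const
  have h3 : IsOpen (⋂ i, {z : Phase n m | ‖z.q i‖ < w.δ}) :=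
    isOpen_iInter_of_finite fun i => isOpen_lt (by unfold Phase.q; fun_prop) continuous_const
  change IsOpen {z : Phase n m | (∀ i, |(z.φ i).im| < w.s) ∧ (∀ i, ‖z.p i‖ < w.δ) ∧
      (∀ i, ‖z.q i‖ < w.δ)}
  rw [e]
  exact h1.inter (h2.inter h3)

lemma baseDomain_mono (D : Base n) {w w' : Widths} (h : w.Le w') :
    baseDomain D w ⊆ baseDomain D w' := fun _ hb =>
  ⟨nhd₁_mono _ h.1 hb.1, nhd_mono _ h.2.1 hb.2.1, nhd₁_mono _ h.2.2.1 hb.2.2⟩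

lemma domain_mono (D : Base n) {w w' : Widths} (h : w.Le w') : domain m D w ⊆ domain m D w' :=
  fun _ hz => ⟨baseDomain_mono D h hz.1, fun i => (hz.2.1 i).trans_le h.2.2.2.1,
    fun i => (hz.2.2.1 i).trans_le h.2.2.2.2, fun i => (hz.2.2.2 i).trans_le h.2.2.2.2⟩

lemma yIJ_mem_actionDomain {D : Base n} {w : Widths} {z : Phase n m} (hz : z ∈ domain m D w) :
    z.yIJ ∈ actionDomain m D w := by
  refine ⟨hz.1.1, hz.1.2.1, fun i => ?_⟩
  simp only [Phase.yIJ, Phase.J, norm_mul, pow_two]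
  exact mul_lt_mul'' (hz.2.2.1 i) (hz.2.2.2 i) (norm_nonneg _) (norm_nonneg _)

end Geometry

/-! ### Weights and monomials of the Taylor-Fourier expansion. -/

section Weights

/-- The weight `e^{s|k|} δ^{|h|+|j|}` of the index `(k, h, j)`. -/
def weight (w : Widths) (κ : Idx n m) : ℝ :=
  Real.exp (w.s * ∑ i, |(κ.1 i : ℝ)|) * w.δ ^ (∑ i, κ.2.1 i + ∑ i, κ.2.2 i)

lemma weight_nonneg {w : Widths} (hδ : 0 ≤ w.δ) (κ : Idx n m) : 0 ≤ weight w κ := by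
  unfold weight; positivity

lemma weight_mono {w w' : Widths} (h : w.Le w') (hδ : 0 ≤ w.δ) (κ : Idx n m) :
    weight w κ ≤ weight w' κ := by
  unfold weight
  have := h.2.2.2.1
  have := h.2.2.2.2
  gcongr

/-- The degrees in p and q are additive and |k + k'| is subadditive. This submultiplicativity makes
the weighted norm an algebra norm. -/
lemma weight_add_le {w : Widths} (hs : 0 ≤ w.s) (hδ : 0 ≤ w.δ) (κ κ' : Idx n m) :
    weight w (κ + κ') ≤ weight w κ * weight w κ' := by
  have h1 : w.s * ∑ i, |((κ + κ').1 i : ℝ)| ≤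
      w.s * ∑ i, |(κ.1 i : ℝ)| + w.s * ∑ i, |(κ'.1 i : ℝ)| := by
    rw [← mul_add, ← Finset.sum_add_distrib]
    gcongr with i
    simp only [Prod.fst_add, Pi.add_apply, Int.cast_add]
    exact abs_add_le _ _
  have h2 : (∑ i, (κ + κ').2.1 i + ∑ i, (κ + κ').2.2 i) =
      (∑ i, κ.2.1 i + ∑ i, κ.2.2 i) + (∑ i, κ'.2.1 i + ∑ i, κ'.2.2 i) := by
    simp only [Prod.snd_add, Prod.fst_add, Pi.add_apply, Finset.sum_add_distrib]; ring
  unfold weight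
  rw [h2, pow_add]
  calc _ ≤ Real.exp (w.s * ∑ i, |(κ.1 i : ℝ)| + w.s * ∑ i, |(κ'.1 i : ℝ)|) *
        (w.δ ^ (∑ i, κ.2.1 i + ∑ i, κ.2.2 i) * w.δ ^ (∑ i, κ'.2.1 i + ∑ i, κ'.2.2 i)) := by gcongr
    _ = _ := by rw [Real.exp_add]; ring

lemma mono_add (κ κ' : Idx n m) (z : Phase n m) : mono (κ + κ') z = mono κ z * mono κ' z := by
  simp only [mono, Prod.fst_add, Prod.snd_add, Pi.add_apply, pow_add, Finset.prod_mul_distrib,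
    Int.cast_add, add_mul, Finset.sum_add_distrib, mul_add, Complex.exp_add]
  ring

lemma mono_zero (z : Phase n m) : mono (0 : Idx n m) z = 1 := by simp [mono]

lemma norm_exp_sum_le {s : ℝ} (k : Fin n → ℤ) {φ : Fin n → ℂ} (hφ : ∀ i, |(φ i).im| ≤ s) :
    ‖Complex.exp (Complex.I * ∑ i, (k i : ℂ) * φ i)‖ ≤ Real.exp (s * ∑ i, |(k i : ℝ)|) := by
  rw [Complex.norm_exp, Real.exp_le_exp]
  have : (Complex.I * ∑ i, (k i : ℂ) * φ i).re = -∑ i, (k i : ℝ) * (φ i).im := by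
    simp [Complex.mul_re, Complex.im_sum]
  rw [this, ← Finset.sum_neg_distrib, Finset.mul_sum]
  refine Finset.sum_le_sum fun i _ => ?_
  calc -((k i : ℝ) * (φ i).im) ≤ |(k i : ℝ) * (φ i).im| := neg_le_abs _
    _ = |(φ i).im| * |(k i : ℝ)| := by rw [abs_mul, mul_comm]
    _ ≤ s * |(k i : ℝ)| := by gcongr; exact hφ i

lemma norm_mono_le {D : Base n} {w : Widths} (κ : Idx n m) {z : Phase n m}
    (hz : z ∈ domain m D w) : ‖mono κ z‖ ≤ weight w κ := by
  unfold mono weight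
  rw [norm_mul, norm_mul, pow_add, ← Finset.prod_pow_eq_pow_sum, ← Finset.prod_pow_eq_pow_sum,
    norm_prod, norm_prod, ← mul_assoc]
  have hδ : ∀ i : Fin m, 0 ≤ w.δ := fun i => (norm_nonneg _).trans (hz.2.2.1 i).le
  gcongr with i _ i _
  · exact mul_nonneg (Real.exp_nonneg _) (Finset.prod_nonneg fun i _ => pow_nonneg (hδ i) _)
  · exact norm_exp_sum_le _ fun i => (hz.2.1 i).le
  · rw [norm_pow]; gcongr; exact (hz.2.2.1 i).le
  · rw [norm_pow]; gcongr; exact (hz.2.2.2 i).le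

lemma differentiable_mono (κ : Idx n m) : Differentiable ℂ (mono κ) := by
  unfold mono Phase.φ Phase.p Phase.q
  fun_prop

end Weights

end NormalForm

namespace NormalForm

variable {n m : ℕ}

/-! ### The calculus of majorants. -/

section Majorants

open Set

/-- `F` is, on the domain, the sum of the terms `a i (y, I, x) e^{i k·φ} p^h q^j` with
`(k, h, j) = κ i ∈ S`, where the `a i` are holomorphic and bounded by `c i`; the weighted sum of the
bounds is at most `M`. -/
structure IsSeries {ι : Type} (S : Set (Idx n m)) (D : Base n) (w : Widths) (F : Phase n m → ℂ)
    (M : ℝ) (κ : ι → Idx n m) (a : ι → ℂ × (Fin n → ℂ) × ℂ → ℂ) (c : ι → ℝ) : Prop where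
  mem : ∀ i, κ i ∈ S
  diff : ∀ i, DifferentiableOn ℂ (a i) (baseDomain D w)
  bound : ∀ i, ∀ b ∈ baseDomain D w, ‖a i b‖ ≤ c i
  nonneg : ∀ i, 0 ≤ c i
  summable : Summable fun i => c i * weight w (κ i)
  tsum_le : ∑' i, c i * weight w (κ i) ≤ M
  hasSum : ∀ z ∈ domain m D w, HasSum (fun i => a i z.yIx * mono (κ i) z) (F z)

/-- `F` has a Taylor-Fourier series with indices in `S` and weighted norm at most `M`. Repeated
indices are allowed. -/
def HasMajorant (S : Set (Idx n m)) (D : Base n) (w : Widths) (F : Phase n m → ℂ) (M : ℝ) : Prop :=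
  ∃ (ι : Type) (_ : Countable ι) (κ : ι → Idx n m) (a : ι → ℂ × (Fin n → ℂ) × ℂ → ℂ) (c : ι → ℝ),
    IsSeries S D w F M κ a c

variable {S : Set (Idx n m)} {D : Base n} {w w' : Widths} {F G : Phase n m → ℂ} {M M' : ℝ}

namespace IsSeries

variable {ι : Type} {κ : ι → Idx n m} {a : ι → ℂ × (Fin n → ℂ) × ℂ → ℂ} {c : ι → ℝ}

lemma norm_term_le (h : IsSeries S D w F M κ a c) (i : ι) {z : Phase n m}
    (hz : z ∈ domain m D w) : ‖a i z.yIx * mono (κ i) z‖ ≤ c i * weight w (κ i) := by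
  rw [norm_mul]
  exact mul_le_mul (h.bound i _ hz.1) (norm_mono_le _ hz) (norm_nonneg _) (h.nonneg i)

lemma norm_le (h : IsSeries S D w F M κ a c) {z : Phase n m} (hz : z ∈ domain m D w) :
    ‖F z‖ ≤ M := by
  rw [← (h.hasSum z hz).tsum_eq]
  exact (tsum_of_norm_bounded h.summable.hasSum fun i => h.norm_term_le i hz).trans h.tsum_le

lemma differentiableOn_term (h : IsSeries S D w F M κ a c) (i : ι) :
    DifferentiableOn ℂ (fun z : Phase n m => a i z.yIx * mono (κ i) z) (domain m D w) :=
  ((h.diff i).comp differentiable_yIx.differentiableOn fun _ hz => hz.1).mul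
    (differentiable_mono _).differentiableOn

lemma hasSum_fderiv (h : IsSeries S D w F M κ a c) {z : Phase n m} (hz : z ∈ domain m D w) :
    HasFDerivAt F (fderiv ℂ F z) z ∧ ∀ v, HasSum
      (fun i => fderiv ℂ (fun z : Phase n m => a i z.yIx * mono (κ i) z) z v) (fderiv ℂ F z v) := by
  have hO := isOpen_domain (m := m) D w
  obtain ⟨h1, h2⟩ := hasFDerivAt_tsum_of_bounded hO h.summable h.differentiableOn_term
    (fun i z hz => h.norm_term_le i hz) hz
  have h3 : HasFDerivAt F _ z := h1.congr_of_eventuallyEq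
    (Filter.eventually_of_mem (hO.mem_nhds hz) fun x hx => (h.hasSum x hx).tsum_eq.symm)
  rw [h3.fderiv]
  refine ⟨h3, fun v => ?_⟩
  exact h2.hasSum.mapL (ContinuousLinearMap.apply ℂ ℂ v)

lemma hasMajorant_subtype [Countable ι] (h : IsSeries S D w F M κ a c) (hδ : 0 ≤ w.δ)
    (S' : Set (Idx n m)) : HasMajorant S' D w
      (fun z => ∑' i : {i // κ i ∈ S'}, a i z.yIx * mono (κ i) z) M := by
  have hs : Summable fun i : {i // κ i ∈ S'} => c i * weight w (κ i) :=
    h.summable.comp_injective Subtype.val_injective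
  refine ⟨{i // κ i ∈ S'}, inferInstance, fun i => κ i, fun i => a i, fun i => c i, fun i => i.2,
    fun i => h.diff i, fun i => h.bound i, fun i => h.nonneg i, hs, ?_, fun z hz => ?_⟩
  · exact (h.summable.tsum_subtype_le _ _ fun i =>
      mul_nonneg (h.nonneg i) (weight_nonneg hδ _)).trans h.tsum_le
  · exact ((h.hasSum z hz).summable.comp_injective Subtype.val_injective).hasSum

end IsSeries

namespace HasMajorant

lemma norm_le (h : HasMajorant S D w F M) {z : Phase n m} (hz : z ∈ domain m D w) : ‖F z‖ ≤ M := by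
  obtain ⟨ι, _, κ, a, c, h⟩ := h
  exact h.norm_le hz

lemma differentiableOn (h : HasMajorant S D w F M) : DifferentiableOn ℂ F (domain m D w) := by
  obtain ⟨ι, _, κ, a, c, h⟩ := h
  exact fun z hz => (h.hasSum_fderiv hz).1.differentiableAt.differentiableWithinAt

lemma congr (h : HasMajorant S D w F M) (hFG : ∀ z ∈ domain m D w, G z = F z) :
    HasMajorant S D w G M := by
  obtain ⟨ι, hι, κ, a, c, h⟩ := h
  exact ⟨ι, hι, κ, a, c, { h with hasSum := fun z hz => hFG z hz ▸ h.hasSum z hz }⟩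

lemma le (h : HasMajorant S D w F M) (hM : M ≤ M') : HasMajorant S D w F M' := by
  obtain ⟨ι, hι, κ, a, c, h⟩ := h
  exact ⟨ι, hι, κ, a, c, { h with tsum_le := h.tsum_le.trans hM }⟩

lemma subset {S' : Set (Idx n m)} (h : HasMajorant S D w F M) (hS : S ⊆ S') :
    HasMajorant S' D w F M := by
  obtain ⟨ι, hι, κ, a, c, h⟩ := h
  exact ⟨ι, hι, κ, a, c, { h with mem := fun i => hS (h.mem i) }⟩

lemma univ (h : HasMajorant S D w F M) : HasMajorant Set.univ D w F M := h.subset (subset_univ _)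

lemma restrict (h : HasMajorant S D w F M) (hw : w'.Le w) (hδ : 0 ≤ w'.δ) :
    HasMajorant S D w' F M := by
  obtain ⟨ι, hι, κ, a, c, h⟩ := h
  have hle : ∀ i, c i * weight w' (κ i) ≤ c i * weight w (κ i) := fun i =>
    mul_le_mul_of_nonneg_left (weight_mono hw hδ _) (h.nonneg i)
  have hs : Summable fun i => c i * weight w' (κ i) :=
    Summable.of_nonneg_of_le (fun i => mul_nonneg (h.nonneg i) (weight_nonneg hδ _)) hle h.summable
  refine ⟨ι, hι, κ, a, c, h.mem, fun i => (h.diff i).mono (baseDomain_mono D hw),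
    fun i b hb => h.bound i b (baseDomain_mono D hw hb), h.nonneg, hs, ?_,
    fun z hz => h.hasSum z (domain_mono D hw hz)⟩
  exact (hs.tsum_le_tsum hle h.summable).trans h.tsum_le

lemma nonneg (h : HasMajorant S D w F M) (hδ : 0 ≤ w.δ) : 0 ≤ M := by
  obtain ⟨ι, hι, κ, a, c, h⟩ := h
  exact (tsum_nonneg fun i => mul_nonneg (h.nonneg i) (weight_nonneg hδ _)).trans h.tsum_le

lemma atom {κ : Idx n m} (hκ : κ ∈ S) {a : ℂ × (Fin n → ℂ) × ℂ → ℂ} {c : ℝ}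
    (ha : DifferentiableOn ℂ a (baseDomain D w)) (hc : ∀ b ∈ baseDomain D w, ‖a b‖ ≤ c)
    (hc0 : 0 ≤ c) : HasMajorant S D w (fun z => a z.yIx * mono κ z) (c * weight w κ) :=
  ⟨Unit, inferInstance, fun _ => κ, fun _ => a, fun _ => c, fun _ => hκ, fun _ => ha, fun _ => hc,
    fun _ => hc0, .of_finite, by simp, fun z _ => by simp⟩

/-- Series of functions. -/
lemma tsum {β : Type} [Countable β] {F : β → Phase n m → ℂ} {M : β → ℝ} {G : Phase n m → ℂ}
    (hδ : 0 ≤ w.δ) (h : ∀ b, HasMajorant S D w (F b) (M b)) (hM : Summable M)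
    (hG : ∀ z ∈ domain m D w, HasSum (fun b => F b z) (G z)) :
    HasMajorant S D w G (∑' b, M b) := by
  choose ι hι κ a c h using h
  have hnn : ∀ x : (b : β) × ι b, 0 ≤ c x.1 x.2 * weight w (κ x.1 x.2) := fun x =>
    mul_nonneg ((h x.1).nonneg x.2) (weight_nonneg hδ _)
  have hs : Summable fun x : (b : β) × ι b => c x.1 x.2 * weight w (κ x.1 x.2) := by
    refine (summable_sigma_of_nonneg hnn).mpr ⟨fun b => (h b).summable, ?_⟩
    exact Summable.of_nonneg_of_le (fun b => tsum_nonneg fun i => hnn ⟨b, i⟩)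
      (fun b => (h b).tsum_le) hM
  refine ⟨(b : β) × ι b, inferInstance, fun x => κ x.1 x.2, fun x => a x.1 x.2, fun x => c x.1 x.2,
    fun x => (h x.1).mem x.2, fun x => (h x.1).diff x.2, fun x => (h x.1).bound x.2,
    fun x => (h x.1).nonneg x.2, hs, ?_, fun z hz => ?_⟩
  · rw [hs.tsum_sigma]
    exact hs.sigma.tsum_le_tsum (fun b => (h b).tsum_le) hM
  · have hs' : Summable fun x : (b : β) × ι b => a x.1 x.2 z.yIx * mono (κ x.1 x.2) z :=
      Summable.of_norm_bounded hs fun x => (h x.1).norm_term_le x.2 hz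
    have h1 := hs'.hasSum.sigma fun b => (h b).hasSum z hz
    rw [← h1.unique (hG z hz)]
    exact hs'.hasSum

lemma sum {β : Type} [Fintype β] {F : β → Phase n m → ℂ} {M : β → ℝ} (hδ : 0 ≤ w.δ)
    (h : ∀ b, HasMajorant S D w (F b) (M b)) :
    HasMajorant S D w (fun z => ∑ b, F b z) (∑ b, M b) := by
  have := tsum (G := fun z => ∑ b, F b z) hδ h .of_finite fun z _ => hasSum_fintype _
  rwa [tsum_fintype] at this

lemma add (hδ : 0 ≤ w.δ) (hF : HasMajorant S D w F M) (hG : HasMajorant S D w G M') :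
    HasMajorant S D w (fun z => F z + G z) (M + M') := by
  have := sum (β := Bool) (F := fun b => if b then F else G) (M := fun b => if b then M else M') hδ
    (by rintro (_ | _) <;> simpa)
  simpa using this

lemma const_mul (hF : HasMajorant S D w F M) (b : ℂ) :
    HasMajorant S D w (fun z => b * F z) (‖b‖ * M) := by
  obtain ⟨ι, hι, κ, a, c, h⟩ := hF
  have e : (fun i => ‖b‖ * c i * weight w (κ i)) = fun i => ‖b‖ * (c i * weight w (κ i)) := by
    ext; ring
  refine ⟨ι, hι, κ, fun i x => b * a i x, fun i => ‖b‖ * c i, h.mem, fun i => (h.diff i).const_mul b,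
    fun i x hx => ?_, fun i => mul_nonneg (norm_nonneg _) (h.nonneg i), ?_, ?_, fun z hz => ?_⟩
  · rw [norm_mul]; gcongr; exact h.bound i x hx
  · rw [e]; exact h.summable.mul_left _
  · rw [e, tsum_mul_left]; gcongr; exact h.tsum_le
  · simpa only [mul_assoc] using (h.hasSum z hz).mul_left b

lemma neg (hF : HasMajorant S D w F M) : HasMajorant S D w (fun z => -F z) M := by
  simpa using hF.const_mul (-1)

lemma sub (hδ : 0 ≤ w.δ) (hF : HasMajorant S D w F M) (hG : HasMajorant S D w G M') :
    HasMajorant S D w (fun z => F z - G z) (M + M') := by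
  simpa only [sub_eq_add_neg] using hF.add hδ hG.neg

/-- The product series is indexed by pairs of terms. As indices may repeat, nothing has to be
regrouped, and `weight_add_le` bounds the weighted sum by the product of the two sums. -/
lemma mul (hs : 0 ≤ w.s) (hδ : 0 ≤ w.δ) (hF : HasMajorant Set.univ D w F M)
    (hG : HasMajorant Set.univ D w G M') :
    HasMajorant Set.univ D w (fun z => F z * G z) (M * M') := by
  have hM := hF.nonneg hδ
  obtain ⟨ι, hι, κ, a, c, h⟩ := hF
  obtain ⟨ι', hι', κ', a', c', h'⟩ := hG
  have hnn := fun i => mul_nonneg (h.nonneg i) (weight_nonneg hδ (κ i))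
  have hnn' := fun i => mul_nonneg (h'.nonneg i) (weight_nonneg hδ (κ' i))
  have hs2 : Summable fun x : ι × ι' =>
      (c x.1 * weight w (κ x.1)) * (c' x.2 * weight w (κ' x.2)) :=
    h.summable.mul_of_nonneg h'.summable hnn hnn'
  have hle : ∀ x : ι × ι', c x.1 * c' x.2 * weight w (κ x.1 + κ' x.2) ≤
      (c x.1 * weight w (κ x.1)) * (c' x.2 * weight w (κ' x.2)) := by
    intro x
    calc _ ≤ c x.1 * c' x.2 * (weight w (κ x.1) * weight w (κ' x.2)) :=
          mul_le_mul_of_nonneg_left (weight_add_le hs hδ _ _)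
            (mul_nonneg (h.nonneg _) (h'.nonneg _))
      _ = _ := by ring
  have hs3 : Summable fun x : ι × ι' => c x.1 * c' x.2 * weight w (κ x.1 + κ' x.2) :=
    Summable.of_nonneg_of_le (fun x => mul_nonneg (mul_nonneg (h.nonneg _) (h'.nonneg _))
      (weight_nonneg hδ _)) hle hs2
  refine ⟨ι × ι', inferInstance, fun x => κ x.1 + κ' x.2, fun x b => a x.1 b * a' x.2 b,
    fun x => c x.1 * c' x.2, fun _ => mem_univ _, fun x => (h.diff _).mul (h'.diff _),
    fun x b hb => ?_, fun x => mul_nonneg (h.nonneg _) (h'.nonneg _), hs3, ?_, fun z hz => ?_⟩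
  · rw [norm_mul]
    exact mul_le_mul (h.bound _ _ hb) (h'.bound _ _ hb) (norm_nonneg _) (h.nonneg _)
  · refine (hs3.tsum_le_tsum hle hs2).trans ?_
    rw [← h.summable.tsum_mul_tsum h'.summable hs2]
    exact mul_le_mul h.tsum_le h'.tsum_le (tsum_nonneg hnn') hM
  · have e : (fun x : ι × ι' => a x.1 z.yIx * a' x.2 z.yIx * mono (κ x.1 + κ' x.2) z) =
        fun x => (a x.1 z.yIx * mono (κ x.1) z) * (a' x.2 z.yIx * mono (κ' x.2) z) := by
      ext x; rw [mono_add]; ring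
    have hs4 : Summable fun x : ι × ι' =>
        (a x.1 z.yIx * mono (κ x.1) z) * (a' x.2 z.yIx * mono (κ' x.2) z) := by
      refine Summable.of_norm_bounded hs2 fun x => ?_
      rw [norm_mul]
      exact mul_le_mul (h.norm_term_le _ hz) (h'.norm_term_le _ hz) (norm_nonneg _) (hnn _)
    rw [e]
    exact HasSum.mul (f := fun i => a i z.yIx * mono (κ i) z)
      (g := fun i => a' i z.yIx * mono (κ' i) z) (h.hasSum z hz) (h'.hasSum z hz) hs4

lemma one : HasMajorant Set.univ D w (fun _ : Phase n m => 1) 1 := by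
  have := atom (m := m) (D := D) (w := w) (κ := 0) (a := fun _ => 1) (c := 1) (mem_univ _)
    (differentiableOn_const _) (fun _ _ => by simp) zero_le_one
  have hw : weight w (0 : Idx n m) = 1 := by simp [weight]
  rw [hw, mul_one] at this
  exact this.congr fun z _ => by rw [mono_zero, mul_one]

lemma pow (hs : 0 ≤ w.s) (hδ : 0 ≤ w.δ) (hF : HasMajorant Set.univ D w F M) (k : ℕ) :
    HasMajorant Set.univ D w (fun z => F z ^ k) (M ^ k) := by
  induction k with
  | zero => simpa using one
  | succ k ih => simpa only [pow_succ] using ih.mul hs hδ hF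

lemma zero (hM : 0 ≤ M) : HasMajorant S D w (fun _ : Phase n m => 0) M :=
  ⟨Empty, inferInstance, Empty.elim, fun i => i.elim, fun i => i.elim, fun i => i.elim,
    fun i => i.elim, fun i => i.elim, fun i => i.elim, .of_finite, by simpa, fun _ _ => by simp⟩

/-- Splitting of a series according to a set of indices. -/
lemma split (hF : HasMajorant Set.univ D w F M) (hδ : 0 ≤ w.δ) (S : Set (Idx n m)) :
    ∃ F₁ F₂ : Phase n m → ℂ, HasMajorant S D w F₁ M ∧ HasMajorant Sᶜ D w F₂ M ∧
      ∀ z ∈ domain m D w, F z = F₁ z + F₂ z := by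
  obtain ⟨ι, hι, κ, a, c, h⟩ := hF
  refine ⟨_, _, h.hasMajorant_subtype hδ S, h.hasMajorant_subtype hδ Sᶜ, fun z hz => ?_⟩
  rw [← (h.hasSum z hz).tsum_eq]
  exact ((h.hasSum z hz).summable.tsum_subtype_add_tsum_subtype_compl (κ ⁻¹' S)).symm

lemma shift (h : HasMajorant S D w F M) {z : Phase n m} (hz : z ∈ domain m D w) (l : Fin n → ℤ) :
    F (z.shift l) = F z := by
  obtain ⟨ι, hι, κ, a, c, h⟩ := h
  have hz' : z.shift l ∈ domain m D w := by
    refine ⟨hz.1, fun i => ?_, hz.2.2.1, hz.2.2.2⟩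
    have := hz.2.1 i
    simpa [Phase.shift, Phase.φ, Complex.add_im, Complex.mul_im] using this
  have hm : ∀ κ : Idx n m, mono κ (z.shift l) = mono κ z := by
    intro κ
    unfold mono
    congr 2
    have e : Complex.I * ∑ i, (κ.1 i : ℂ) * (z.shift l).φ i =
        Complex.I * ∑ i, (κ.1 i : ℂ) * z.φ i +
          ((∑ i, κ.1 i * l i : ℤ) : ℂ) * (2 * Real.pi * Complex.I) := by
      simp only [Phase.shift, Phase.φ, mul_add, Finset.sum_add_distrib]
      push_cast
      rw [Finset.sum_mul, Finset.mul_sum (a := Complex.I)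
        (f := fun i => (κ.1 i : ℂ) * (2 * (Real.pi : ℂ) * (l i : ℂ)))]
      congr 1
      refine Finset.sum_congr rfl fun i _ => ?_
      ring
    rw [e, Complex.exp_periodic.int_mul]
  refine (h.hasSum _ hz').unique ?_
  simp only [hm]
  exact h.hasSum z hz

end HasMajorant

end Majorants

end NormalForm

namespace NormalForm

variable {n m : ℕ}

/-! ### Partial derivatives of series and their Cauchy estimates. -/

section Derivatives

open Set

/-- Indices of the coordinates of `(y, I, p)`, and also of the conjugate ones `(x, φ, q)`. -/
abbrev Half (n m : ℕ) : Type := Unit ⊕ Fin n ⊕ Fin m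

/-- Canonical basis of `ℂ × ℂⁿ × ℂᵐ`. -/
def halfVec : Half n m → ℂ × (Fin n → ℂ) × (Fin m → ℂ)
  | .inl _ => (1, 0, 0)
  | .inr (.inl i) => (0, Pi.single i 1, 0)
  | .inr (.inr i) => (0, 0, Pi.single i 1)

/-- Canonical basis of the phase space. -/
def basisVec : Half n m ⊕ Half n m → Phase n m
  | .inl c => (halfVec c, 0)
  | .inr c => (0, halfVec c)

/-- The width of the domain in the direction of a coordinate. -/
def width (w : Widths) : Half n m ⊕ Half n m → ℝ
  | .inl (.inl _) => w.r
  | .inl (.inr (.inl _)) => w.ρ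
  | .inl (.inr (.inr _)) => w.δ
  | .inr (.inl _) => w.ξ
  | .inr (.inr (.inl _)) => w.s
  | .inr (.inr (.inr _)) => w.δ

lemma width_pos {w : Widths} (hw : w.Pos) (c : Half n m ⊕ Half n m) : 0 < width w c := by
  obtain ⟨h1, h2, h3, h4, h5⟩ := hw
  rcases c with (_ | _ | _) | (_ | _ | _) <;> simpa [width]

lemma width_scale (w : Widths) (t : ℝ) (c : Half n m ⊕ Half n m) :
    width (w.scale t) c = t * width w c := by
  rcases c with (_ | _ | _) | (_ | _ | _) <;> rfl

lemma d_le_width_mul (w : Widths) (c : Half n m) :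
    w.d ≤ width w (.inl c) * width w (.inr c) := by
  rcases c with (_ | _ | _) <;> simp [width, Widths.d, pow_two]

lemma d_pos {w : Widths} (hw : w.Pos) : 0 < w.d := by
  obtain ⟨h1, h2, h3, h4, h5⟩ := hw
  simp only [Widths.d, lt_min_iff]
  exact ⟨by positivity, by positivity, by positivity⟩

variable {S : Set (Idx n m)} {D : Base n} {w w' : Widths} {F G : Phase n m → ℂ} {M : ℝ}

/-- Common frame of the estimates below: a partial derivative sends each term to a single term, and
the gain K is measured term by term between the weights of the two domains. -/
lemma IsSeries.hasMajorant_of_le {ι : Type} [Countable ι] {κ : ι → Idx n m}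
    {a : ι → ℂ × (Fin n → ℂ) × ℂ → ℂ} {c : ι → ℝ} (h : IsSeries S D w F M κ a c)
    {κ' : ι → Idx n m} {a' : ι → ℂ × (Fin n → ℂ) × ℂ → ℂ} {c' : ι → ℝ} {K : ℝ} (hK : 0 ≤ K)
    (hδ : 0 ≤ w'.δ) (hd : ∀ i, DifferentiableOn ℂ (a' i) (baseDomain D w'))
    (hb : ∀ i, ∀ b ∈ baseDomain D w', ‖a' i b‖ ≤ c' i) (hc : ∀ i, 0 ≤ c' i)
    (hle : ∀ i, c' i * weight w' (κ' i) ≤ K * (c i * weight w (κ i)))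
    (hsum : ∀ z ∈ domain m D w', HasSum (fun i => a' i z.yIx * mono (κ' i) z) (G z)) :
    HasMajorant Set.univ D w' G (K * M) := by
  have hs2 : Summable fun i => K * (c i * weight w (κ i)) := h.summable.mul_left K
  have hs : Summable fun i => c' i * weight w' (κ' i) :=
    Summable.of_nonneg_of_le (fun i => mul_nonneg (hc i) (weight_nonneg hδ _)) hle hs2
  refine ⟨ι, inferInstance, κ', a', c', fun _ => mem_univ _, hd, hb, hc, hs, ?_, hsum⟩
  refine (hs.tsum_le_tsum hle hs2).trans ?_
  rw [tsum_mul_left]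
  exact mul_le_mul_of_nonneg_left h.tsum_le hK

lemma fderiv_apply_of_line {f : Phase n m → ℂ} {z v : Phase n m} (hf : DifferentiableAt ℂ f z)
    {f' : ℂ} (h : HasDerivAt (fun t : ℂ => f (z + t • v)) f' 0) : fderiv ℂ f z v = f' := by
  have h1 : HasDerivAt (fun t : ℂ => z + t • v) v 0 := by
    simpa using ((hasDerivAt_id (0 : ℂ)).smul_const v).const_add z
  have h2 : HasFDerivAt f (fderiv ℂ f z) (z + (0 : ℂ) • v) := by simpa using hf.hasFDerivAt
  exact (h2.comp_hasDerivAt (0 : ℂ) h1).unique h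

/-- A direction in the variables y, I, x acts on the coefficients and leaves the monomials alone, so
Cauchy's estimate is applied to every coefficient. -/
lemma HasMajorant.fderiv_base (h : HasMajorant S D w F M) (hw : w'.Le w) (hδ : 0 ≤ w'.δ)
    {τ : ℝ} (hτ : 0 < τ) {v : Phase n m} (hφ : v.φ = 0) (hp : v.p = 0) (hq : v.q = 0)
    (hv : ∀ b ∈ baseDomain D w', ∀ ζ : ℂ, ‖ζ‖ < τ → b + ζ • v.yIx ∈ baseDomain D w) :
    HasMajorant Set.univ D w' (fun z => fderiv ℂ F z v) (M / τ) := by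
  obtain ⟨ι, hι, κ, a, c, h⟩ := h
  rw [div_eq_inv_mul]
  have hO := isOpen_baseDomain D w
  refine h.hasMajorant_of_le (κ' := κ) (a' := fun i b => fderiv ℂ (a i) b v.yIx)
    (c' := fun i => c i / τ) (by positivity) hδ (fun i => ?_) (fun i b hb => ?_)
    (fun i => div_nonneg (h.nonneg i) hτ.le) (fun i => ?_) fun z hz => ?_
  · exact (DifferentiableOn.fderiv_apply hO (h.diff i) _).mono (baseDomain_mono D hw)
  · refine norm_fderiv_apply_le hτ (fun ζ hζ => ?_) fun ζ hζ => h.bound i _ (hv b hb ζ hζ)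
    exact (h.diff i _ (hv b hb ζ hζ)).differentiableAt (hO.mem_nhds (hv b hb ζ hζ))
  · rw [div_eq_inv_mul, mul_assoc]
    have := weight_mono hw hδ (κ i)
    have := h.nonneg i
    gcongr
  · have hz' := domain_mono D hw hz
    convert (h.hasSum_fderiv hz').2 v using 2 with i
    symm
    refine fderiv_apply_of_line ((h.differentiableOn_term i z hz').differentiableAt
      ((isOpen_domain D w).mem_nhds hz')) ?_
    have e1 : ∀ t : ℂ, (z + t • v).yIx = z.yIx + t • v.yIx := fun t => rfl
    have e2 : ∀ t : ℂ, mono (κ i) (z + t • v) = mono (κ i) z := by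
      intro t
      have h1 : (z + t • v).φ = z.φ := by
        change z.φ + t • v.φ = z.φ; simp [hφ]
      have h2 : (z + t • v).p = z.p := by
        change z.p + t • v.p = z.p; simp [hp]
      have h3 : (z + t • v).q = z.q := by
        change z.q + t • v.q = z.q; simp [hq]
      simp only [mono, h1, h2, h3]
    simp only [e1, e2]
    have h1 : HasDerivAt (fun t : ℂ => z.yIx + t • v.yIx) v.yIx 0 := by
      simpa using ((hasDerivAt_id (0 : ℂ)).smul_const v.yIx).const_add z.yIx
    have h2 : HasFDerivAt (a i) (fderiv ℂ (a i) z.yIx) (z.yIx + (0 : ℂ) • v.yIx) := by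
      simpa using ((h.diff i _ hz'.1).differentiableAt (hO.mem_nhds hz'.1)).hasFDerivAt
    exact (h2.comp_hasDerivAt (0 : ℂ) h1).mul_const _

/-- The factor produced by a derivative in φ is absorbed by the loss in s, as τ|k| ≤ e^{τ|k|}. -/
lemma abs_mul_weight_le (hw : w'.Le w) (hδ : 0 ≤ w'.δ) {τ : ℝ} (hτ : 0 < τ) (hs : w'.s + τ ≤ w.s)
    (κ : Idx n m) (i : Fin n) : |(κ.1 i : ℝ)| * weight w' κ ≤ τ⁻¹ * weight w κ := by
  unfold weight
  rw [inv_mul_eq_div, le_div_iff₀ hτ]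
  have h1 : |(κ.1 i : ℝ)| ≤ ∑ i, |(κ.1 i : ℝ)| :=
    Finset.single_le_sum (f := fun i => |(κ.1 i : ℝ)|) (fun _ _ => abs_nonneg _)
      (Finset.mem_univ i)
  set A := ∑ i, |(κ.1 i : ℝ)|
  have hA : 0 ≤ A := (abs_nonneg _).trans h1
  have h2 : |(κ.1 i : ℝ)| * τ ≤ Real.exp (τ * A) := by
    calc _ ≤ A * τ := by gcongr
      _ ≤ τ * A + 1 := by linarith
      _ ≤ _ := Real.add_one_le_exp _
  have h3 : Real.exp (τ * A) * Real.exp (w'.s * A) ≤ Real.exp (w.s * A) := by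
    rw [← Real.exp_add, Real.exp_le_exp, ← add_mul]
    gcongr
    linarith
  have h4 := hw.2.2.2.2
  calc _ = (|(κ.1 i : ℝ)| * τ) * Real.exp (w'.s * A) * w'.δ ^ (∑ i, κ.2.1 i + ∑ i, κ.2.2 i) := by
        ring
    _ ≤ Real.exp (τ * A) * Real.exp (w'.s * A) * w.δ ^ (∑ i, κ.2.1 i + ∑ i, κ.2.2 i) := by gcongr
    _ ≤ _ := by have := hδ.trans h4; gcongr

/-- (N + 1) x^N τ is one of the nonnegative terms of the binomial expansion of (x + τ)^(N + 1). It
absorbs the exponent produced by a derivative in p or q, since a single exponent does not exceed the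
total degree. -/
lemma succ_mul_pow_le {x τ y : ℝ} (hx : 0 ≤ x) (hτ : 0 < τ) (hy : x + τ ≤ y) (N : ℕ) :
    ((N + 1 : ℕ) : ℝ) * x ^ N ≤ τ⁻¹ * y ^ (N + 1) := by
  rw [inv_mul_eq_div, le_div_iff₀ hτ]
  have h : ∀ N : ℕ, ((N + 1 : ℕ) : ℝ) * x ^ N * τ ≤ (x + τ) ^ (N + 1) := by
    intro N
    induction N with
    | zero => simp; linarith
    | succ N ih =>
      rw [pow_succ (x + τ)]
      have h1 : x ^ (N + 1) ≤ (x + τ) ^ (N + 1) := by gcongr; linarith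
      calc ((N + 1 + 1 : ℕ) : ℝ) * x ^ (N + 1) * τ =
          (((N + 1 : ℕ) : ℝ) * x ^ N * τ) * x + x ^ (N + 1) * τ := by push_cast; ring
        _ ≤ (x + τ) ^ (N + 1) * x + (x + τ) ^ (N + 1) * τ := by gcongr
        _ = _ := by ring
  exact (h N).trans (by gcongr)

lemma HasMajorant.fderiv_φ (h : HasMajorant S D w F M) (hw : w'.Le w) (hδ : 0 ≤ w'.δ)
    {τ : ℝ} (hτ : 0 < τ) (hs : w'.s + τ ≤ w.s) (l : Fin n) :
    HasMajorant Set.univ D w' (fun z => fderiv ℂ F z (basisVec (.inr (.inr (.inl l))))) (M / τ) := by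
  obtain ⟨ι, hι, κ, a, c, h⟩ := h
  rw [div_eq_inv_mul]
  have hO := isOpen_baseDomain D w
  have hsub := baseDomain_mono D hw
  refine h.hasMajorant_of_le (κ' := κ) (a' := fun i b => Complex.I * ((κ i).1 l : ℂ) * a i b)
    (c' := fun i => |((κ i).1 l : ℝ)| * c i) (by positivity) hδ (fun i => ?_) (fun i b hb => ?_)
    (fun i => mul_nonneg (abs_nonneg _) (h.nonneg i)) (fun i => ?_) fun z hz => ?_
  · exact ((h.diff i).const_mul _).mono hsub
  · have h1 : ‖Complex.I * ((κ i).1 l : ℂ)‖ = |((κ i).1 l : ℝ)| := by simp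
    rw [norm_mul, h1]
    gcongr
    exact h.bound i b (hsub hb)
  · have := abs_mul_weight_le hw hδ hτ hs (κ i) l
    have hn := h.nonneg i
    calc _ = c i * (|((κ i).1 l : ℝ)| * weight w' (κ i)) := by ring
      _ ≤ c i * (τ⁻¹ * weight w (κ i)) := by gcongr
      _ = _ := by ring
  · have hz' := domain_mono D hw hz
    convert (h.hasSum_fderiv hz').2 (basisVec (.inr (.inr (.inl l)))) using 2 with i
    symm
    refine fderiv_apply_of_line ((h.differentiableOn_term i z hz').differentiableAt
      ((isOpen_domain D w).mem_nhds hz')) ?_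
    set v : Phase n m := basisVec (.inr (.inr (.inl l))) with hv
    have e1 : ∀ t : ℂ, (z + t • v).yIx = z.yIx := fun t => by
      simp [hv, basisVec, halfVec, Phase.yIx, Phase.y, Phase.I, Phase.x]
    have e2 : ∀ t : ℂ, mono (κ i) (z + t • v) =
        Complex.exp (t * (Complex.I * ((κ i).1 l : ℂ))) * mono (κ i) z := by
      intro t
      have h1 : (z + t • v).φ = z.φ + t • (Pi.single l 1 : Fin n → ℂ) := rfl
      have h2 : (z + t • v).p = z.p := by
        change z.p + t • (0 : Fin m → ℂ) = z.p; simp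
      have h3 : (z + t • v).q = z.q := by
        change z.q + t • (0 : Fin m → ℂ) = z.q; simp
      have h4 : ∑ j, ((κ i).1 j : ℂ) * (z.φ + t • (Pi.single l 1 : Fin n → ℂ)) j =
          ∑ j, ((κ i).1 j : ℂ) * z.φ j + t * ((κ i).1 l : ℂ) := by
        simp only [Pi.add_apply, Pi.smul_apply, smul_eq_mul, mul_add, Finset.sum_add_distrib]
        congr 1
        rw [Finset.sum_eq_single l (fun j _ hj => by simp [hj]) (by simp)]
        simp [mul_comm]
      simp only [mono, h1, h2, h3, h4, mul_add, Complex.exp_add]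
      ring_nf
    simp only [e1, e2]
    have h1 : HasDerivAt (fun t : ℂ => Complex.exp (t * (Complex.I * ((κ i).1 l : ℂ))))
        (Complex.I * ((κ i).1 l : ℂ)) 0 := by
      have := ((hasDerivAt_id (0 : ℂ)).mul_const (Complex.I * ((κ i).1 l : ℂ))).cexp
      simpa using this
    refine ((h1.mul_const (mono (κ i) z)).const_mul (a i z.yIx)).congr_deriv ?_
    ring

lemma sum_update_pred (h : Fin m → ℕ) (l : Fin m) (hl : h l ≠ 0) :
    ∑ i, h i = ∑ i, Function.update h l (h l - 1) i + 1 := by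
  rw [Finset.sum_update_of_mem (Finset.mem_univ l), ← Finset.add_sum_erase _ _ (Finset.mem_univ l),
    Finset.sdiff_singleton_eq_erase]
  omega

/-- The truncated subtraction is harmless: when the exponent vanishes, so does the factor in front.
-/
lemma hasDerivAt_prod_pow (h : Fin m → ℕ) (p : Fin m → ℂ) (l : Fin m) :
    HasDerivAt (fun t : ℂ => ∏ i, (p + t • (Pi.single l 1 : Fin m → ℂ)) i ^ h i)
      ((h l : ℂ) * ∏ i, p i ^ Function.update h l (h l - 1) i) 0 := by
  have e : (fun t : ℂ => ∏ i, (p + t • (Pi.single l 1 : Fin m → ℂ)) i ^ h i) =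
      fun t => (p l + t) ^ h l * ∏ i ∈ Finset.univ.erase l, p i ^ h i := by
    ext t
    rw [← Finset.mul_prod_erase _ _ (Finset.mem_univ l)]
    congr 1
    · simp
    · refine Finset.prod_congr rfl fun i hi => ?_
      simp [Finset.ne_of_mem_erase hi]
  have e2 : ∏ i, p i ^ Function.update h l (h l - 1) i =
      p l ^ (h l - 1) * ∏ i ∈ Finset.univ.erase l, p i ^ h i := by
    rw [← Finset.mul_prod_erase _ _ (Finset.mem_univ l)]
    congr 1
    · simp
    · refine Finset.prod_congr rfl fun i hi => ?_
      simp [Finset.ne_of_mem_erase hi]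
  rw [e, e2]
  have h1 := (((hasDerivAt_id (0 : ℂ)).const_add (p l)).pow (h l)).mul_const
    (∏ i ∈ Finset.univ.erase l, p i ^ h i)
  refine (HasDerivAt.congr_deriv h1 ?_)
  simp only [id, add_zero]
  ring

lemma pred_mul_weight_le (hw : w'.Le w) (hδ : 0 ≤ w'.δ) {τ : ℝ} (hτ : 0 < τ)
    (hs : w'.δ + τ ≤ w.δ) {κ κ' : Idx n m} (hk : κ'.1 = κ.1) {N : ℕ}
    (hN : ∑ i, κ'.2.1 i + ∑ i, κ'.2.2 i = N) (hN' : ∑ i, κ.2.1 i + ∑ i, κ.2.2 i = N + 1)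
    {x : ℕ} (hx : x ≤ N + 1) : (x : ℝ) * weight w' κ' ≤ τ⁻¹ * weight w κ := by
  unfold weight
  rw [hk, hN, hN']
  have h1 : Real.exp (w'.s * ∑ i, |(κ.1 i : ℝ)|) ≤ Real.exp (w.s * ∑ i, |(κ.1 i : ℝ)|) := by
    have := hw.2.2.2.1
    gcongr
  have h2 := succ_mul_pow_le hδ hτ hs N
  have h3 : (x : ℝ) ≤ ((N + 1 : ℕ) : ℝ) := by exact_mod_cast hx
  calc _ = Real.exp (w'.s * ∑ i, |(κ.1 i : ℝ)|) * (x * w'.δ ^ N) := by ring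
    _ ≤ Real.exp (w.s * ∑ i, |(κ.1 i : ℝ)|) * (((N + 1 : ℕ) : ℝ) * w'.δ ^ N) := by gcongr
    _ ≤ Real.exp (w.s * ∑ i, |(κ.1 i : ℝ)|) * (τ⁻¹ * w.δ ^ (N + 1)) := by gcongr
    _ = _ := by ring

/-- Derivatives with respect to `p` and `q`, in terms of the effect of the derivative on
monomials. -/
lemma HasMajorant.fderiv_fibre (h : HasMajorant S D w F M) (hw : w'.Le w) (hδ : 0 ≤ w'.δ)
    {τ : ℝ} (hτ : 0 < τ) (hs : w'.δ + τ ≤ w.δ) {v : Phase n m} (hv : v.yIx = 0)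
    (x : Idx n m → ℕ) (pred : Idx n m → Idx n m) (hk : ∀ κ, (pred κ).1 = κ.1)
    (hx : ∀ κ : Idx n m, x κ ≤ ∑ i, κ.2.1 i + ∑ i, κ.2.2 i)
    (hpred : ∀ κ : Idx n m, x κ ≠ 0 → ∑ i, κ.2.1 i + ∑ i, κ.2.2 i =
      ∑ i, (pred κ).2.1 i + ∑ i, (pred κ).2.2 i + 1)
    (hder : ∀ κ z, HasDerivAt (fun t : ℂ => mono κ (z + t • v)) (x κ * mono (pred κ) z) 0) :
    HasMajorant Set.univ D w' (fun z => fderiv ℂ F z v) (M / τ) := by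
  obtain ⟨ι, hι, κ, a, c, h⟩ := h
  rw [div_eq_inv_mul]
  have hO := isOpen_baseDomain D w
  have hsub := baseDomain_mono D hw
  refine h.hasMajorant_of_le (κ' := fun i => pred (κ i)) (a' := fun i b => (x (κ i) : ℂ) * a i b)
    (c' := fun i => (x (κ i) : ℝ) * c i) (by positivity) hδ (fun i => ?_) (fun i b hb => ?_)
    (fun i => mul_nonneg (by positivity) (h.nonneg i)) (fun i => ?_) fun z hz => ?_
  · exact ((h.diff i).const_mul _).mono hsub
  · rw [norm_mul, Complex.norm_natCast]
    gcongr
    exact h.bound i b (hsub hb)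
  · have hn := h.nonneg i
    have hwn : 0 ≤ weight w (κ i) := weight_nonneg (by linarith) _
    have h1 : (x (κ i) : ℝ) * weight w' (pred (κ i)) ≤ τ⁻¹ * weight w (κ i) := by
      rcases eq_or_ne (x (κ i)) 0 with h0 | h0
      · rw [h0]; simp; positivity
      · have := hpred _ h0
        exact pred_mul_weight_le hw hδ hτ hs (hk _) rfl this (this ▸ hx _)
    calc _ = c i * ((x (κ i) : ℝ) * weight w' (pred (κ i))) := by ring
      _ ≤ c i * (τ⁻¹ * weight w (κ i)) := by gcongr
      _ = _ := by ring
  · have hz' := domain_mono D hw hz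
    convert (h.hasSum_fderiv hz').2 v using 2 with i
    symm
    refine fderiv_apply_of_line ((h.differentiableOn_term i z hz').differentiableAt
      ((isOpen_domain D w).mem_nhds hz')) ?_
    have e1 : ∀ t : ℂ, (z + t • v).yIx = z.yIx := fun t => by
      change z.yIx + t • v.yIx = z.yIx; simp [hv]
    simp only [e1]
    refine ((hder (κ i) z).const_mul (a i z.yIx)).congr_deriv ?_
    ring

/-- Cauchy's estimates for the partial derivatives. -/
lemma HasMajorant.fderiv (h : HasMajorant S D w F M) (hw : w'.Le w) (hδ : 0 ≤ w'.δ)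
    {τ : ℝ} (hτ : 0 < τ) (c : Half n m ⊕ Half n m) (hc : width w' c + τ ≤ width w c) :
    HasMajorant Set.univ D w' (fun z => fderiv ℂ F z (basisVec c)) (M / τ) := by
  rcases c with (_ | i | l) | (_ | l | l)
  · refine h.fderiv_base hw hδ hτ rfl rfl rfl fun b hb ζ hζ => ⟨?_, ?_, ?_⟩
    · refine add_mem_nhd₁ hb.1 ?_
      simp only [width] at hc
      simp [basisVec, halfVec, Phase.yIx, Phase.y]
      linarith
    · convert (baseDomain_mono D hw hb).2.1 using 1
      simp [basisVec, halfVec, Phase.yIx, Phase.I]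
    · convert (baseDomain_mono D hw hb).2.2 using 1
      simp [basisVec, Phase.yIx, Phase.x]
  · refine h.fderiv_base hw hδ hτ rfl rfl rfl fun b hb ζ hζ => ⟨?_, ?_, ?_⟩
    · convert (baseDomain_mono D hw hb).1 using 1
      simp [basisVec, halfVec, Phase.yIx, Phase.y]
    · refine add_mem_nhd hb.2.1 ?_
      simp only [width] at hc
      simp [basisVec, halfVec, Phase.yIx, Phase.I, euclNorm_smul, euclNorm_single]
      linarith
    · convert (baseDomain_mono D hw hb).2.2 using 1
      simp [basisVec, Phase.yIx, Phase.x]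
  · refine h.fderiv_fibre hw hδ hτ hc rfl (fun κ => κ.2.1 l)
      (fun κ => (κ.1, Function.update κ.2.1 l (κ.2.1 l - 1), κ.2.2)) (fun _ => rfl)
      (fun κ => ?_) (fun κ hκ => ?_) fun κ z => ?_
    · exact (Finset.single_le_sum (f := κ.2.1) (fun _ _ => Nat.zero_le _)
        (Finset.mem_univ l)).trans (Nat.le_add_right _ _)
    · rw [sum_update_pred _ l hκ]; ring
    · set v : Phase n m := basisVec (.inl (.inr (.inr l)))
      have h1 : ∀ t : ℂ, (z + t • v).φ = z.φ := fun t => by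
        change z.φ + t • (0 : Fin n → ℂ) = z.φ; simp
      have h2 : ∀ t : ℂ, (z + t • v).p = z.p + t • (Pi.single l 1 : Fin m → ℂ) := fun t => rfl
      have h3 : ∀ t : ℂ, (z + t • v).q = z.q := fun t => by
        change z.q + t • (0 : Fin m → ℂ) = z.q; simp
      simp only [mono, h1, h2, h3]
      refine (((hasDerivAt_prod_pow κ.2.1 z.p l).const_mul _).mul_const _).congr_deriv ?_
      ring
  · refine h.fderiv_base hw hδ hτ rfl rfl rfl fun b hb ζ hζ => ⟨?_, ?_, ?_⟩
    · convert (baseDomain_mono D hw hb).1 using 1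
      simp [basisVec, Phase.yIx, Phase.y]
    · convert (baseDomain_mono D hw hb).2.1 using 1
      simp [basisVec, Phase.yIx, Phase.I]
    · refine add_mem_nhd₁ hb.2.2 ?_
      simp only [width] at hc
      simp [basisVec, halfVec, Phase.yIx, Phase.x]
      linarith
  · exact h.fderiv_φ hw hδ hτ hc l
  · refine h.fderiv_fibre hw hδ hτ hc rfl (fun κ => κ.2.2 l)
      (fun κ => (κ.1, κ.2.1, Function.update κ.2.2 l (κ.2.2 l - 1))) (fun _ => rfl)
      (fun κ => ?_) (fun κ hκ => ?_) fun κ z => ?_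
    · exact (Finset.single_le_sum (f := κ.2.2) (fun _ _ => Nat.zero_le _)
        (Finset.mem_univ l)).trans (Nat.le_add_left _ _)
    · rw [sum_update_pred _ l hκ]; ring
    · set v : Phase n m := basisVec (.inr (.inr (.inr l)))
      have h1 : ∀ t : ℂ, (z + t • v).φ = z.φ := fun t => by
        change z.φ + t • (0 : Fin n → ℂ) = z.φ; simp
      have h2 : ∀ t : ℂ, (z + t • v).p = z.p := fun t => by
        change z.p + t • (0 : Fin m → ℂ) = z.p; simp
      have h3 : ∀ t : ℂ, (z + t • v).q = z.q + t • (Pi.single l 1 : Fin m → ℂ) := fun t => rfl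
      simp only [mono, h1, h2, h3]
      refine ((hasDerivAt_prod_pow κ.2.2 z.q l).const_mul _).congr_deriv ?_
      ring

end Derivatives

end NormalForm

namespace NormalForm

variable {n m : ℕ}

/-! ### Fourier integrals over the rotations of the phases. -/

section Torus

open Set MeasureTheory

variable {ι : Type} [Fintype ι]

/-- The character `e^{2πi k·θ}`. -/
def torusChar (k : ι → ℤ) (θ : ι → ℝ) : ℂ :=
  Complex.exp (2 * Real.pi * Complex.I * ∑ i, (k i : ℂ) * (θ i : ℂ))

lemma torusChar_add (k l : ι → ℤ) (θ : ι → ℝ) :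
    torusChar (k + l) θ = torusChar k θ * torusChar l θ := by
  simp only [torusChar, ← Complex.exp_add, ← mul_add, ← Finset.sum_add_distrib, Pi.add_apply,
    Int.cast_add, add_mul]

lemma norm_torusChar (k : ι → ℤ) (θ : ι → ℝ) : ‖torusChar k θ‖ = 1 := by
  have : (2 * Real.pi * Complex.I * ∑ i, (k i : ℂ) * (θ i : ℂ)) =
      ((2 * Real.pi * ∑ i, (k i : ℝ) * θ i : ℝ) : ℂ) * Complex.I := by push_cast; ring
  rw [torusChar, this, Complex.norm_exp_ofReal_mul_I]

lemma continuous_torusChar (k : ι → ℤ) : Continuous (torusChar k) := by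
  unfold torusChar; fun_prop

lemma integral_exp_int {k : ℤ} (hk : k ≠ 0) :
    ∫ t in Icc (0 : ℝ) 1, Complex.exp (2 * Real.pi * Complex.I * ((k : ℂ) * (t : ℂ))) = 0 := by
  rw [integral_Icc_eq_integral_Ioc, ← intervalIntegral.integral_of_le zero_le_one]
  have hc : 2 * Real.pi * Complex.I * (k : ℂ) ≠ 0 :=
    mul_ne_zero Complex.two_pi_I_ne_zero (by exact_mod_cast hk)
  have := integral_exp_mul_complex (a := 0) (b := 1) hc
  simp only [mul_assoc] at this ⊢
  rw [this]
  have e : (2 * (Real.pi * (Complex.I * ((k : ℂ) * ((1 : ℝ) : ℂ))))) =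
      (k : ℂ) * (2 * Real.pi * Complex.I) := by push_cast; ring
  rw [e, Complex.exp_int_mul_two_pi_mul_I]
  simp

lemma integral_torusChar (k : ι → ℤ) [Decidable (k = 0)] :
    ∫ θ in Icc (0 : ι → ℝ) 1, torusChar k θ = if k = 0 then 1 else 0 := by
  have hK : Icc (0 : ι → ℝ) 1 = Set.pi univ fun _ => Icc 0 1 := by
    rw [Set.pi_univ_Icc]; rfl
  have e : ∀ θ : ι → ℝ, torusChar k θ =
      ∏ i, Complex.exp (2 * Real.pi * Complex.I * ((k i : ℂ) * (θ i : ℂ))) := by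
    intro θ
    rw [← Complex.exp_sum, ← Finset.mul_sum, torusChar]
  rw [hK, volume_pi, Measure.restrict_pi_pi]
  simp only [e]
  rw [integral_fintype_prod_eq_prod (𝕜 := ℂ) (f := fun i (t : ℝ) =>
    Complex.exp (2 * Real.pi * Complex.I * ((k i : ℂ) * (t : ℂ))))]
  split_ifs with h
  · subst h; simp
  · obtain ⟨i, hi⟩ : ∃ i, k i ≠ 0 := by
      by_contra! hc
      exact h (funext hc)
    exact Finset.prod_eq_zero (Finset.mem_univ i) (integral_exp_int hi)

open Classical in
/-- Fourier coefficients of an absolutely convergent trigonometric series. -/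
lemma integral_mul_torusChar {β : Type} [Countable β] {k : β → ι → ℤ} {c : β → ℂ}
    (hc : Summable fun i => ‖c i‖) {f : (ι → ℝ) → ℂ}
    (hf : ∀ θ, HasSum (fun i => c i * torusChar (k i) θ) (f θ)) (l : ι → ℤ) :
    ∫ θ in Icc (0 : ι → ℝ) 1, f θ * torusChar (-l) θ = ∑' i, if k i = l then c i else 0 := by
  have h1 : ∀ i, ∀ θ, c i * torusChar (k i) θ * torusChar (-l) θ =
      c i * torusChar (k i - l) θ := fun i θ => by
    rw [mul_assoc, ← torusChar_add, sub_eq_add_neg]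
  have hInt : ∀ i, IntegrableOn (fun θ => c i * torusChar (k i - l) θ) (Icc (0 : ι → ℝ) 1) :=
    fun i => ((continuous_torusChar _).const_mul (c i)).continuousOn.integrableOn_compact
      isCompact_Icc
  have hvol : (volume : Measure (ι → ℝ)).real (Icc 0 1) = 1 := by
    simp [Measure.real, Real.volume_Icc_pi]
  have := hasSum_integral_of_summable_integral_norm (μ := volume.restrict (Icc (0 : ι → ℝ) 1))
    (F := fun i θ => c i * torusChar (k i - l) θ) hInt (by
      simpa [norm_torusChar, hvol] using hc)
  have e : ∀ θ, ∑' i, c i * torusChar (k i - l) θ = f θ * torusChar (-l) θ := fun θ => by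
    simp only [← h1]
    exact ((hf θ).mul_right _).tsum_eq
  simp only [e] at this
  rw [← this.tsum_eq]
  refine tsum_congr fun i => ?_
  rw [integral_const_mul, integral_torusChar]
  simp [sub_eq_zero]

/-- Rotation of the angles `φ` and of the phases of `p` and `q`. -/
def rot (α : Fin n → ℝ) (β γ : Fin m → ℝ) (z : Phase n m) : Phase n m :=
  ((z.y, z.I, fun i => Complex.exp (2 * Real.pi * Complex.I * (β i : ℂ)) * z.p i),
    (z.x, fun i => z.φ i + 2 * Real.pi * (α i : ℂ),
      fun i => Complex.exp (2 * Real.pi * Complex.I * (γ i : ℂ)) * z.q i))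

lemma norm_exp_two_pi (t : ℝ) : ‖Complex.exp (2 * Real.pi * Complex.I * (t : ℂ))‖ = 1 := by
  have : 2 * Real.pi * Complex.I * (t : ℂ) = ((2 * Real.pi * t : ℝ) : ℂ) * Complex.I := by
    push_cast; ring
  rw [this, Complex.norm_exp_ofReal_mul_I]

lemma rot_mem {D : Base n} {w : Widths} {z : Phase n m} (hz : z ∈ domain m D w) (α : Fin n → ℝ)
    (β γ : Fin m → ℝ) : rot α β γ z ∈ domain m D w := by
  refine ⟨hz.1, fun i => ?_, fun i => ?_, fun i => ?_⟩
  · have := hz.2.1 i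
    have e : ((rot α β γ z).φ i).im = (z.φ i).im := by
      simp [rot, Phase.φ]
    rwa [e]
  · have := hz.2.2.1 i
    simpa only [rot, Phase.p, norm_mul, norm_exp_two_pi, one_mul] using this
  · have := hz.2.2.2 i
    simpa only [rot, Phase.q, norm_mul, norm_exp_two_pi, one_mul] using this

lemma mono_rot (κ : Idx n m) (α : Fin n → ℝ) (β γ : Fin m → ℝ) (z : Phase n m) :
    mono κ (rot α β γ z) = mono κ z * Complex.exp (2 * Real.pi * Complex.I *
      (∑ i, (κ.1 i : ℂ) * (α i : ℂ) + ∑ i, (κ.2.1 i : ℂ) * (β i : ℂ) +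
        ∑ i, (κ.2.2 i : ℂ) * (γ i : ℂ))) := by
  have hp : ∀ (h : Fin m → ℕ) (β : Fin m → ℝ) (p : Fin m → ℂ),
      ∏ i, (Complex.exp (2 * Real.pi * Complex.I * (β i : ℂ)) * p i) ^ h i =
        Complex.exp (2 * Real.pi * Complex.I * ∑ i, (h i : ℂ) * (β i : ℂ)) * ∏ i, p i ^ h i := by
    intro h β p
    rw [Finset.mul_sum, Complex.exp_sum, ← Finset.prod_mul_distrib]
    refine Finset.prod_congr rfl fun i _ => ?_
    rw [mul_pow, ← Complex.exp_nat_mul]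
    ring_nf
  have hφ : Complex.exp (Complex.I * ∑ i, (κ.1 i : ℂ) * (z.φ i + 2 * Real.pi * (α i : ℂ))) =
      Complex.exp (2 * Real.pi * Complex.I * ∑ i, (κ.1 i : ℂ) * (α i : ℂ)) *
        Complex.exp (Complex.I * ∑ i, (κ.1 i : ℂ) * z.φ i) := by
    rw [← Complex.exp_add]
    congr 1
    simp only [mul_add, Finset.sum_add_distrib, Finset.mul_sum]
    rw [add_comm]
    congr 1
    refine Finset.sum_congr rfl fun i _ => ?_
    ring
  have e1 : (rot α β γ z).φ = fun i => z.φ i + 2 * Real.pi * (α i : ℂ) := rfl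
  have e2 : (rot α β γ z).p = fun i => Complex.exp (2 * Real.pi * Complex.I * (β i : ℂ)) * z.p i :=
    rfl
  have e3 : (rot α β γ z).q = fun i => Complex.exp (2 * Real.pi * Complex.I * (γ i : ℂ)) * z.q i :=
    rfl
  simp only [mono, e1, e2, e3, hp, hφ]
  simp only [mul_add, Complex.exp_add]
  ring

/-- The torus acting on all the phases. -/
abbrev TorusIdx (n m : ℕ) : Type := Fin n ⊕ Fin m ⊕ Fin m

def torusRot (θ : TorusIdx n m → ℝ) (z : Phase n m) : Phase n m :=
  rot (fun i => θ (.inl i)) (fun i => θ (.inr (.inl i))) (fun i => θ (.inr (.inr i))) z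

/-- The rotations that preserve `J`. -/
def resRot (θ : TorusIdx n m → ℝ) (z : Phase n m) : Phase n m :=
  rot (fun i => θ (.inl i)) (fun i => θ (.inr (.inl i))) (fun i => -θ (.inr (.inl i))) z

def idxChar (κ : Idx n m) : TorusIdx n m → ℤ :=
  Sum.elim κ.1 (Sum.elim (fun i => (κ.2.1 i : ℤ)) fun i => (κ.2.2 i : ℤ))

/-- As p and q turn in opposite directions, only the difference of their exponents survives.
`resRot` ignores the last block of angles, hence the zero there; the same torus as for `torusRot` is
kept so that one Fourier lemma serves both actions. -/
def resChar (κ : Idx n m) : TorusIdx n m → ℤ :=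
  Sum.elim κ.1 (Sum.elim (fun i => (κ.2.1 i : ℤ) - (κ.2.2 i : ℤ)) 0)

lemma idxChar_injective : Function.Injective (idxChar : Idx n m → _) := by
  intro κ κ' h
  ext i
  · simpa [idxChar] using congrFun h (.inl i)
  · simpa [idxChar] using congrFun h (.inr (.inl i))
  · simpa [idxChar] using congrFun h (.inr (.inr i))

lemma mono_torusRot (κ : Idx n m) (θ : TorusIdx n m → ℝ) (z : Phase n m) :
    mono κ (torusRot θ z) = mono κ z * torusChar (idxChar κ) θ := by
  rw [torusRot, mono_rot, torusChar]
  simp [idxChar, Fintype.sum_sum_type, add_assoc]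

lemma mono_resRot (κ : Idx n m) (θ : TorusIdx n m → ℝ) (z : Phase n m) :
    mono κ (resRot θ z) = mono κ z * torusChar (resChar κ) θ := by
  rw [resRot, mono_rot, torusChar]
  congr 3
  simp only [resChar, Fintype.sum_sum_type, Sum.elim_inl, Sum.elim_inr, Int.cast_sub, sub_mul,
    Finset.sum_sub_distrib, Complex.ofReal_neg, mul_neg, Finset.sum_neg_distrib, Pi.zero_apply,
    Int.cast_zero, zero_mul, Finset.sum_const_zero, add_zero, Int.cast_natCast]
  ring

/-- The resonant indices `(0, h, h)`. -/
def resonant : Set (Idx n m) := {κ | κ.1 = 0 ∧ κ.2.1 = κ.2.2}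

lemma resChar_eq_zero_iff (κ : Idx n m) : resChar κ = 0 ↔ κ ∈ resonant := by
  constructor
  · intro h
    refine ⟨funext fun i => ?_, funext fun i => ?_⟩
    · simpa [resChar] using congrFun h (.inl i)
    · have := congrFun h (.inr (.inl i))
      simp only [resChar, Sum.elim_inr, Sum.elim_inl, Pi.zero_apply] at this
      omega
  · rintro ⟨h1, h2⟩
    ext (i | i | i) <;> simp [resChar, h1, h2]

lemma yIJ_resRot (θ : TorusIdx n m → ℝ) (z : Phase n m) : (resRot θ z).yIJ = z.yIJ := by
  have : (resRot θ z).J = z.J := by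
    ext i
    simp only [Phase.J, resRot, rot, Phase.p, Phase.q]
    rw [mul_mul_mul_comm, ← Complex.exp_add]
    simp
  simp only [Phase.yIJ, this]
  rfl

end Torus

/-! ### Uniqueness and holomorphy of the coefficients; the average as a mean. -/

section Coefficients

open Set MeasureTheory

variable {D : Base n} {w : Widths} {F : Phase n m → ℂ}

lemma weight_pos (hδ : 0 < w.δ) (κ : Idx n m) : 0 < weight w κ := by
  unfold weight; positivity

/-- Independent rotations of all the phases distinguish all the indices (`idxChar_injective`), so a
Fourier integral isolates one term. Uniqueness and holomorphy of the coefficients both follow from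
this formula. -/
lemma IsExpansion.integral_torusRot {a : Idx n m → ℂ × (Fin n → ℂ) × ℂ → ℂ}
    (h : IsExpansion D w F a) {z : Phase n m} (hz : z ∈ domain m D w) (κ : Idx n m) :
    ∫ θ in Icc (0 : TorusIdx n m → ℝ) 1, F (torusRot θ z) * torusChar (-idxChar κ) θ =
      a κ z.yIx * mono κ z := by
  classical
  rw [integral_mul_torusChar (k := idxChar) (c := fun κ => a κ z.yIx * mono κ z)
    (h z hz).summable.norm (fun θ => ?_)]
  · rw [tsum_eq_single κ]
    · simp
    · intro κ' hκ'
      simp [idxChar_injective.ne hκ']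
  · have := h (torusRot θ z) (rot_mem hz _ _ _)
    simp only [mono_torusRot, ← mul_assoc] at this
    exact this

/-- The point of the domain over `b` with `φ = 0` and all the `p` and `q` equal to `δ / 2`. -/
def refPoint (m : ℕ) (w : Widths) (b : ℂ × (Fin n → ℂ) × ℂ) : Phase n m :=
  ((b.1, b.2.1, fun _ => ((w.δ / 2 : ℝ) : ℂ)), (b.2.2, 0, fun _ => ((w.δ / 2 : ℝ) : ℂ)))

lemma refPoint_mem (hs : 0 < w.s) (hδ : 0 < w.δ) {b : ℂ × (Fin n → ℂ) × ℂ}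
    (hb : b ∈ baseDomain D w) : refPoint m w b ∈ domain m D w := by
  have h : ‖((w.δ / 2 : ℝ) : ℂ)‖ < w.δ := by
    rw [Complex.norm_real, Real.norm_of_nonneg (by positivity)]; linarith
  exact ⟨hb, fun i => by simpa [refPoint, Phase.φ] using hs, fun i => h, fun i => h⟩

lemma mono_refPoint_ne_zero (hδ : 0 < w.δ) (b : ℂ × (Fin n → ℂ) × ℂ) (κ : Idx n m) :
    mono κ (refPoint m w b) ≠ 0 := by
  have h : ((w.δ / 2 : ℝ) : ℂ) ≠ 0 := by
    exact_mod_cast (by positivity : w.δ / 2 ≠ 0)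
  simp only [mono, refPoint, Phase.p, Phase.q]
  exact mul_ne_zero (mul_ne_zero (Complex.exp_ne_zero _) (Finset.prod_ne_zero_iff.mpr fun i _ =>
    pow_ne_zero _ h)) (Finset.prod_ne_zero_iff.mpr fun i _ => pow_ne_zero _ h)

/-- The Taylor-Fourier coefficients are unique. -/
lemma IsExpansion.unique {a a' : Idx n m → ℂ × (Fin n → ℂ) × ℂ → ℂ} (hs : 0 < w.s) (hδ : 0 < w.δ)
    (h : IsExpansion D w F a) (h' : IsExpansion D w F a') {b : ℂ × (Fin n → ℂ) × ℂ}
    (hb : b ∈ baseDomain D w) (κ : Idx n m) : a κ b = a' κ b := by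
  have hz := refPoint_mem (m := m) hs hδ hb
  have := (h.integral_torusRot hz κ).symm.trans (h'.integral_torusRot hz κ)
  exact mul_right_cancel₀ (mono_refPoint_ne_zero hδ b κ) this

lemma isExpansion_coeff (h : ∃ a, IsExpansion D w F a) : IsExpansion D w F (coeff D w F) := by
  rw [coeff, dif_pos h]
  exact h.choose_spec

/-- The Taylor-Fourier coefficients of a holomorphic function are holomorphic. -/
lemma differentiableOn_coeff (hs : 0 < w.s) (hδ : 0 < w.δ) (h : ∃ a, IsExpansion D w F a)
    (hF : DifferentiableOn ℂ F (domain m D w)) (κ : Idx n m) :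
    DifferentiableOn ℂ (coeff D w F κ) (baseDomain D w) := by
  have hcont : Continuous fun p : (TorusIdx n m → ℝ) × (ℂ × (Fin n → ℂ) × ℂ) =>
      torusRot p.1 (refPoint m w p.2) := by
    unfold torusRot rot refPoint Phase.y Phase.I Phase.p Phase.x Phase.φ Phase.q
    fun_prop
  have hdiff : ∀ θ, Differentiable ℂ fun b : ℂ × (Fin n → ℂ) × ℂ =>
      torusRot θ (refPoint m w b) := by
    intro θ
    unfold torusRot rot refPoint Phase.y Phase.I Phase.p Phase.x Phase.φ Phase.q
    fun_prop
  have h1 : DifferentiableOn ℂ (fun b => ∫ θ in Icc (0 : TorusIdx n m → ℝ) 1,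
      F (torusRot θ (refPoint m w b)) * torusChar (-idxChar κ) θ) (baseDomain D w) := by
    refine differentiableOn_setIntegral isCompact_Icc (isOpen_baseDomain D w) ?_ fun θ _ => ?_
    · refine ContinuousOn.mul (hF.continuousOn.comp hcont.continuousOn fun p hp => ?_)
        ((continuous_torusChar _).comp continuous_fst).continuousOn
      exact rot_mem (refPoint_mem hs hδ hp.2) _ _ _
    · refine DifferentiableOn.mul_const (hF.comp (hdiff θ).differentiableOn fun b hb => ?_) _
      exact rot_mem (refPoint_mem hs hδ hb) _ _ _
  -- The monomial at the reference point is a nonzero constant, independent of b; dividing the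
  -- Fourier integral by it leaves the coefficient.
  have h2 : ∀ b, mono κ (refPoint m w b) = mono κ (refPoint m w (0 : ℂ × (Fin n → ℂ) × ℂ)) :=
    fun b => rfl
  refine (h1.mul_const (mono κ (refPoint m w (0 : ℂ × (Fin n → ℂ) × ℂ)))⁻¹).congr fun b hb => ?_
  rw [(isExpansion_coeff h).integral_torusRot (refPoint_mem hs hδ hb) κ, h2, mul_assoc,
    mul_inv_cancel₀ (mono_refPoint_ne_zero hδ _ κ), mul_one]
  rfl

lemma offAverage_eq_tsum (z : Phase n m) : offAverage D w F z =
    ∑' κ, ((resonant : Set (Idx n m))ᶜ).indicator (fun κ => coeff D w F κ z.yIx * mono κ z) κ := by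
  have e2 : ∀ κ : Idx n m, (if κ.1 = 0 ∧ κ.2.1 = κ.2.2 then 0 else
      coeff D w F κ z.yIx * mono κ z) =
      ((resonant : Set (Idx n m))ᶜ).indicator (fun κ => coeff D w F κ z.yIx * mono κ z) κ := by
    intro κ
    by_cases hκ : κ ∈ (resonant : Set (Idx n m))
    · rw [Set.indicator_of_notMem (by simpa using hκ)]
      exact if_pos hκ
    · rw [Set.indicator_of_mem hκ]
      exact if_neg hκ
  exact tsum_congr e2

/-- The average is the mean over the rotations that preserve `J`. -/
lemma average_eq_integral (h : ∃ a, IsExpansion D w F a) {z : Phase n m}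
    (hz : z ∈ domain m D w) :
    average D w F z = ∫ θ in Icc (0 : TorusIdx n m → ℝ) 1, F (resRot θ z) := by
  classical
  have hE := isExpansion_coeff h
  have h1 := integral_mul_torusChar (k := resChar) (c := fun κ => coeff D w F κ z.yIx * mono κ z)
    (hE z hz).summable.norm (f := fun θ => F (resRot θ z)) (fun θ => by
      have := hE (resRot θ z) (rot_mem hz _ _ _)
      simp only [mono_resRot, ← mul_assoc] at this
      exact this) 0
  have h2 : ∀ θ : TorusIdx n m → ℝ, torusChar (-0) θ = 1 := fun θ => by simp [torusChar]
  simp only [h2, mul_one] at h1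
  rw [h1, average, offAverage_eq_tsum, ← (hE z hz).tsum_eq, sub_eq_iff_eq_add]
  have hsum := (hE z hz).summable
  have e1 : ∀ κ : Idx n m, (if resChar κ = 0 then coeff D w F κ z.yIx * mono κ z else 0) =
      (resonant : Set (Idx n m)).indicator (fun κ => coeff D w F κ z.yIx * mono κ z) κ := fun κ => by
    simp only [resChar_eq_zero_iff, Set.indicator]
  simp only [e1]
  rw [← Summable.tsum_add (hsum.indicator _) (hsum.indicator _)]
  refine tsum_congr fun κ => ?_
  rw [Set.indicator_self_add_compl_apply]

/-- The average is a mean over rotations that fix G, so G comes out of the integral. It is used for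
G = 1/ω_y, a function of y, I, J. -/
lemma offAverage_mul_of_invariant {G : Phase n m → ℂ} (hF : ∃ a, IsExpansion D w F a)
    (hFG : ∃ a, IsExpansion D w (fun z => F z * G z) a)
    (hG : ∀ θ z, G (resRot θ z) = G z) {z : Phase n m} (hz : z ∈ domain m D w) :
    offAverage D w (fun z => F z * G z) z = offAverage D w F z * G z := by
  have h1 := average_eq_integral hF hz
  have h2 := average_eq_integral hFG hz
  simp only [hG, integral_mul_const, ← h1] at h2
  simp only [average] at h2
  linear_combination -h2

end Coefficients

end NormalForm

namespace NormalForm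

variable {n m : ℕ}

/-! ### Passage between the norm and majorants. -/

section Norm

open Set

variable {S : Set (Idx n m)} {D : Base n} {w : Widths} {F : Phase n m → ℂ} {M : ℝ}

/-- The sum of the terms with the same index. -/
lemma IsSeries.isExpansion {ι : Type} {κ : ι → Idx n m} {a : ι → ℂ × (Fin n → ℂ) × ℂ → ℂ}
    {c : ι → ℝ} (h : IsSeries S D w F M κ a c) :
    IsExpansion D w F fun κ₀ b => ∑' i : {i // κ i = κ₀}, a i b := by
  intro z hz
  have h1 := (Equiv.sigmaFiberEquiv κ).hasSum_iff.mpr (h.hasSum z hz)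
  have h2 := h1.summable.sigma_factor
  refine h1.sigma fun κ₀ => ?_
  rw [← tsum_mul_right]
  have e : ∀ i : {i // κ i = κ₀}, ((fun i => a i z.yIx * mono (κ i) z) ∘ Equiv.sigmaFiberEquiv κ)
      ⟨κ₀, i⟩ = a i z.yIx * mono κ₀ z := by
    rintro ⟨i, rfl⟩; rfl
  have h3 := (h2 κ₀).hasSum
  simp only [e] at h3 ⊢
  exact h3

lemma HasMajorant.exists_isExpansion (h : HasMajorant S D w F M) : ∃ a, IsExpansion D w F a := by
  obtain ⟨ι, hι, κ, a, c, h⟩ := h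
  exact ⟨_, h.isExpansion⟩

/-- Collecting the terms of equal index can only lower the weighted sum, by the triangle inequality;
by uniqueness the collected sums are the coefficients. With `hasMajorant_norm` this makes the norm
the least majorant. -/
lemma HasMajorant.norm_le_ofReal (hw : w.Pos) (h : HasMajorant S D w F M) :
    norm D w F ≤ ENNReal.ofReal M := by
  obtain ⟨-, -, -, hs, hδ⟩ := hw
  have hex := h.exists_isExpansion
  obtain ⟨ι, hι, κ, a, c, h⟩ := h
  have hnn : ∀ i, 0 ≤ c i * weight w (κ i) := fun i =>
    mul_nonneg (h.nonneg i) (weight_nonneg hδ.le _)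
  have hco : ∀ κ₀, ∀ b ∈ baseDomain D w, ‖coeff D w F κ₀ b‖ₑ ≤
      ∑' i : {i // κ i = κ₀}, ENNReal.ofReal (c i) := by
    intro κ₀ b hb
    have hsum : Summable fun i : {i // κ i = κ₀} => c i := by
      have h1 : Summable fun i : {i // κ i = κ₀} => c i * weight w (κ i) :=
        h.summable.comp_injective Subtype.val_injective
      have h2 : (fun i : {i // κ i = κ₀} => c i * weight w (κ i)) =
          fun i : {i // κ i = κ₀} => c i * weight w κ₀ := by
        ext ⟨i, rfl⟩; rfl
      rw [h2] at h1
      exact (summable_mul_right_iff (weight_pos hδ κ₀).ne').mp h1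
    rw [(isExpansion_coeff hex).unique hs hδ h.isExpansion hb κ₀,
      ← ENNReal.ofReal_tsum_of_nonneg (fun i : {i // κ i = κ₀} => h.nonneg i) hsum,
      ← ofReal_norm]
    exact ENNReal.ofReal_le_ofReal
      (tsum_of_norm_bounded hsum.hasSum fun i => h.bound i b hb)
  rw [norm, if_pos hex]
  calc _ ≤ ∑' κ₀ : Idx n m, (∑' i : {i // κ i = κ₀}, ENNReal.ofReal (c i)) *
        ENNReal.ofReal (weight w κ₀) := by
        refine ENNReal.tsum_le_tsum fun κ₀ => ?_
        gcongr
        · exact iSup₂_le fun b hb => hco κ₀ b hb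
        · exact le_rfl
    _ = ∑' x : (κ₀ : Idx n m) × {i // κ i = κ₀},
        ENNReal.ofReal (c (Equiv.sigmaFiberEquiv κ x) * weight w (κ (Equiv.sigmaFiberEquiv κ x))) := by
        rw [ENNReal.tsum_sigma']
        refine tsum_congr fun κ₀ => ?_
        rw [← ENNReal.tsum_mul_right]
        refine tsum_congr ?_
        rintro ⟨i, rfl⟩
        exact (ENNReal.ofReal_mul (h.nonneg i)).symm
    _ = ∑' i, ENNReal.ofReal (c i * weight w (κ i)) :=
        (Equiv.sigmaFiberEquiv κ).tsum_eq fun i => ENNReal.ofReal (c i * weight w (κ i))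
    _ = ENNReal.ofReal (∑' i, c i * weight w (κ i)) :=
        (ENNReal.ofReal_tsum_of_nonneg hnn h.summable).symm
    _ ≤ ENNReal.ofReal M := ENNReal.ofReal_le_ofReal h.tsum_le

/-- A coefficient with nonresonant index is, by uniqueness, a sum over an empty fibre. -/
lemma HasMajorant.offAverage_eq_zero (hw : w.Pos) (h : HasMajorant resonant D w F M)
    {z : Phase n m} (hz : z ∈ domain m D w) : offAverage D w F z = 0 := by
  obtain ⟨-, -, -, hs, hδ⟩ := hw
  have hex := h.exists_isExpansion
  obtain ⟨ι, hι, κ, a, c, h⟩ := h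
  rw [offAverage_eq_tsum]
  rw [← tsum_zero (α := ℂ) (β := Idx n m)]
  refine tsum_congr fun κ₀ => ?_
  by_cases hκ : κ₀ ∈ (resonant : Set (Idx n m))
  · rw [Set.indicator_of_notMem (by simpa using hκ)]
  · rw [Set.indicator_of_mem hκ, (isExpansion_coeff hex).unique hs hδ h.isExpansion hz.1 κ₀]
    have : IsEmpty {i // κ i = κ₀} := ⟨fun i => hκ (i.2 ▸ h.mem i)⟩
    simp

/-- The expansion of a holomorphic function of finite norm. -/
lemma isSeries_coeff (hw : w.Pos) (hF : DifferentiableOn ℂ F (domain m D w))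
    (hfin : norm D w F ≠ ⊤) :
    IsSeries univ D w F (norm D w F).toReal id (coeff D w F)
      (fun κ => (⨆ b ∈ baseDomain D w, ‖coeff D w F κ b‖ₑ).toReal) := by
  obtain ⟨-, -, -, hs, hδ⟩ := hw
  have hex : ∃ a, IsExpansion D w F a := by
    by_contra hex
    exact hfin (if_neg hex)
  have hnorm : norm D w F = ∑' κ : Idx n m, (⨆ b ∈ baseDomain D w, ‖coeff D w F κ b‖ₑ) *
      ENNReal.ofReal (weight w κ) := if_pos hex
  have hterm : ∀ κ : Idx n m, (⨆ b ∈ baseDomain D w, ‖coeff D w F κ b‖ₑ) *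
      ENNReal.ofReal (weight w κ) ≠ ⊤ := ENNReal.ne_top_of_tsum_ne_top (hnorm ▸ hfin)
  have hsup : ∀ κ : Idx n m, (⨆ b ∈ baseDomain D w, ‖coeff D w F κ b‖ₑ) ≠ ⊤ := by
    intro κ h
    refine hterm κ ?_
    rw [h, ENNReal.top_mul]
    simpa using weight_pos hδ κ
  have e : ∀ κ : Idx n m, (⨆ b ∈ baseDomain D w, ‖coeff D w F κ b‖ₑ).toReal * weight w κ =
      ((⨆ b ∈ baseDomain D w, ‖coeff D w F κ b‖ₑ) * ENNReal.ofReal (weight w κ)).toReal := by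
    intro κ
    rw [ENNReal.toReal_mul, ENNReal.toReal_ofReal (weight_nonneg hδ.le κ)]
  refine ⟨fun _ => mem_univ _, differentiableOn_coeff hs hδ hex hF, fun κ b hb => ?_,
    fun _ => ENNReal.toReal_nonneg, ?_, ?_, isExpansion_coeff hex⟩
  · rw [← toReal_enorm]
    exact ENNReal.toReal_mono (hsup κ) (le_iSup₂ (f := fun b _ => ‖coeff D w F κ b‖ₑ) b hb)
  · simp only [id, e]
    exact ENNReal.summable_toReal (hnorm ▸ hfin)
  · simp only [id, e]
    rw [← ENNReal.tsum_toReal_eq hterm, hnorm]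

lemma hasMajorant_norm (hw : w.Pos) (hF : DifferentiableOn ℂ F (domain m D w))
    (hfin : norm D w F ≠ ⊤) : HasMajorant univ D w F (norm D w F).toReal :=
  ⟨Idx n m, inferInstance, _, _, _, isSeries_coeff hw hF hfin⟩

lemma hasMajorant_offAverage (hw : w.Pos) (hF : DifferentiableOn ℂ F (domain m D w))
    (hfin : norm D w F ≠ ⊤) :
    HasMajorant resonantᶜ D w (offAverage D w F) (norm D w F).toReal := by
  refine ((isSeries_coeff hw hF hfin).hasMajorant_subtype hw.2.2.2.2.le resonantᶜ).congr
    fun z _ => ?_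
  rw [offAverage_eq_tsum]
  exact (tsum_subtype (resonant : Set (Idx n m))ᶜ
    fun κ => coeff D w F κ z.yIx * mono κ z).symm

lemma hasMajorant_average (hw : w.Pos) (hF : DifferentiableOn ℂ F (domain m D w))
    (hfin : norm D w F ≠ ⊤) :
    HasMajorant resonant D w (average D w F) (norm D w F).toReal := by
  have h := isSeries_coeff hw hF hfin
  refine (h.hasMajorant_subtype hw.2.2.2.2.le resonant).congr fun z hz => ?_
  have hs := (h.hasSum z hz).summable
  rw [average, offAverage_eq_tsum, ← (h.hasSum z hz).tsum_eq, sub_eq_iff_eq_add]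
  exact ((hs.tsum_subtype_add_tsum_subtype_compl resonant).symm.trans
    (congrArg _ (tsum_subtype (resonant : Set (Idx n m))ᶜ
      fun κ => coeff D w F κ z.yIx * mono κ z)))

end Norm

end NormalForm

namespace NormalForm

variable {n m : ℕ}

/-! ### The homological equation, integrated along characteristics. -/

section Homological

open Set MeasureTheory

variable {S : Set (Idx n m)} {D : Base n} {w w' : Widths} {F : Phase n m → ℂ} {M : ℝ}

/-- The real centre moves along with the point, from x₀ to a inside the convex set, and the distance
between the two is multiplied by t. -/
lemma segment_mem_nhd₁ {A : Set ℝ} (hA : Convex ℝ A) {x₀ : ℝ} (hx₀ : x₀ ∈ A) {θ : ℝ} {s : ℂ}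
    (hs : (x₀ : ℂ) + s ∈ nhd₁ A θ) {t : ℝ} (ht : t ∈ Icc (0 : ℝ) 1) :
    (x₀ : ℂ) + t • s ∈ nhd₁ A θ := by
  obtain ⟨a, ha, h⟩ := hs
  refine ⟨(1 - t) * x₀ + t * a, hA hx₀ ha (by linarith [ht.2]) ht.1 (by ring), ?_⟩
  have e : (x₀ : ℂ) + t • s - (((1 - t) * x₀ + t * a : ℝ) : ℂ) = (t : ℂ) * ((x₀ : ℂ) + s - a) := by
    rw [Complex.real_smul]; push_cast; ring
  rw [e, norm_mul, Complex.norm_real, Real.norm_of_nonneg ht.1]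
  calc t * ‖(x₀ : ℂ) + s - a‖ ≤ 1 * ‖(x₀ : ℂ) + s - a‖ := by gcongr; exact ht.2
    _ < θ := by rwa [one_mul]

lemma segment_mem_baseDomain (hΞ : Convex ℝ D.Ξ) {x₀ : ℝ} (hx₀ : x₀ ∈ D.Ξ)
    {b : ℂ × (Fin n → ℂ) × ℂ} (hb : b ∈ baseDomain D w) {t : ℝ} (ht : t ∈ Icc (0 : ℝ) 1) :
    (b.1, b.2.1, (x₀ : ℂ) + t • (b.2.2 - x₀)) ∈ baseDomain D w :=
  ⟨hb.1, hb.2.1, segment_mem_nhd₁ hΞ hx₀ (by simpa using hb.2.2) ht⟩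

/-- The logarithmic derivative of the monomial `κ` along the characteristics. -/
def charRate (A : Fin n → ℂ × (Fin n → ℂ) × (Fin m → ℂ) → ℂ)
    (B : Fin m → ℂ × (Fin n → ℂ) × (Fin m → ℂ) → ℂ) (κ : Idx n m)
    (u : ℂ × (Fin n → ℂ) × (Fin m → ℂ)) : ℂ :=
  Complex.I * ∑ l, (κ.1 l : ℂ) * A l u + ∑ l, ((κ.2.2 l : ℂ) - (κ.2.1 l : ℂ)) * B l u

/-- The tangent vector to the characteristics. -/
def charVec (A : Fin n → ℂ × (Fin n → ℂ) × (Fin m → ℂ) → ℂ)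
    (B : Fin m → ℂ × (Fin n → ℂ) × (Fin m → ℂ) → ℂ) (z : Phase n m) : Phase n m :=
  ((0, 0, fun i => -(B i z.yIJ * z.p i)), (1, fun l => A l z.yIJ, fun i => B i z.yIJ * z.q i))

/-- The characteristic through `z`. -/
def charCurve (A : Fin n → ℂ × (Fin n → ℂ) × (Fin m → ℂ) → ℂ)
    (B : Fin m → ℂ × (Fin n → ℂ) × (Fin m → ℂ) → ℂ) (z : Phase n m) (u : ℂ) : Phase n m :=
  ((z.y, z.I, fun i => Complex.exp (-(u * B i z.yIJ)) * z.p i),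
    (z.x + u, fun l => z.φ l + u * A l z.yIJ, fun i => Complex.exp (u * B i z.yIJ) * z.q i))

/-- The solution of the homological equation with right hand side `a(y, I, x) e^{i k·φ} p^h q^j`. -/
def homTerm (a : ℂ × (Fin n → ℂ) × ℂ → ℂ) (E : ℂ × (Fin n → ℂ) × (Fin m → ℂ) → ℂ) (κ : Idx n m)
    (x₀ : ℝ) (z : Phase n m) : ℂ :=
  mono κ z * ((z.x - x₀) • ∫ t in Icc (0 : ℝ) 1, a (z.y, z.I, (x₀ : ℂ) + t • (z.x - x₀)) *
    Complex.exp (((t : ℂ) - 1) * (z.x - x₀) * E z.yIJ))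

variable {A : Fin n → ℂ × (Fin n → ℂ) × (Fin m → ℂ) → ℂ}
  {B : Fin m → ℂ × (Fin n → ℂ) × (Fin m → ℂ) → ℂ}

lemma charCurve_zero (z : Phase n m) : charCurve A B z 0 = z := by
  simp [charCurve, Phase.y, Phase.I, Phase.p, Phase.x, Phase.φ, Phase.q]

lemma yIJ_charCurve (z : Phase n m) (u : ℂ) : (charCurve A B z u).yIJ = z.yIJ := by
  have : (charCurve A B z u).J = z.J := by
    ext i
    simp only [Phase.J, charCurve, Phase.p, Phase.q]
    rw [mul_mul_mul_comm, ← Complex.exp_add]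
    simp
  simp only [Phase.yIJ, this]
  rfl

lemma mono_charCurve (κ : Idx n m) (z : Phase n m) (u : ℂ) :
    mono κ (charCurve A B z u) = mono κ z * Complex.exp (u * charRate A B κ z.yIJ) := by
  have hp : ∀ (h : Fin m → ℕ) (p f : Fin m → ℂ), ∏ i, (Complex.exp (f i) * p i) ^ h i =
      Complex.exp (∑ i, (h i : ℂ) * f i) * ∏ i, p i ^ h i := by
    intro h p f
    rw [Complex.exp_sum, ← Finset.prod_mul_distrib]
    refine Finset.prod_congr rfl fun i _ => ?_
    rw [mul_pow, ← Complex.exp_nat_mul]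
  have e1 : (charCurve A B z u).φ = fun l => z.φ l + u * A l z.yIJ := rfl
  have e2 : (charCurve A B z u).p = fun i => Complex.exp (-(u * B i z.yIJ)) * z.p i := rfl
  have e3 : (charCurve A B z u).q = fun i => Complex.exp (u * B i z.yIJ) * z.q i := rfl
  have e4 : u * charRate A B κ z.yIJ = Complex.I * ∑ l, (κ.1 l : ℂ) * (u * A l z.yIJ) +
      ∑ i, (κ.2.1 i : ℂ) * -(u * B i z.yIJ) + ∑ i, (κ.2.2 i : ℂ) * (u * B i z.yIJ) := by
    simp only [charRate, mul_add, Finset.mul_sum, sub_mul, Finset.sum_sub_distrib, mul_neg,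
      Finset.sum_neg_distrib, mul_sub]
    have e : ∀ l, u * (Complex.I * ((κ.1 l : ℂ) * A l z.yIJ)) =
      Complex.I * ((κ.1 l : ℂ) * (u * A l z.yIJ)) := fun l => by ring
    have e' : ∀ (c : ℂ) l, u * (c * B l z.yIJ) = c * (u * B l z.yIJ) := fun c l => by ring
    simp only [e, e']
    ring
  simp only [mono, e1, e2, e3, hp, e4]
  simp only [mul_add, Finset.sum_add_distrib, Complex.exp_add]
  ring

lemma hasDerivAt_charCurve (z : Phase n m) :
    HasDerivAt (charCurve A B z) (charVec A B z) 0 := by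
  have hB : ∀ (b c : ℂ), HasDerivAt (fun u : ℂ => Complex.exp (u * b) * c) (b * c) 0 := by
    intro b c
    have := (((hasDerivAt_id (0 : ℂ)).mul_const b).cexp).mul_const c
    simpa using this
  refine HasDerivAt.prodMk (HasDerivAt.prodMk (hasDerivAt_const _ _)
    (HasDerivAt.prodMk (hasDerivAt_const _ _) ?_)) (HasDerivAt.prodMk ?_ (HasDerivAt.prodMk ?_ ?_))
  · refine hasDerivAt_pi.mpr fun i => ?_
    simpa using hB (-B i z.yIJ) (z.p i)
  · simpa using (hasDerivAt_id (0 : ℂ)).const_add z.x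
  · refine hasDerivAt_pi.mpr fun i => ?_
    simpa using ((hasDerivAt_id (0 : ℂ)).mul_const (A i z.yIJ)).const_add (z.φ i)
  · exact hasDerivAt_pi.mpr fun i => hB (B i z.yIJ) (z.q i)

/-- `homTerm` is variation of constants: the integral from x₀ to x of a(σ) e^{(σ - x)E}, times the
monomial. Along the characteristic J, hence E, is constant and the monomial grows like e^{uE}, which
cancels the dependence of e^{-xE} on u. What remains is a constant times a primitive of a e^{σE}. -/
lemma fderiv_homTerm (hΞ : Convex ℝ D.Ξ) {x₀ : ℝ} (hx₀ : x₀ ∈ D.Ξ)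
    {a : ℂ × (Fin n → ℂ) × ℂ → ℂ} (ha : DifferentiableOn ℂ a (baseDomain D w)) (κ : Idx n m)
    (hd : DifferentiableOn ℂ (homTerm a (charRate A B κ) κ x₀) (domain m D w)) {z : Phase n m}
    (hz : z ∈ domain m D w) :
    fderiv ℂ (homTerm a (charRate A B κ) κ x₀) z (charVec A B z) = a z.yIx * mono κ z := by
  set E := charRate A B κ z.yIJ with hE
  set s := z.x - x₀ with hs
  let G : ℂ → ℂ := fun σ => a (z.y, z.I, (x₀ : ℂ) + σ) * Complex.exp (σ * E)
  let V : Set ℂ := {σ | (x₀ : ℂ) + σ ∈ nhd₁ D.Ξ w.ξ}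
  have hsV : s ∈ V := by
    change (x₀ : ℂ) + (z.x - x₀) ∈ nhd₁ D.Ξ w.ξ
    rw [add_sub_cancel]
    exact hz.1.2.2
  have hV : IsOpen V := (isOpen_nhd₁ D.Ξ w.ξ).preimage (by fun_prop)
  have hstar : StarConvex ℝ 0 V := by
    intro σ hσ p q hp hq hpq
    rw [smul_zero, zero_add]
    exact segment_mem_nhd₁ hΞ hx₀ hσ ⟨hq, by linarith⟩
  have hG : DifferentiableOn ℂ G V := by
    refine DifferentiableOn.mul (ha.comp (f := fun σ : ℂ => (z.y, z.I, (x₀ : ℂ) + σ)) (by fun_prop)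
      fun σ hσ => ⟨hz.1.1, hz.1.2.1, hσ⟩) (by fun_prop)
  have h1 := hasDerivAt_smul_integral hV hstar hG hsV
  have h2 : HasDerivAt (fun u : ℂ => s + u) 1 0 := by
    simpa using (hasDerivAt_id (0 : ℂ)).const_add s
  have h3 : HasDerivAt (fun u : ℂ => (s + u) • ∫ t in Icc (0 : ℝ) 1, G (t • (s + u))) (G s) 0 := by
    have := HasDerivAt.comp (0 : ℂ) (h₂ := fun s : ℂ => s • ∫ t in Icc (0 : ℝ) 1, G (t • s))
      (h₂' := G s) (by rw [add_zero]; exact h1) h2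
    rw [mul_one] at this
    exact this
  have h4 := h3.const_mul (mono κ z * Complex.exp (-(s * E)))
  have h5 : (fun u => homTerm a (charRate A B κ) κ x₀ (charCurve A B z u)) = fun u : ℂ =>
      mono κ z * Complex.exp (-(s * E)) *
        ((s + u) • ∫ t in Icc (0 : ℝ) 1, G (t • (s + u))) := by
    ext u
    have e1 : (charCurve A B z u).x - x₀ = s + u := by
      simp only [charCurve, Phase.x, hs]; ring
    have e2 : (charCurve A B z u).y = z.y := rfl
    have e3 : (charCurve A B z u).I = z.I := rfl
    rw [homTerm, mono_charCurve, yIJ_charCurve, e1, e2, e3, ← hE]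
    rw [mul_assoc, mul_assoc]
    congr 1
    rw [mul_smul_comm, mul_smul_comm]
    congr 1
    rw [← integral_const_mul, ← integral_const_mul]
    refine integral_congr_ae (Filter.Eventually.of_forall fun t => ?_)
    simp only [G]
    have : Complex.exp (u * E) * Complex.exp (((t : ℂ) - 1) * (s + u) * E) =
        Complex.exp (-(s * E)) * Complex.exp (t • (s + u) * E) := by
      rw [← Complex.exp_add, ← Complex.exp_add, Complex.real_smul]
      ring_nf
    linear_combination a (z.y, z.I, (x₀ : ℂ) + t • (s + u)) * this
  have h6 : HasFDerivAt (homTerm a (charRate A B κ) κ x₀)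
      (fderiv ℂ (homTerm a (charRate A B κ) κ x₀) z) (charCurve A B z 0) := by
    rw [charCurve_zero]
    exact ((hd z hz).differentiableAt ((isOpen_domain D w).mem_nhds hz)).hasFDerivAt
  have h7 := h6.comp_hasDerivAt (0 : ℂ) (hasDerivAt_charCurve (A := A) (B := B) z)
  have h8 := h7.unique (h5 ▸ h4 : HasDerivAt (homTerm a (charRate A B κ) κ x₀ ∘ charCurve A B z) _ 0)
  rw [h8]
  simp only [G]
  have e : (x₀ : ℂ) + s = z.x := by simp [hs]
  rw [e]
  have e' : Complex.exp (-(s * E)) * Complex.exp (s * E) = 1 := by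
    rw [← Complex.exp_add]; simp
  change _ = a (z.y, z.I, z.x) * _
  linear_combination mono κ z * a (z.y, z.I, z.x) * e'

lemma HasMajorant.charRate {α β : ℝ} (hδ : 0 ≤ w.δ)
    (hA : ∀ l, HasMajorant Set.univ D w (fun z : Phase n m => A l z.yIJ) α)
    (hB : ∀ l, HasMajorant Set.univ D w (fun z : Phase n m => B l z.yIJ) β) (κ : Idx n m) :
    HasMajorant Set.univ D w (fun z : Phase n m => charRate A B κ z.yIJ)
      ((∑ l, |(κ.1 l : ℝ)|) * α + ((∑ l, κ.2.1 l + ∑ l, κ.2.2 l : ℕ) : ℝ) * β) := by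
  have h1 := (HasMajorant.sum hδ fun l => (hA l).const_mul (κ.1 l : ℂ)).const_mul Complex.I
  have h2 := HasMajorant.sum hδ fun l => (hB l).const_mul ((κ.2.2 l : ℂ) - (κ.2.1 l : ℂ))
  refine ((h1.add hδ h2).le ?_).congr fun z _ => rfl
  simp only [Complex.norm_I, one_mul, Complex.norm_intCast, ← Finset.sum_mul]
  -- If m = 0 there is no frequency from which the sign of β could be read, but then its coefficient
  -- is 0.
  rcases Nat.eq_zero_or_pos m with rfl | hm
  · simp
  have hβ := (hB ⟨0, hm⟩).nonneg hδ
  gcongr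
  push_cast
  rw [← Finset.sum_add_distrib]
  refine Finset.sum_le_sum fun l _ => ?_
  refine (norm_sub_le _ _).trans ?_
  simp [add_comm]

/-- The rate E depends on p and q through J, so the exponential in the integrand cannot be part of a
coefficient. It is expanded in powers of E: the l-th term is a coefficient of size at most X^(l+1) c
times the monomial times E^l / l!, and the bounds sum to an exponential. -/
lemma hasMajorant_homTerm (hΞ : Convex ℝ D.Ξ) {x₀ : ℝ} (hx₀ : x₀ ∈ D.Ξ) {X : ℝ}
    (hX : ∀ x ∈ nhd₁ D.Ξ w.ξ, ‖x - x₀‖ ≤ X) (hX0 : 0 ≤ X) (hs : 0 ≤ w.s) (hδ : 0 ≤ w.δ)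
    {a : ℂ × (Fin n → ℂ) × ℂ → ℂ} (ha : DifferentiableOn ℂ a (baseDomain D w)) {c : ℝ}
    (hc : ∀ b ∈ baseDomain D w, ‖a b‖ ≤ c) (hc0 : 0 ≤ c)
    {E : ℂ × (Fin n → ℂ) × (Fin m → ℂ) → ℂ} {e : ℝ}
    (hE : HasMajorant Set.univ D w (fun z : Phase n m => E z.yIJ) e) (κ : Idx n m) :
    HasMajorant Set.univ D w (homTerm a E κ x₀) (X * c * weight w κ * Real.exp (X * e)) := by
  have he := hE.nonneg hδ
  let a' : ℕ → ℂ × (Fin n → ℂ) × ℂ → ℂ := fun l b => (b.2.2 - x₀) ^ (l + 1) *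
    ∫ t in Icc (0 : ℝ) 1, a (b.1, b.2.1, (x₀ : ℂ) + t • (b.2.2 - x₀)) * ((t : ℂ) - 1) ^ l
  have hcont : ∀ b ∈ baseDomain D w, ContinuousOn
      (fun t : ℝ => a (b.1, b.2.1, (x₀ : ℂ) + t • (b.2.2 - x₀))) (Icc 0 1) := fun b hb =>
    ha.continuousOn.comp (Continuous.continuousOn (by fun_prop)) fun t ht =>
      segment_mem_baseDomain hΞ hx₀ hb ht
  have hbd : ∀ b ∈ baseDomain D w, ∀ l : ℕ, ∀ t ∈ Icc (0 : ℝ) 1,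
      ‖a (b.1, b.2.1, (x₀ : ℂ) + t • (b.2.2 - x₀)) * ((t : ℂ) - 1) ^ l‖ ≤ c := by
    intro b hb l t ht
    have h1 : ‖((t : ℂ) - 1)‖ ≤ 1 := by
      have : (t : ℂ) - 1 = ((t - 1 : ℝ) : ℂ) := by push_cast; ring
      rw [this, Complex.norm_real, Real.norm_eq_abs, abs_le]
      constructor <;> linarith [ht.1, ht.2]
    rw [norm_mul, norm_pow]
    calc _ ≤ c * 1 ^ l := by
          gcongr
          exact hc _ (segment_mem_baseDomain hΞ hx₀ hb ht)
      _ = c := by simp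
  have ha'd : ∀ l, DifferentiableOn ℂ (a' l) (baseDomain D w) := by
    intro l
    refine DifferentiableOn.mul (by fun_prop) ?_
    refine differentiableOn_setIntegral (μ := volume)
      (f := fun (t : ℝ) (b : ℂ × (Fin n → ℂ) × ℂ) =>
        a (b.1, b.2.1, (x₀ : ℂ) + t • (b.2.2 - x₀)) * ((t : ℂ) - 1) ^ l) isCompact_Icc
      (isOpen_baseDomain D w) ?_ fun t ht => ?_
    · refine ContinuousOn.mul (ha.continuousOn.comp (Continuous.continuousOn (by fun_prop))
        fun p hp => segment_mem_baseDomain hΞ hx₀ hp.2 hp.1) (by fun_prop)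
    · refine DifferentiableOn.mul_const (ha.comp ?_ fun b hb =>
        segment_mem_baseDomain hΞ hx₀ hb ht) _
      simp only [Complex.real_smul]
      fun_prop
  have ha'b : ∀ l, ∀ b ∈ baseDomain D w, ‖a' l b‖ ≤ X ^ (l + 1) * c := by
    intro l b hb
    have h1 : ‖∫ t in Icc (0 : ℝ) 1, a (b.1, b.2.1, (x₀ : ℂ) + t • (b.2.2 - x₀)) *
        ((t : ℂ) - 1) ^ l‖ ≤ c := by
      have := norm_setIntegral_le_of_norm_le_const (μ := volume) (s := Icc (0 : ℝ) 1) (by simp)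
        (hbd b hb l)
      simpa using this
    simp only [a', norm_mul, norm_pow]
    gcongr
    exact hX _ hb.2.2
  have hterm : ∀ l : ℕ, HasMajorant Set.univ D w
      (fun z : Phase n m => ((l.factorial : ℂ))⁻¹ *
        ((a' l z.yIx * mono κ z) * E z.yIJ ^ l))
      (‖((l.factorial : ℂ))⁻¹‖ * (X ^ (l + 1) * c * weight w κ * e ^ l)) := fun l =>
    ((HasMajorant.atom (mem_univ κ) (ha'd l) (ha'b l) (by positivity)).mul hs hδ
      (hE.pow hs hδ l)).const_mul _
  have hM : HasSum (fun l : ℕ => ‖((l.factorial : ℂ))⁻¹‖ * (X ^ (l + 1) * c * weight w κ * e ^ l))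
      (X * c * weight w κ * Real.exp (X * e)) := by
    have h1 := (NormedSpace.expSeries_div_hasSum_exp (X * e)).mul_left (X * c * weight w κ)
    rw [← Real.exp_eq_exp_ℝ] at h1
    refine h1.congr_fun fun l => ?_
    rw [norm_inv, Complex.norm_natCast, mul_pow, pow_succ]
    field_simp
  have := HasMajorant.tsum (G := homTerm a E κ x₀) hδ hterm hM.summable fun z hz => ?_
  · rwa [hM.tsum_eq] at this
  set s := z.x - (x₀ : ℂ) with hs'
  have hb : z.yIx ∈ baseDomain D w := hz.1
  let f : ℕ → ℝ → ℂ := fun l t => a (z.y, z.I, (x₀ : ℂ) + t • s) * ((t : ℂ) - 1) ^ l *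
    (((l.factorial : ℂ))⁻¹ * (s * E z.yIJ) ^ l)
  have hfint : ∀ l, IntegrableOn (f l) (Icc 0 1) := fun l =>
    (((hcont _ hb).mul (by fun_prop)).mul_const _).integrableOn_compact isCompact_Icc
  have hvol : ∀ l, ∫ t in Icc (0 : ℝ) 1, ‖f l t‖ ≤ c * ‖(((l.factorial : ℂ))⁻¹ *
      (s * E z.yIJ) ^ l)‖ := by
    intro l
    have h1 : ∫ t in Icc (0 : ℝ) 1, ‖f l t‖ ≤ ∫ t in Icc (0 : ℝ) 1, c * ‖(((l.factorial : ℂ))⁻¹ *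
      (s * E z.yIJ) ^ l)‖ := by
      refine setIntegral_mono_on (hfint l).norm (integrable_const _) measurableSet_Icc
        fun t ht => ?_
      simp only [f]
      rw [norm_mul]
      gcongr
      exact hbd _ hb l t ht
    simpa using h1
  have hexp : ∀ x : ℂ, HasSum (fun l : ℕ => ((l.factorial : ℂ))⁻¹ * x ^ l) (Complex.exp x) := by
    intro x
    have h1 := NormedSpace.expSeries_div_hasSum_exp x
    rw [← Complex.exp_eq_exp_ℂ] at h1
    exact h1.congr_fun fun l => by rw [div_eq_inv_mul]
  -- Exchange of the exponential series with the integral over the segment.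
  have hsum := hasSum_integral_of_summable_integral_norm (μ := volume.restrict (Icc (0 : ℝ) 1))
    (F := f) hfint (Summable.of_nonneg_of_le (fun l => integral_nonneg fun t => norm_nonneg _) hvol
      ((hexp (s * E z.yIJ)).summable.norm.mul_left c))
  have e1 : ∀ t : ℝ, ∑' l, f l t = a (z.y, z.I, (x₀ : ℂ) + t • s) *
      Complex.exp (((t : ℂ) - 1) * s * E z.yIJ) := by
    intro t
    rw [← (hexp (((t : ℂ) - 1) * s * E z.yIJ)).tsum_eq, ← tsum_mul_left]
    refine tsum_congr fun l => ?_
    simp only [f, mul_pow]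
    ring
  simp only [e1] at hsum
  have h2 := (hsum.mul_left s).mul_left (mono κ z)
  refine h2.congr_fun fun l => ?_
  simp only [f, a']
  rw [integral_mul_const]
  change _ = mono κ z * (s * ((∫ t in Icc (0 : ℝ) 1, a (z.y, z.I, (x₀ : ℂ) + t • s) *
    ((t : ℂ) - 1) ^ l) * _))
  change ((l.factorial : ℂ))⁻¹ * ((s ^ (l + 1) * (∫ t in Icc (0 : ℝ) 1, a (z.y, z.I,
    (x₀ : ℂ) + t • s) * ((t : ℂ) - 1) ^ l)) * mono κ z * E z.yIJ ^ l) = _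
  rw [mul_pow, pow_succ]
  ring

/-- The homological equation: no small divisors occur, as it is solved by integration along the
characteristics. -/
lemma exists_homological (hΞ : Convex ℝ D.Ξ) {x₀ : ℝ} (hx₀ : x₀ ∈ D.Ξ) {X : ℝ}
    (hX : ∀ x ∈ nhd₁ D.Ξ w.ξ, ‖x - x₀‖ ≤ X) (hX0 : 0 ≤ X) (hw : w'.Le w) (hs : 0 ≤ w'.s)
    (hδ : 0 ≤ w'.δ) {α β : ℝ}
    (hA : ∀ l, HasMajorant Set.univ D w (fun z : Phase n m => A l z.yIJ) α)
    (hB : ∀ l, HasMajorant Set.univ D w (fun z : Phase n m => B l z.yIJ) β)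
    (hα : w'.s + X * α ≤ w.s) (hβ : w'.δ * Real.exp (X * β) ≤ w.δ)
    (hF : HasMajorant S D w F M) :
    ∃ χ : Phase n m → ℂ, HasMajorant Set.univ D w' χ (X * M) ∧
      ∀ z ∈ domain m D w', fderiv ℂ χ z (charVec A B z) = F z := by
  obtain ⟨ι, hι, κ, a, c, h⟩ := hF
  have hsub := baseDomain_mono D hw
  have hX' : ∀ x ∈ nhd₁ D.Ξ w'.ξ, ‖x - x₀‖ ≤ X := fun x hx => hX x (nhd₁_mono _ hw.2.2.1 hx)
  let e : ι → ℝ := fun i => (∑ l, |((κ i).1 l : ℝ)|) * α +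
    ((∑ l, (κ i).2.1 l + ∑ l, (κ i).2.2 l : ℕ) : ℝ) * β
  have hterm : ∀ i, HasMajorant Set.univ D w' (homTerm (a i) (charRate A B (κ i)) (κ i) x₀)
      (X * c i * weight w' (κ i) * Real.exp (X * e i)) := fun i =>
    hasMajorant_homTerm hΞ hx₀ hX' hX0 hs hδ ((h.diff i).mono hsub)
      (fun b hb => h.bound i b (hsub hb)) (h.nonneg i)
      (HasMajorant.charRate hδ (fun l => (hA l).restrict hw hδ)
        (fun l => (hB l).restrict hw hδ) (κ i)) (κ i)
  -- This is where small divisors are avoided: the growth along the characteristics is exponential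
  -- with a rate linear in |k| and |h| + |j|, hence amounts to a shift of s and a factor on δ.
  have hwt : ∀ i, weight w' (κ i) * Real.exp (X * e i) ≤ weight w (κ i) := by
    intro i
    set k := ∑ l, |((κ i).1 l : ℝ)|
    set N := ∑ l, (κ i).2.1 l + ∑ l, (κ i).2.2 l
    have hk : 0 ≤ k := Finset.sum_nonneg fun _ _ => abs_nonneg _
    calc weight w' (κ i) * Real.exp (X * e i) =
        Real.exp ((w'.s + X * α) * k) * (w'.δ * Real.exp (X * β)) ^ N := by
          simp only [weight, e, mul_pow, ← Real.exp_nat_mul]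
          rw [show X * (k * α + (N : ℝ) * β) = (X * α) * k + (N : ℝ) * (X * β) by ring,
            Real.exp_add, add_mul, Real.exp_add]
          ring
      _ ≤ Real.exp (w.s * k) * w.δ ^ N := by gcongr
  have hle : ∀ i, X * c i * weight w' (κ i) * Real.exp (X * e i) ≤
      X * (c i * weight w (κ i)) := by
    intro i
    have := h.nonneg i
    calc _ = X * c i * (weight w' (κ i) * Real.exp (X * e i)) := by ring
      _ ≤ X * c i * weight w (κ i) := by gcongr; exact hwt i
      _ = _ := by ring
  have hs2 : Summable fun i => X * (c i * weight w (κ i)) := h.summable.mul_left X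
  have hs1 : Summable fun i => X * c i * weight w' (κ i) * Real.exp (X * e i) :=
    Summable.of_nonneg_of_le (fun i => (hterm i).nonneg hδ) hle hs2
  refine ⟨fun z => ∑' i, homTerm (a i) (charRate A B (κ i)) (κ i) x₀ z, ?_, fun z hz => ?_⟩
  · refine (HasMajorant.tsum hδ hterm hs1 fun z hz => ?_).le ?_
    · exact (Summable.of_norm_bounded hs1 fun i => (hterm i).norm_le hz).hasSum
    · refine (hs1.tsum_le_tsum hle hs2).trans ?_
      rw [tsum_mul_left]
      exact mul_le_mul_of_nonneg_left h.tsum_le hX0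
  · obtain ⟨h1, h2⟩ := hasFDerivAt_tsum_of_bounded (isOpen_domain D w') hs1
      (fun i => (hterm i).differentiableOn) (fun i z hz => (hterm i).norm_le hz) hz
    rw [h1.fderiv]
    have h3 := h2.hasSum.mapL (ContinuousLinearMap.apply ℂ ℂ (charVec A B z))
    refine h3.unique ?_
    refine (h.hasSum z (domain_mono D hw hz)).congr_fun fun i => ?_
    exact fderiv_homTerm hΞ hx₀ ((h.diff i).mono hsub) (κ i) (hterm i).differentiableOn hz

end Homological

end NormalForm

namespace NormalForm

/-! ### Time-one flows after a linear change of variables. -/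

section TimeOne

open Metric Set MeasureTheory Filter Topology

variable {E : Type*} [NormedAddCommGroup E] [NormedSpace ℂ E] [FiniteDimensional ℂ E]

lemma lieDeriv_conj (A : E ≃L[ℂ] E) (X : E → E) (G : E → ℂ) :
    lieDeriv (fun x => A (X (A.symm x))) (G ∘ A.symm) = lieDeriv X G ∘ A.symm := by
  ext x
  simp only [lieDeriv, Function.comp_apply]
  rw [ContinuousLinearEquiv.comp_right_fderiv]
  simp

lemma lieDeriv_conj_iterate (A : E ≃L[ℂ] E) (X : E → E) (G : E → ℂ) (k : ℕ) :
    (lieDeriv (fun x => A (X (A.symm x))))^[k] (G ∘ A.symm) = (lieDeriv X)^[k] G ∘ A.symm := by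
  induction k with
  | zero => rfl
  | succ k ih => rw [Function.iterate_succ_apply', Function.iterate_succ_apply', ih, lieDeriv_conj]

/-- The time-one flow of a vector field that is small after a linear change of variables. -/
theorem exists_timeOne (A : E ≃L[ℂ] E) {X : E → E} {U V V' : Set E} {η : ℝ}
    (h : SmallField (fun x => A (X (A.symm x))) (A.symm ⁻¹' U) (A.symm ⁻¹' V) η)
    (hV' : ∀ x ∈ A.symm ⁻¹' V', ball x (3 * η) ⊆ A.symm ⁻¹' V)
    (hX : DifferentiableOn ℂ X U) :
    ∃ Φ : E → E, DifferentiableOn ℂ Φ V ∧ MapsTo Φ V U ∧ InjOn Φ V' ∧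
      (∀ B : E →L[ℂ] E →L[ℂ] ℂ,
        (∀ x ∈ U, ∀ u v, B (fderiv ℂ X x u) v + B u (fderiv ℂ X x v) = 0) →
        ∀ z ∈ V, ∀ u v, B (fderiv ℂ Φ z u) (fderiv ℂ Φ z v) = B u v) ∧
      (∀ c, (∀ x ∈ U, x + c ∈ U ∧ X (x + c) = X x) → ∀ z ∈ V, z + c ∈ V → Φ (z + c) = Φ z + c) ∧
      (∀ G : E → ℂ, DifferentiableOn ℂ G U → ∀ z ∈ V,
        HasSum (fun k : ℕ => ((k.factorial : ℂ))⁻¹ * (lieDeriv X)^[k] G z) (G (Φ z))) ∧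
      (∀ (F : Type) [NormedAddCommGroup F] [NormedSpace ℂ F] [CompleteSpace F] (L : E →L[ℂ] F)
        (C : ℝ), (∀ x ∈ U, ‖L (X x)‖ ≤ C) → ∀ z ∈ V, ‖L (Φ z - z)‖ ≤ C) := by
  have : CompleteSpace E := FiniteDimensional.complete ℂ E
  set Y : E → E := fun x => A (X (A.symm x)) with hY
  have hUo : IsOpen U := by
    have := h.openU.preimage A.continuous
    simpa [← preimage_comp] using this
  have hmemV : ∀ z ∈ V, A z ∈ A.symm ⁻¹' V := fun z hz => by simpa using hz
  have hflow := fun z (hz : z ∈ V) => h.differentiableOn_picardFlow_apply SmallField.one_mem _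
    (hmemV z hz) |>.differentiableAt (h.openV.mem_nhds (hmemV z hz))
  have hfd : ∀ z ∈ V, ∀ u, fderiv ℂ (fun z => A.symm (picardFlow Y 1 (A z))) z u =
      A.symm (fderiv ℂ (picardFlow Y 1) (A z) (A u)) := by
    intro z hz u
    have h1 : HasFDerivAt (fun z => A.symm (picardFlow Y 1 (A z))) _ z :=
      A.symm.hasFDerivAt.comp z ((hflow z hz).hasFDerivAt.comp z A.hasFDerivAt)
    rw [h1.fderiv]
    rfl
  refine ⟨fun z => A.symm (picardFlow Y 1 (A z)), fun z hz => ?_, fun z hz => ?_,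
    fun z₁ hz₁ z₂ hz₂ heq => ?_, fun B hB z hz u v => ?_, fun c hc z hz hzc => ?_,
    fun G hG z hz => ?_, fun F _ _ _ L C hC z hz => ?_⟩
  · exact (A.symm.differentiableAt.comp z
      ((hflow z hz).comp z A.differentiableAt)).differentiableWithinAt
  · exact h.picardFlow_mem SmallField.one_mem (hmemV z hz)
  · have := h.injOn_picardFlow hV' (show A z₁ ∈ _ by simpa using hz₁)
      (show A z₂ ∈ _ by simpa using hz₂) (A.symm.injective heq)
    exact A.injective this
  · rw [hfd z hz, hfd z hz]
    have := h.form_fderiv_picardFlow (B.bilinearComp (A.symm : E →L[ℂ] E) (A.symm : E →L[ℂ] E))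
      (fun x hx u v => ?_) (hmemV z hz) (A u) (A v)
    · simpa using this
    · have hd : HasFDerivAt Y ((A : E →L[ℂ] E).comp ((fderiv ℂ X (A.symm x)).comp
          (A.symm : E →L[ℂ] E))) x :=
        A.hasFDerivAt.comp x ((((hX _ hx).differentiableAt
          (hUo.mem_nhds hx)).hasFDerivAt).comp x A.symm.hasFDerivAt)
      rw [hd.fderiv]
      simpa using hB _ hx (A.symm u) (A.symm v)
  · have := h.picardFlow_add (c := A c) (fun x hx => ?_) (hmemV z hz)
      (by simpa using hzc) SmallField.one_mem
    · simp only [map_add]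
      rw [this]
      simp
    · obtain ⟨h1, h2⟩ := hc _ hx
      refine ⟨by simpa using h1, ?_⟩
      change A (X (A.symm (x + A c))) = A (X (A.symm x))
      rw [map_add, ContinuousLinearEquiv.symm_apply_apply, h2]
  · have := h.hasSum_lieDeriv (G := G ∘ A.symm)
      (hG.comp A.symm.differentiable.differentiableOn fun x hx => hx) (hmemV z hz)
    rw [hY] at this
    simpa only [lieDeriv_conj_iterate, Function.comp_apply,
      ContinuousLinearEquiv.symm_apply_apply] using this
  · have he := h.picardFlow_eq SmallField.one_mem (hmemV z hz)
    have hcont : ContinuousOn (fun u : ℝ => Y (picardFlow Y (u • (1 : ℂ)) (A z))) (Icc 0 1) := by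
      refine h.diff.continuousOn.comp (h.differentiableOn_picardFlow.continuousOn.comp
        (f := fun u : ℝ => (u • (1 : ℂ), A z)) (by fun_prop) fun u hu => ?_) fun u hu => ?_
      · exact SmallField.smul_time_mem hu (p := (1, A z)) ⟨SmallField.one_mem, hmemV z hz⟩
      · exact h.picardFlow_mem (SmallField.smul_time_mem hu (p := (1, A z))
          ⟨SmallField.one_mem, hmemV z hz⟩).1 (hmemV z hz)
    -- The displacement is the mean of the field along the orbit, so each linear image of it
    -- inherits the bound of the field, with no constant depending on the norm of E or on A.
    have e : L (A.symm (picardFlow Y 1 (A z)) - z) = ∫ u in Icc (0 : ℝ) 1,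
        (L.comp (A.symm : E →L[ℂ] E)) (Y (picardFlow Y (u • (1 : ℂ)) (A z))) := by
      rw [ContinuousLinearMap.integral_comp_comm _ (hcont.integrableOn_compact isCompact_Icc), he]
      simp
    rw [e]
    have := norm_setIntegral_le_of_norm_le_const (μ := volume) (s := Icc (0 : ℝ) 1) (C := C)
      (f := fun u : ℝ => (L.comp (A.symm : E →L[ℂ] E)) (Y (picardFlow Y (u • (1 : ℂ)) (A z))))
      (by simp) fun u hu => by
        have hU := h.picardFlow_mem (SmallField.smul_time_mem hu (p := (1, A z))
          ⟨SmallField.one_mem, hmemV z hz⟩).1 (hmemV z hz)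
        simpa [hY] using hC _ hU
    simpa using this

end TimeOne

variable {n m : ℕ}

/-! ### Hamiltonian vector fields and the symplectic form. -/

section Hamiltonian

open Set

/-- Coordinates on `ℂ × ℂⁿ × ℂᵐ`. -/
def halfCoord : Half n m → (ℂ × (Fin n → ℂ) × (Fin m → ℂ)) →L[ℂ] ℂ
  | .inl _ => ContinuousLinearMap.fst ℂ _ _
  | .inr (.inl i) => (ContinuousLinearMap.proj i).comp
      ((ContinuousLinearMap.fst ℂ _ _).comp (ContinuousLinearMap.snd ℂ _ _))
  | .inr (.inr i) => (ContinuousLinearMap.proj i).comp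
      ((ContinuousLinearMap.snd ℂ _ _).comp (ContinuousLinearMap.snd ℂ _ _))

lemma sum_halfCoord_smul (u : ℂ × (Fin n → ℂ) × (Fin m → ℂ)) :
    ∑ c, halfCoord c u • halfVec c = u := by
  refine Prod.ext ?_ (Prod.ext ?_ ?_)
  · simp [Fintype.sum_sum_type, halfCoord, halfVec, Prod.fst_sum]
  · ext i
    simp [Fintype.sum_sum_type, halfCoord, halfVec, Prod.fst_sum, Prod.snd_sum, Finset.sum_apply,
      Pi.single_apply]
  · ext i
    simp [Fintype.sum_sum_type, halfCoord, halfVec, Prod.snd_sum, Finset.sum_apply,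
      Pi.single_apply]

lemma clm_apply_eq_sum {F : Type*} [NormedAddCommGroup F] [NormedSpace ℂ F]
    (L : Phase n m →L[ℂ] F) (v : Phase n m) :
    L v = ∑ c, (halfCoord c v.1 • L (basisVec (.inl c)) + halfCoord c v.2 • L (basisVec (.inr c))) := by
  have e1 : (v.1, (0 : ℂ × (Fin n → ℂ) × (Fin m → ℂ))) =
      ∑ c, halfCoord c v.1 • (basisVec (.inl c) : Phase n m) := by
    refine Prod.ext ?_ ?_
    · simp only [basisVec, Prod.fst_sum, Prod.smul_fst]
      exact (sum_halfCoord_smul v.1).symm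
    · simp [basisVec, Prod.snd_sum]
  have e2 : ((0 : ℂ × (Fin n → ℂ) × (Fin m → ℂ)), v.2) =
      ∑ c, halfCoord c v.2 • (basisVec (.inr c) : Phase n m) := by
    refine Prod.ext ?_ ?_
    · simp [basisVec, Prod.fst_sum]
    · simp only [basisVec, Prod.snd_sum, Prod.smul_snd]
      exact (sum_halfCoord_smul v.2).symm
  have : v = (v.1, 0) + (0, v.2) := by simp
  conv_lhs => rw [this, map_add, e1, e2, map_sum, map_sum]
  simp only [map_smul, Finset.sum_add_distrib]

/-- The projection to the variables `(y, I, p)`. -/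
def firstHalf : Phase n m →L[ℂ] ℂ × (Fin n → ℂ) × (Fin m → ℂ) := ContinuousLinearMap.fst ℂ _ _

/-- The projection to the variables `(x, φ, q)`. -/
def secondHalf : Phase n m →L[ℂ] ℂ × (Fin n → ℂ) × (Fin m → ℂ) := ContinuousLinearMap.snd ℂ _ _

lemma firstHalf_apply (u : Phase n m) : firstHalf u = u.1 := rfl

lemma secondHalf_apply (u : Phase n m) : secondHalf u = u.2 := rfl

/-- The two-form as a continuous bilinear map. -/
def twoFormL : Phase n m →L[ℂ] Phase n m →L[ℂ] ℂ :=
  ∑ c : Half n m,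
    (((halfCoord c).comp firstHalf).smulRight
        ((halfCoord c).comp secondHalf) -
      ((halfCoord c).comp secondHalf).smulRight
        ((halfCoord c).comp firstHalf))

lemma twoFormL_apply (u v : Phase n m) : twoFormL u v =
    ∑ c, (halfCoord c u.1 * halfCoord c v.2 - halfCoord c v.1 * halfCoord c u.2) := by
  simp only [twoFormL, sum_apply, sub_apply,
    ContinuousLinearMap.smulRight_apply, ContinuousLinearMap.comp_apply,
    smul_apply, firstHalf_apply, secondHalf_apply,
    smul_eq_mul]
  exact Finset.sum_congr rfl fun c _ => by ring

lemma twoForm_eq (u v : Phase n m) : twoForm u v = twoFormL u v := by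
  rw [twoFormL_apply]
  simp [twoForm, Fintype.sum_sum_type, halfCoord, Phase.y, Phase.I, Phase.p, Phase.x, Phase.φ,
    Phase.q]
  ring

lemma twoFormL_swap (u v : Phase n m) : twoFormL u v = -twoFormL v u := by
  rw [twoFormL_apply, twoFormL_apply, ← Finset.sum_neg_distrib]
  exact Finset.sum_congr rfl fun c _ => by ring

/-- The Hamiltonian vector field of `χ`. -/
def hamField (χ : Phase n m → ℂ) (z : Phase n m) : Phase n m :=
  ((-fderiv ℂ χ z (basisVec (.inr (.inl ()))), fun i => -fderiv ℂ χ z (basisVec (.inr (.inr (.inl i)))),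
      fun i => -fderiv ℂ χ z (basisVec (.inr (.inr (.inr i))))),
    (fderiv ℂ χ z (basisVec (.inl (.inl ()))), fun i => fderiv ℂ χ z (basisVec (.inl (.inr (.inl i)))),
      fun i => fderiv ℂ χ z (basisVec (.inl (.inr (.inr i))))))

lemma halfCoord_hamField_fst (χ : Phase n m → ℂ) (z : Phase n m) (c : Half n m) :
    halfCoord c (hamField χ z).1 = -fderiv ℂ χ z (basisVec (.inr c)) := by
  rcases c with (_ | _ | _) <;> rfl

lemma halfCoord_hamField_snd (χ : Phase n m → ℂ) (z : Phase n m) (c : Half n m) :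
    halfCoord c (hamField χ z).2 = fderiv ℂ χ z (basisVec (.inl c)) := by
  rcases c with (_ | _ | _) <;> rfl

lemma twoFormL_hamField (χ : Phase n m → ℂ) (z v : Phase n m) :
    twoFormL (hamField χ z) v = -fderiv ℂ χ z v := by
  rw [twoFormL_apply, clm_apply_eq_sum (fderiv ℂ χ z) v, ← Finset.sum_neg_distrib]
  refine Finset.sum_congr rfl fun c _ => ?_
  rw [halfCoord_hamField_fst, halfCoord_hamField_snd, smul_eq_mul, smul_eq_mul]
  ring

lemma lieDeriv_hamField (χ G : Phase n m → ℂ) (z : Phase n m) :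
    lieDeriv (hamField χ) G z =
      ∑ c, (fderiv ℂ χ z (basisVec (.inl c)) * fderiv ℂ G z (basisVec (.inr c)) -
        fderiv ℂ χ z (basisVec (.inr c)) * fderiv ℂ G z (basisVec (.inl c))) := by
  rw [lieDeriv, clm_apply_eq_sum]
  refine Finset.sum_congr rfl fun c _ => ?_
  rw [halfCoord_hamField_fst, halfCoord_hamField_snd, smul_eq_mul, smul_eq_mul]
  ring

variable {U : Set (Phase n m)} {χ : Phase n m → ℂ}

lemma differentiableOn_hamField (hU : IsOpen U) (hχ : DifferentiableOn ℂ χ U) :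
    DifferentiableOn ℂ (hamField χ) U := by
  have h := fun v => DifferentiableOn.fderiv_apply hU hχ v
  unfold hamField
  refine DifferentiableOn.prodMk (DifferentiableOn.prodMk (h _).neg (DifferentiableOn.prodMk ?_ ?_))
    (DifferentiableOn.prodMk (h _) (DifferentiableOn.prodMk ?_ ?_))
  · exact differentiableOn_pi.mpr fun i => (h _).neg
  · exact differentiableOn_pi.mpr fun i => (h _).neg
  · exact differentiableOn_pi.mpr fun i => h _
  · exact differentiableOn_pi.mpr fun i => h _

/-- Differentiating `twoFormL_hamField` expresses the first term by the Hessian of χ. The form is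
antisymmetric and the Hessian symmetric, so the two terms cancel. -/
lemma twoFormL_fderiv_hamField (hU : IsOpen U) (hχ : DifferentiableOn ℂ χ U) {z : Phase n m}
    (hz : z ∈ U) (u v : Phase n m) :
    twoFormL (fderiv ℂ (hamField χ) z u) v + twoFormL u (fderiv ℂ (hamField χ) z v) = 0 := by
  have hat : ∀ x ∈ U, HasFDerivAt χ (fderiv ℂ χ x) x := fun x hx =>
    ((hχ x hx).differentiableAt (hU.mem_nhds hx)).hasFDerivAt
  have h2 : HasFDerivAt (fderiv ℂ χ) (fderiv ℂ (fderiv ℂ χ) z) z :=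
    ((DifferentiableOn.fderiv_of_isOpen hU hχ z hz).differentiableAt (hU.mem_nhds hz)).hasFDerivAt
  have hX : HasFDerivAt (hamField χ) (fderiv ℂ (hamField χ) z) z :=
    ((differentiableOn_hamField hU hχ z hz).differentiableAt (hU.mem_nhds hz)).hasFDerivAt
  have key : ∀ u v, twoFormL (fderiv ℂ (hamField χ) z u) v =
      -fderiv ℂ (fderiv ℂ χ) z u v := by
    intro u v
    have h3 : HasFDerivAt (fun x => twoFormL (hamField χ x) v) _ z :=
      (twoFormL.hasFDerivAt.comp z hX).clm_apply (hasFDerivAt_const v z)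
    have h4 : HasFDerivAt (fun x => -fderiv ℂ χ x v) _ z :=
      (h2.clm_apply (hasFDerivAt_const v z)).neg
    simp only [twoFormL_hamField] at h3
    have := congrArg (fun L => L u) (h3.unique h4)
    simpa using this
  have hsymm := second_derivative_symmetric_of_eventually
    (Filter.eventually_of_mem (hU.mem_nhds hz) hat) h2 u v
  rw [twoFormL_swap u, key, key, hsymm]
  ring

end Hamiltonian

end NormalForm

namespace NormalForm

variable {n m : ℕ}

/-! ### Poisson brackets and Lie series in terms of gradients. -/

section Gradient

open Set

variable {D : Base n} {w : Widths} {S : Set (Idx n m)}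

lemma Widths.scale_δ_nonneg (hw : w.Pos) {t : ℝ} (ht : 0 ≤ t) : 0 ≤ (w.scale t).δ :=
  mul_nonneg ht hw.2.2.2.2.le

lemma Widths.scale_s_nonneg (hw : w.Pos) {t : ℝ} (ht : 0 ≤ t) : 0 ≤ (w.scale t).s :=
  mul_nonneg ht hw.2.2.2.1.le

/-- The partial derivatives of `G` are bounded by `L` in units of the widths. -/
def HasGradient (D : Base n) (w : Widths) (t : ℝ) (G : Phase n m → ℂ) (L : ℝ) : Prop :=
  ∀ c, HasMajorant univ D (w.scale t) (fun z => fderiv ℂ G z (basisVec c)) (L / width w c)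

lemma HasMajorant.hasGradient (hw : w.Pos) {t t' M : ℝ} {G : Phase n m → ℂ}
    (hG : HasMajorant S D (w.scale t') G M) (ht : 0 ≤ t) (htt : t < t') :
    HasGradient D w t G (M / (t' - t)) := by
  intro c
  have hc := width_pos hw c
  have := hG.fderiv (Widths.scale_le_scale hw htt.le) (Widths.scale_δ_nonneg hw ht)
    (τ := (t' - t) * width w c) (mul_pos (sub_pos.2 htt) hc) c
    (by rw [width_scale, width_scale]; linarith)
  rwa [div_div]

namespace HasGradient

variable {t t' L L' : ℝ} {G G' : Phase n m → ℂ}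

lemma le (hw : w.Pos) (h : HasGradient D w t G L) (hL : L ≤ L') : HasGradient D w t G L' :=
  fun c => (h c).le (div_le_div_of_nonneg_right hL (width_pos hw c).le)

lemma restrict (hw : w.Pos) (h : HasGradient D w t G L) (ht : 0 ≤ t') (htt : t' ≤ t) :
    HasGradient D w t' G L :=
  fun c => (h c).restrict (Widths.scale_le_scale hw htt) (Widths.scale_δ_nonneg hw ht)

lemma nonneg (hw : w.Pos) (ht : 0 ≤ t) (h : HasGradient D w t G L) : 0 ≤ L := by
  have := (h (.inl (.inl ()))).nonneg (Widths.scale_δ_nonneg hw ht)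
  by_contra hL
  exact absurd this (not_le.2 (div_neg_of_neg_of_pos (not_le.1 hL) (width_pos hw _)))

lemma add (hw : w.Pos) (ht : 0 ≤ t) (h : HasGradient D w t G L) (h' : HasGradient D w t G' L')
    (hG : DifferentiableOn ℂ G (domain m D (w.scale t)))
    (hG' : DifferentiableOn ℂ G' (domain m D (w.scale t))) :
    HasGradient D w t (fun z => G z + G' z) (L + L') := by
  intro c
  rw [add_div]
  refine ((h c).add (Widths.scale_δ_nonneg hw ht) (h' c)).congr fun z hz => ?_
  have ho := (isOpen_domain (m := m) D (w.scale t)).mem_nhds hz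
  rw [fderiv_fun_add ((hG z hz).differentiableAt ho) ((hG' z hz).differentiableAt ho)]
  rfl

/-- The Poisson bracket has two products for each of the 1 + n + m conjugate pairs, and the widths
of a conjugate pair multiply to at least d. No width is lost, as both functions enter through their
gradients. -/
lemma lieDeriv (hw : w.Pos) (ht : 0 ≤ t) (h : HasGradient D w t G L) {χ : Phase n m → ℂ}
    (h' : HasGradient D w t χ L') :
    HasMajorant univ D (w.scale t) (lieDeriv (hamField χ) G)
      (2 * (1 + n + m) * (L * L' / w.d)) := by
  have hδ := Widths.scale_δ_nonneg hw ht
  have hs := Widths.scale_s_nonneg hw ht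
  have hL := h.nonneg hw ht
  have hL' := h'.nonneg hw ht
  have key : ∀ c : Half n m, HasMajorant univ D (w.scale t) (fun z =>
      fderiv ℂ χ z (basisVec (.inl c)) * fderiv ℂ G z (basisVec (.inr c)) -
        fderiv ℂ χ z (basisVec (.inr c)) * fderiv ℂ G z (basisVec (.inl c)))
      (L * L' / w.d + L * L' / w.d) := by
    intro c
    have hp1 := width_pos hw (.inl c : Half n m ⊕ Half n m)
    have hp2 := width_pos hw (.inr c : Half n m ⊕ Half n m)
    have hd := d_le_width_mul w c
    have hle : L * L' / (width w (.inl c) * width w (.inr c)) ≤ L * L' / w.d :=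
      div_le_div_of_nonneg_left (mul_nonneg hL hL') (d_pos hw) hd
    refine HasMajorant.sub hδ
      ((HasMajorant.mul hs hδ (h' (.inl c)) (h (.inr c))).le (le_trans (le_of_eq ?_) hle))
      ((HasMajorant.mul hs hδ (h' (.inr c)) (h (.inl c))).le (le_trans (le_of_eq ?_) hle))
    · field_simp
    · field_simp
  refine ((HasMajorant.sum hδ key).congr fun z _ => lieDeriv_hamField χ G z).le (le_of_eq ?_)
  simp [Fintype.card_sum]
  ring

end HasGradient

/-- Bound of the iterated Lie derivatives along a Hamiltonian vector field. -/
lemma HasMajorant.lieDeriv_iterate (hw : w.Pos) {t η K L : ℝ} {G χ : Phase n m → ℂ} (hη : 0 < η)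
    (ht : η ≤ t) (hG : HasMajorant Set.univ D (w.scale t) G K) (hχ : HasGradient D w t χ L) (k : ℕ) :
    HasMajorant Set.univ D (w.scale (t - η))
      (fun z => ((k.factorial : ℂ))⁻¹ * (lieDeriv (hamField χ))^[k] G z)
      (K * (3 * (2 * (1 + n + m)) * (L / (η * w.d))) ^ k) := by
  have ht0 : 0 ≤ t := hη.le.trans ht
  have hδ := Widths.scale_δ_nonneg hw (sub_nonneg.2 ht)
  have hL := hχ.nonneg hw ht0
  have hK := hG.nonneg (Widths.scale_δ_nonneg hw ht0)
  have hd := d_pos hw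
  rcases Nat.eq_zero_or_pos k with rfl | hk
  · simpa using hG.restrict (Widths.scale_le_scale hw (by linarith)) hδ
  have hk' : (0 : ℝ) < k := by exact_mod_cast hk
  -- The loss η is shared equally among the k derivatives. This produces the factor k^k, which the
  -- factorial reduces to at most e^k ≤ 3^k.
  set ζ := η / k with hζ
  have hζ0 : 0 < ζ := div_pos hη hk'
  have hiter : ∀ i : ℕ, i ≤ k → HasMajorant Set.univ D (w.scale (t - i * ζ))
      ((lieDeriv (hamField χ))^[i] G) (K * (2 * (1 + n + m) * (L / (ζ * w.d))) ^ i) := by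
    intro i
    induction i with
    | zero => intro _; simpa using hG
    | succ i ih =>
      intro hi
      have hi' : ((i : ℝ) + 1) * ζ ≤ η := by
        have : (i : ℝ) + 1 ≤ k := by exact_mod_cast hi
        calc ((i : ℝ) + 1) * ζ ≤ k * ζ := by gcongr
          _ = η := by rw [hζ]; field_simp
      have h1 := ih (by omega)
      have h0 : 0 ≤ t - ((i : ℝ) + 1) * ζ := by linarith
      have h2 := h1.hasGradient hw (t := t - ((i : ℝ) + 1) * ζ) h0 (by linarith)
      have h3 := h2.lieDeriv hw h0 (hχ.restrict hw h0 (by nlinarith [mul_nonneg (Nat.cast_nonneg (α := ℝ) i) hζ0.le]))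
      rw [Function.iterate_succ_apply']
      push_cast
      refine h3.le (le_of_eq ?_)
      have : t - (i : ℝ) * ζ - (t - ((i : ℝ) + 1) * ζ) = ζ := by ring
      rw [this, pow_succ]
      field_simp
  have h1 := hiter k le_rfl
  have e : t - (k : ℝ) * ζ = t - η := by rw [hζ]; field_simp
  rw [e] at h1
  refine (h1.const_mul _).le ?_
  have hfac : (k : ℝ) ^ k / k.factorial ≤ 3 ^ k := by
    refine (Real.pow_div_factorial_le_exp _ hk'.le k).trans ?_
    have := Real.exp_one_lt_d9
    calc Real.exp k = Real.exp 1 ^ k := by rw [← Real.exp_nat_mul, mul_one]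
      _ ≤ 3 ^ k := by gcongr; linarith
  have e2 : L / (ζ * w.d) = k * (L / (η * w.d)) := by rw [hζ]; field_simp
  rw [e2, norm_inv, Complex.norm_natCast]
  calc ((k.factorial : ℝ))⁻¹ * (K * (2 * (1 + n + m) * (k * (L / (η * w.d)))) ^ k)
      = K * ((k : ℝ) ^ k / k.factorial) * (2 * (1 + n + m) * (L / (η * w.d))) ^ k := by
        rw [show 2 * (1 + (n : ℝ) + m) * (k * (L / (η * w.d))) =
          k * (2 * (1 + n + m) * (L / (η * w.d))) by ring, mul_pow]
        ring
    _ ≤ K * 3 ^ k * (2 * (1 + n + m) * (L / (η * w.d))) ^ k := by gcongr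
    _ = _ := by
      rw [mul_assoc, ← mul_pow]
      ring_nf

end Gradient

/-! ### Dimension-free bounds for the components of a Hamiltonian field. -/

section Displacement

open Set

/-- Cauchy estimate for the Euclidean length of a family of partial derivatives. -/
lemma euclNorm_fderiv_le {E : Type*} [NormedAddCommGroup E] [NormedSpace ℂ E] {k : ℕ}
    {e : Fin k → E} {U : Set E} (hU : IsOpen U) {χ : E → ℂ} (hχ : DifferentiableOn ℂ χ U) {M θ : ℝ}
    (hM : ∀ x ∈ U, ‖χ x‖ ≤ M) (hθ : 0 < θ) {z : E}
    (hz : ∀ v : Fin k → ℂ, euclNorm v < θ → z + ∑ i, v i • e i ∈ U) :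
    euclNorm (fun i => fderiv ℂ χ z (e i)) ≤ M / θ := by
  set a : Fin k → ℂ := fun i => fderiv ℂ χ z (e i) with ha
  have hz0 : z ∈ U := by simpa using hz 0 (by simpa [euclNorm] using hθ)
  have hM0 : 0 ≤ M := (norm_nonneg _).trans (hM z hz0)
  rcases (euclNorm_nonneg a).eq_or_lt with h0 | h0
  · rw [← h0]; positivity
  -- In the direction of the conjugate gradient the derivative is |a|², so one directional Cauchy
  -- estimate bounds the Euclidean length without any factor depending on k.
  set v : Fin k → ℂ := fun i => starRingEnd ℂ (a i) with hv
  have hva : euclNorm v = euclNorm a := by simp [euclNorm, hv]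
  have hmem : ∀ ζ : ℂ, ‖ζ‖ < θ / euclNorm a → z + ζ • ∑ i, v i • e i ∈ U := by
    intro ζ hζ
    have := hz (ζ • v) (by rw [euclNorm_smul, hva]; exact (lt_div_iff₀ h0).1 hζ)
    simpa [Finset.smul_sum, smul_smul] using this
  have h1 := norm_fderiv_apply_le (f := χ) (v := ∑ i, v i • e i) (div_pos hθ h0)
    (fun ζ hζ => (hχ _ (hmem ζ hζ)).differentiableAt (hU.mem_nhds (hmem ζ hζ)))
    (fun ζ hζ => hM _ (hmem ζ hζ))
  have h2 : fderiv ℂ χ z (∑ i, v i • e i) = ((euclNorm a ^ 2 : ℝ) : ℂ) := by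
    rw [map_sum, euclNorm, Real.sq_sqrt (Finset.sum_nonneg fun i _ => sq_nonneg _)]
    push_cast
    refine Finset.sum_congr rfl fun i _ => ?_
    rw [map_smul, smul_eq_mul, hv]
    exact Complex.conj_mul' (a i)
  rw [h2, Complex.norm_real, Real.norm_of_nonneg (sq_nonneg _), div_div_eq_mul_div,
    le_div_iff₀ hθ] at h1
  rw [le_div_iff₀ hθ]
  nlinarith

variable {D : Base n} {w : Widths}

lemma add_mem_domain_scale {t η : ℝ} {z u : Phase n m} (hz : z ∈ domain m D (w.scale t))
    (hy : ‖u.y‖ ≤ η * w.r) (hI : euclNorm u.I ≤ η * w.ρ) (hx : ‖u.x‖ ≤ η * w.ξ)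
    (hφ : ∀ i, ‖u.φ i‖ ≤ η * w.s) (hp : ∀ i, ‖u.p i‖ ≤ η * w.δ) (hq : ∀ i, ‖u.q i‖ ≤ η * w.δ) :
    z + u ∈ domain m D (w.scale (t + η)) := by
  obtain ⟨⟨h1, h2, h3⟩, h4, h5, h6⟩ := hz
  refine ⟨⟨add_mem_nhd₁ (v := u.y) h1 ?_, add_mem_nhd (v := u.I) h2 ?_, add_mem_nhd₁ (v := u.x) h3 ?_⟩, fun i => ?_, fun i => ?_,
    fun i => ?_⟩
  · simp only [Widths.scale]; linarith
  · simp only [Widths.scale]; linarith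
  · simp only [Widths.scale]; linarith
  · have h := h4 i
    simp only [Widths.scale] at h ⊢
    have e : ((z + u).φ i).im = (z.φ i).im + (u.φ i).im := rfl
    rw [e]
    have := (Complex.abs_im_le_norm (u.φ i)).trans (hφ i)
    linarith [abs_add_le (z.φ i).im (u.φ i).im]
  · have h := h5 i
    simp only [Widths.scale] at h ⊢
    have e : (z + u).p i = z.p i + u.p i := rfl
    rw [e]
    linarith [norm_add_le (z.p i) (u.p i), hp i]
  · have h := h6 i
    simp only [Widths.scale] at h ⊢
    have e : (z + u).q i = z.q i + u.q i := rfl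
    rw [e]
    linarith [norm_add_le (z.q i) (u.q i), hq i]

/-- The components of a Hamiltonian vector field, with the weights of `symplDist`. -/
lemma hamField_bounds (hw : w.Pos) {t σ M : ℝ} (hσ : 0 < σ) {S : Set (Idx n m)}
    {χ : Phase n m → ℂ} (hχ : HasMajorant S D (w.scale (t + σ)) χ M) {z : Phase n m}
    (hz : z ∈ domain m D (w.scale t)) :
    w.s * euclNorm (hamField χ z).I ≤ M / σ ∧ w.ρ * euclNorm (hamField χ z).φ ≤ M / σ ∧
      w.δ * euclNorm (hamField χ z).p ≤ M / σ ∧ w.δ * euclNorm (hamField χ z).q ≤ M / σ ∧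
      w.ξ * ‖(hamField χ z).y‖ ≤ M / σ ∧ w.r * ‖(hamField χ z).x‖ ≤ M / σ := by
  obtain ⟨hr, hρ, hξ, hs, hδ⟩ := hw
  have neg_eq : ∀ {k : ℕ} (v : Fin k → ℂ), euclNorm (fun i => -v i) = euclNorm v := fun v => by
    simp [euclNorm]
  have fam : ∀ {k : ℕ} (e : Fin k → Phase n m) (θ : ℝ), 0 < θ →
      (∀ v : Fin k → ℂ, euclNorm v < σ * θ →
        z + ∑ i, v i • e i ∈ domain m D (w.scale (t + σ))) →
      θ * euclNorm (fun i => fderiv ℂ χ z (e i)) ≤ M / σ := by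
    intro k e θ hθ h
    have := euclNorm_fderiv_le (isOpen_domain D _) hχ.differentiableOn
      (fun x hx => hχ.norm_le hx) (mul_pos hσ hθ) h
    calc θ * euclNorm (fun i => fderiv ℂ χ z (e i)) ≤ θ * (M / (σ * θ)) := by gcongr
      _ = M / σ := by field_simp
  have one : ∀ (e : Phase n m) (θ : ℝ), 0 < θ →
      (∀ v : ℂ, ‖v‖ < σ * θ → z + v • e ∈ domain m D (w.scale (t + σ))) →
      θ * ‖fderiv ℂ χ z e‖ ≤ M / σ := by
    intro e θ hθ h
    have := fam (fun _ : Fin 1 => e) θ hθ fun v hv => by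
      simpa using h (v 0) (by simpa [euclNorm] using hv)
    simpa [euclNorm] using this
  have e0 : ∀ {k : ℕ}, euclNorm (0 : Fin k → ℂ) = 0 := by simp [euclNorm]
  have hz' := fun u => add_mem_domain_scale (D := D) (w := w) (t := t) (η := σ) (z := z) (u := u) hz
  have p1 := (mul_pos hσ hr).le
  have p2 := (mul_pos hσ hρ).le
  have p3 := (mul_pos hσ hξ).le
  have p4 := (mul_pos hσ hs).le
  have p5 := (mul_pos hσ hδ).le
  -- The domain is a product in φ, p and q; Euclidean balls fit into it with the same radius, so
  -- Euclidean gradients are controlled in these variables too.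
  have q1 : ∀ {k : ℕ} (v : Fin k → ℂ) (c : ℝ), euclNorm v < c → ∀ i, ‖v i‖ ≤ c := fun v c hv i =>
    (norm_apply_le_euclNorm v i).trans hv.le
  refine ⟨?_, ?_, ?_, ?_, ?_, ?_⟩
  · refine (congrArg _ (neg_eq _)).le.trans (fam _ _ hs fun v hv => ?_)
    have : ∑ i, v i • (basisVec (.inr (.inr (.inl i))) : Phase n m) = (0, (0, v, 0)) := by
      refine Prod.ext ?_ (Prod.ext ?_ (Prod.ext ?_ ?_)) <;>
        simp [basisVec, halfVec, Prod.fst_sum, Prod.snd_sum, Finset.univ_sum_single, ← Pi.single_smul]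
    rw [this]
    apply hz' <;> simp [Phase.y, Phase.I, Phase.x, Phase.φ, Phase.p, Phase.q, e0, p1, p2, p3, p5]
    exact q1 v _ hv
  · refine fam _ _ hρ fun v hv => ?_
    have : ∑ i, v i • (basisVec (.inl (.inr (.inl i))) : Phase n m) = ((0, v, 0), 0) := by
      refine Prod.ext (Prod.ext ?_ (Prod.ext ?_ ?_)) ?_ <;>
        simp [basisVec, halfVec, Prod.fst_sum, Prod.snd_sum, Finset.univ_sum_single, ← Pi.single_smul]
    rw [this]
    apply hz' <;> simp [Phase.y, Phase.I, Phase.x, Phase.φ, Phase.p, Phase.q, p1, p3, p4, p5]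
    exact hv.le
  · refine (congrArg _ (neg_eq _)).le.trans (fam _ _ hδ fun v hv => ?_)
    have : ∑ i, v i • (basisVec (.inr (.inr (.inr i))) : Phase n m) = (0, (0, 0, v)) := by
      refine Prod.ext ?_ (Prod.ext ?_ (Prod.ext ?_ ?_)) <;>
        simp [basisVec, halfVec, Prod.fst_sum, Prod.snd_sum, Finset.univ_sum_single, ← Pi.single_smul]
    rw [this]
    apply hz' <;> simp [Phase.y, Phase.I, Phase.x, Phase.φ, Phase.p, Phase.q, e0, p1, p2, p3, p4, p5]
    exact q1 v _ hv
  · refine fam _ _ hδ fun v hv => ?_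
    have : ∑ i, v i • (basisVec (.inl (.inr (.inr i))) : Phase n m) = ((0, 0, v), 0) := by
      refine Prod.ext (Prod.ext ?_ (Prod.ext ?_ ?_)) ?_ <;>
        simp [basisVec, halfVec, Prod.fst_sum, Prod.snd_sum, Finset.univ_sum_single, ← Pi.single_smul]
    rw [this]
    apply hz' <;> simp [Phase.y, Phase.I, Phase.x, Phase.φ, Phase.p, Phase.q, e0, p1, p2, p3, p4, p5]
    exact q1 v _ hv
  · refine (congrArg _ (norm_neg _)).le.trans (one _ _ hξ fun v hv => ?_)
    apply hz' <;> simp [basisVec, halfVec, Phase.y, Phase.I, Phase.x, Phase.φ, Phase.p, Phase.q, e0,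
      p1, p2, p4, p5, hv.le]
  · refine one _ _ hr fun v hv => ?_
    apply hz' <;> simp [basisVec, halfVec, Phase.y, Phase.I, Phase.x, Phase.φ, Phase.p, Phase.q, e0,
      p2, p3, p4, p5, hv.le]

end Displacement

end NormalForm

namespace NormalForm

variable {n m : ℕ}

/-! ### Canonical transformations generated by small Hamiltonians. -/

section HamiltonianFlow

open Set Metric

variable {D : Base n} {w : Widths}

lemma shift_eq_add (l : Fin n → ℤ) (z : Phase n m) :
    z.shift l = z + (0, (0, fun i => 2 * (Real.pi : ℂ) * (l i : ℂ), 0)) := by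
  refine Prod.ext ?_ (Prod.ext ?_ (Prod.ext ?_ ?_))
  · exact (add_zero z.1).symm
  · exact (add_zero z.x).symm
  · rfl
  · exact (add_zero z.q).symm

lemma shift_mem_domain {w : Widths} {z : Phase n m} (l : Fin n → ℤ) (hz : z ∈ domain m D w) :
    z.shift l ∈ domain m D w := by
  refine ⟨hz.1, fun i => ?_, hz.2.2.1, hz.2.2.2⟩
  have : ((z.shift l).φ i).im = (z.φ i).im := by
    change (z.φ i + 2 * (Real.pi : ℂ) * (l i : ℂ)).im = _
    simp
  rw [this]
  exact hz.2.1 i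

/-- Division of each coordinate by its width. -/
def rescale (w : Widths) (hw : w.Pos) : Phase n m ≃L[ℂ] Phase n m :=
  have h : ∀ a : ℝ, 0 < a → ((a : ℂ))⁻¹ ≠ 0 := fun _ ha =>
    inv_ne_zero (Complex.ofReal_ne_zero.2 ha.ne')
  ((ContinuousLinearEquiv.smulLeft (Units.mk0 _ (h _ hw.1))).prodCongr
    ((ContinuousLinearEquiv.smulLeft (Units.mk0 _ (h _ hw.2.1))).prodCongr
      (ContinuousLinearEquiv.smulLeft (Units.mk0 _ (h _ hw.2.2.2.2))))).prodCongr
  ((ContinuousLinearEquiv.smulLeft (Units.mk0 _ (h _ hw.2.2.1))).prodCongr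
    ((ContinuousLinearEquiv.smulLeft (Units.mk0 _ (h _ hw.2.2.2.1))).prodCongr
      (ContinuousLinearEquiv.smulLeft (Units.mk0 _ (h _ hw.2.2.2.2)))))

lemma rescale_apply (hw : w.Pos) (z : Phase n m) : rescale w hw z =
    (((w.r : ℂ)⁻¹ • z.y, (w.ρ : ℂ)⁻¹ • z.I, (w.δ : ℂ)⁻¹ • z.p),
      ((w.ξ : ℂ)⁻¹ • z.x, (w.s : ℂ)⁻¹ • z.φ, (w.δ : ℂ)⁻¹ • z.q)) := rfl

lemma rescale_symm_apply (hw : w.Pos) (z : Phase n m) : (rescale w hw).symm z =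
    (((w.r : ℂ) • z.y, (w.ρ : ℂ) • z.I, (w.δ : ℂ) • z.p),
      ((w.ξ : ℂ) • z.x, (w.s : ℂ) • z.φ, (w.δ : ℂ) • z.q)) := by
  obtain ⟨hr, hρ, hξ, hs, hδ⟩ := id hw
  have h : ∀ {a : ℝ}, 0 < a → (a : ℂ) ≠ 0 := fun ha => Complex.ofReal_ne_zero.2 ha.ne'
  rw [ContinuousLinearEquiv.symm_apply_eq, rescale_apply]
  simp only [Phase.y, Phase.I, Phase.p, Phase.x, Phase.φ, Phase.q, smul_smul,
    inv_mul_cancel₀ (h hr), inv_mul_cancel₀ (h hρ), inv_mul_cancel₀ (h hξ), inv_mul_cancel₀ (h hs),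
    inv_mul_cancel₀ (h hδ), one_smul]

/-- In the rescaled variables all the widths are comparable with the sup norm, except that 𝓘_ρ is
made of Euclidean balls: this costs the factor n + 1. The 3 matches the collar of `SmallField`. -/
lemma ball_rescale_subset (hw : w.Pos) {t η : ℝ} (hη : 0 < η) {x : Phase n m}
    (hx : (rescale w hw).symm x ∈ domain m D (w.scale t)) :
    ball x (3 * (η / (3 * (n + 1)))) ⊆
      (rescale w hw).symm ⁻¹' domain m D (w.scale (t + η)) := by
  obtain ⟨hr, hρ, hξ, hs, hδ⟩ := id hw
  intro x' hx'
  have e1 : 3 * (η / (3 * (n + 1))) = η / (n + 1) := by field_simp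
  rw [e1, mem_ball, dist_eq_norm] at hx'
  have hle : η / ((n : ℝ) + 1) ≤ η :=
    div_le_self hη.le (by linarith [Nat.cast_nonneg (α := ℝ) n])
  set u := x' - x with hu
  have hu1 := hx'.le
  have hu2 := hx'.le.trans hle
  have hfst : ‖u.1‖ ≤ ‖u‖ := norm_fst_le u
  have hsnd : ‖u.2‖ ≤ ‖u‖ := norm_snd_le u
  have hI : ‖u.I‖ ≤ ‖u‖ := (norm_fst_le u.1.2).trans ((norm_snd_le u.1).trans hfst)
  have hp : ‖u.p‖ ≤ ‖u‖ := (norm_snd_le u.1.2).trans ((norm_snd_le u.1).trans hfst)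
  have hφ : ‖u.φ‖ ≤ ‖u‖ := (norm_fst_le u.2.2).trans ((norm_snd_le u.2).trans hsnd)
  have hq : ‖u.q‖ ≤ ‖u‖ := (norm_snd_le u.2.2).trans ((norm_snd_le u.2).trans hsnd)
  have hy : ‖u.y‖ ≤ ‖u‖ := (norm_fst_le u.1).trans hfst
  have hxx : ‖u.x‖ ≤ ‖u‖ := (norm_fst_le u.2).trans hsnd
  have hmul : ∀ {a : ℝ} {c : ℂ}, 0 < a → ‖c‖ ≤ ‖u‖ → ‖(a : ℂ) • c‖ ≤ η * a := by
    intro a c ha hc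
    rw [norm_smul, Complex.norm_real, Real.norm_of_nonneg ha.le, mul_comm]
    exact mul_le_mul_of_nonneg_right (hc.trans hu2) ha.le
  have key : (rescale w hw).symm x' = (rescale w hw).symm x + (rescale w hw).symm u := by
    rw [← map_add, hu, add_sub_cancel]
  rw [mem_preimage, key]
  have hs' := rescale_symm_apply hw u
  refine add_mem_domain_scale hx ?_ ?_ ?_ (fun i => ?_) (fun i => ?_) (fun i => ?_) <;> rw [hs']
  · exact hmul hr hy
  · change euclNorm ((w.ρ : ℂ) • u.I) ≤ _
    rw [euclNorm_smul, Complex.norm_real, Real.norm_of_nonneg hρ.le, mul_comm]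
    refine mul_le_mul_of_nonneg_right ?_ hρ.le
    refine (euclNorm_le_mul (C := η / (n + 1)) (fun i => ((norm_le_pi_norm _ i).trans hI).trans hu1)
      (by positivity)).trans ?_
    rw [mul_div_assoc', div_le_iff₀ (by positivity)]
    nlinarith
  · exact hmul hξ hxx
  · exact hmul hs ((norm_le_pi_norm _ i).trans hφ)
  · exact hmul hδ ((norm_le_pi_norm _ i).trans hp)
  · exact hmul hδ ((norm_le_pi_norm _ i).trans hq)

/-- A component of the field is a derivative in the conjugate direction; dividing it by its own
width leaves the product of the two conjugate widths in the denominator. -/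
lemma norm_rescale_hamField_le (hw : w.Pos) {L : ℝ} (hL : 0 ≤ L) {χ : Phase n m → ℂ}
    {z : Phase n m} (h : ∀ c, ‖fderiv ℂ χ z (basisVec c)‖ ≤ L / width w c) :
    ‖rescale w hw (hamField χ z)‖ ≤ L / w.d := by
  obtain ⟨hr, hρ, hξ, hs, hδ⟩ := id hw
  have hd := d_pos hw
  have hC : 0 ≤ L / w.d := by positivity
  have key : ∀ (c : Half n m ⊕ Half n m) (a : ℝ), 0 < a → w.d ≤ width w c * a →
      a⁻¹ * ‖fderiv ℂ χ z (basisVec c)‖ ≤ L / w.d := by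
    intro c a ha hda
    have hc := width_pos hw c
    calc a⁻¹ * ‖fderiv ℂ χ z (basisVec c)‖ ≤ a⁻¹ * (L / width w c) := by gcongr; exact h c
      _ = L / (width w c * a) := by field_simp
      _ ≤ L / w.d := div_le_div_of_nonneg_left hL hd hda
  have hinl : ∀ c : Half n m, w.d ≤ width w (.inl c : Half n m ⊕ Half n m) * width w (.inr c : Half n m ⊕ Half n m) :=
    fun c => d_le_width_mul w c
  have hinr : ∀ c : Half n m, w.d ≤ width w (.inr c : Half n m ⊕ Half n m) * width w (.inl c : Half n m ⊕ Half n m) :=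
    fun c => by rw [mul_comm]; exact d_le_width_mul w c
  have nrm : ∀ {a : ℝ} {c : ℂ}, 0 < a → ‖(a : ℂ)⁻¹ • c‖ = a⁻¹ * ‖c‖ := fun {a c} ha => by
    rw [norm_smul, norm_inv, Complex.norm_real, Real.norm_of_nonneg ha.le]
  rw [rescale_apply]
  refine norm_prod_le_iff.2 ⟨norm_prod_le_iff.2 ⟨?_, norm_prod_le_iff.2 ⟨?_, ?_⟩⟩,
    norm_prod_le_iff.2 ⟨?_, norm_prod_le_iff.2 ⟨?_, ?_⟩⟩⟩
  · refine (nrm hr).le.trans ?_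
    refine (congrArg _ (norm_neg _)).le.trans (key _ _ hr (hinr _))
  · refine (pi_norm_le_iff_of_nonneg hC).2 fun i => (nrm hρ).le.trans ?_
    refine (congrArg _ (norm_neg _)).le.trans (key _ _ hρ (hinr (.inr (.inl i))))
  · refine (pi_norm_le_iff_of_nonneg hC).2 fun i => (nrm hδ).le.trans ?_
    refine (congrArg _ (norm_neg _)).le.trans (key _ _ hδ (hinr (.inr (.inr i))))
  · exact (nrm hξ).le.trans (key _ _ hξ (hinl (.inl ())))
  · exact (pi_norm_le_iff_of_nonneg hC).2 fun i => (nrm hs).le.trans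
      (key _ _ hs (hinl (.inr (.inl i))))
  · exact (pi_norm_le_iff_of_nonneg hC).2 fun i => (nrm hδ).le.trans
      (key _ _ hδ (hinl (.inr (.inr i))))

lemma fderiv_shift {S : Set (Idx n m)} {χ : Phase n m → ℂ} {M : ℝ} (hχ : HasMajorant S D w χ M)
    {z : Phase n m} (hz : z ∈ domain m D w) (l : Fin n → ℤ) :
    fderiv ℂ χ (z + (0, (0, fun i => 2 * (Real.pi : ℂ) * (l i : ℂ), 0))) = fderiv ℂ χ z := by
  rw [← fderiv_comp_add_right]
  refine Filter.EventuallyEq.fderiv_eq ?_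
  filter_upwards [(isOpen_domain (m := m) D w).mem_nhds hz] with x hx
  rw [← shift_eq_add]
  exact hχ.shift hx l

/-- The time-one flow of a small Hamiltonian is a canonical transformation. -/
theorem exists_hamiltonian_timeOne (hw : w.Pos) {t σ η M : ℝ} (hσ : 0 < σ) (hη : 0 < η)
    (ht : 2 * η ≤ t) {S : Set (Idx n m)} {χ : Phase n m → ℂ}
    (hχ : HasMajorant S D (w.scale (t + σ)) χ M) (hsmall : 24 * (n + 1) * M ≤ σ * η * w.d) :
    ∃ Φ : Phase n m → Phase n m, IsCanonical D (w.scale (t - 2 * η)) (w.scale t) Φ ∧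
      (∀ G : Phase n m → ℂ, DifferentiableOn ℂ G (domain m D (w.scale t)) →
        ∀ z ∈ domain m D (w.scale (t - η)),
          HasSum (fun k : ℕ => ((k.factorial : ℂ))⁻¹ * (lieDeriv (hamField χ))^[k] G z) (G (Φ z))) ∧
      ∀ z ∈ domain m D (w.scale (t - η)), symplDist w (Φ z) z ≤ M / σ := by
  have ht0 : 0 ≤ t := by linarith
  have hd := d_pos hw
  have hM := hχ.nonneg (Widths.scale_δ_nonneg hw (by linarith))
  have hgrad : HasGradient D w t χ (M / σ) := by
    simpa using hχ.hasGradient hw ht0 (by linarith)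
  set U := domain m D (w.scale t) with hU
  have hUsub : U ⊆ domain m D (w.scale (t + σ)) :=
    domain_mono D (Widths.scale_le_scale hw (by linarith))
  have hUo : IsOpen U := isOpen_domain D _
  have hχd : DifferentiableOn ℂ χ U := hχ.differentiableOn.mono hUsub
  have hXd := differentiableOn_hamField hUo hχd
  set A : Phase n m ≃L[ℂ] Phase n m := rescale w hw with hA
  -- The rescaled speed is at most M/(σd), and `hsmall` says that this is at most one eighth of
  -- η/(3(n + 1)). The field lives on the fraction t of the widths, its flow on t - η; injectivity
  -- takes another η.
  have hsf : SmallField (fun x => A (hamField χ (A.symm x))) (A.symm ⁻¹' U)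
      (A.symm ⁻¹' domain m D (w.scale (t - η))) (η / (3 * (n + 1))) :=
    { pos := by positivity
      openU := hUo.preimage A.symm.continuous
      openV := (isOpen_domain D _).preimage A.symm.continuous
      diff := A.differentiable.comp_differentiableOn
        (hXd.comp A.symm.differentiable.differentiableOn fun x hx => hx)
      bound := by
        intro z hz
        refine (norm_rescale_hamField_le hw (div_nonneg hM hσ.le)
          fun c => (hgrad c).norm_le hz).trans ?_
        rw [div_div, div_div, div_le_div_iff₀ (by positivity) (by positivity)]
        linarith
      ball_subset := by
        intro z hz
        have := ball_rescale_subset hw hη hz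
        rwa [sub_add_cancel] at this }
  obtain ⟨Φ, h1, h2, h3, h4, h5, h6, h7⟩ := exists_timeOne A
    (V' := domain m D (w.scale (t - 2 * η))) hsf (fun x hx => by
      have := ball_rescale_subset hw hη (mem_preimage.1 hx)
      rwa [show t - 2 * η + η = t - η by ring] at this) hXd
  have hV' : domain m D (w.scale (t - 2 * η)) ⊆ domain m D (w.scale (t - η)) :=
    domain_mono D (Widths.scale_le_scale hw (by linarith))
  refine ⟨Φ, ⟨h1.mono hV', fun z hz => h2 (hV' hz), h3, fun z hz u v => ?_, fun z hz l => ?_⟩, h6,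
    fun z hz => ?_⟩
  · rw [twoForm_eq, twoForm_eq]
    exact h4 twoFormL (fun x hx u v => twoFormL_fderiv_hamField hUo hχd hx u v) z (hV' hz) u v
  · have := h5 (0, (0, fun i => 2 * (Real.pi : ℂ) * (l i : ℂ), 0)) (fun x hx => ⟨?_, ?_⟩) z
      (hV' hz) (by rw [← shift_eq_add]; exact shift_mem_domain l (hV' hz))
    · rw [shift_eq_add, shift_eq_add, this]
    · rw [← shift_eq_add]; exact shift_mem_domain l hx
    · simp only [hamField, fderiv_shift hχ (hUsub hx)]
  · have hb := fun x (hx : x ∈ U) => hamField_bounds hw hσ hχ hx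
    obtain ⟨hr, hρ, hξ, hs, hδ⟩ := id hw
    have one : ∀ (L : Phase n m →L[ℂ] ℂ) (a : ℝ), 0 < a →
        (∀ x ∈ U, a * ‖L (hamField χ x)‖ ≤ M / σ) → a * ‖L (Φ z) - L z‖ ≤ M / σ := by
      intro L a ha h
      have := h7 ℂ L (M / σ / a) (fun x hx => by
        rw [le_div_iff₀ ha, mul_comm]; exact h x hx) z hz
      rw [le_div_iff₀ ha, mul_comm, map_sub] at this
      exact this
    -- The values are taken in `EuclideanSpace`, so that the mean value bound for the displacement
    -- holds directly in the Euclidean norm.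
    have fam : ∀ (k : ℕ) (L : Phase n m →L[ℂ] (Fin k → ℂ)) (a : ℝ), 0 < a →
        (∀ x ∈ U, a * euclNorm (L (hamField χ x)) ≤ M / σ) →
          a * euclNorm (L (Φ z) - L z) ≤ M / σ := by
      intro k L a ha h
      have := h7 (EuclideanSpace ℂ (Fin k))
        (((PiLp.continuousLinearEquiv 2 ℂ (fun _ : Fin k => ℂ)).symm :
          (Fin k → ℂ) →L[ℂ] EuclideanSpace ℂ (Fin k)).comp L) (M / σ / a) (fun x hx => by
        rw [le_div_iff₀ ha, mul_comm]
        have := h x hx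
        rw [euclNorm_eq] at this
        exact this) z hz
      rw [le_div_iff₀ ha, mul_comm] at this
      rw [← map_sub, euclNorm_eq]
      exact this
    refine max_le (fam n ((ContinuousLinearMap.fst ℂ _ _).comp
      ((ContinuousLinearMap.snd ℂ _ _).comp firstHalf)) _ hs fun x hx => (hb x hx).1)
      (max_le (fam n ((ContinuousLinearMap.fst ℂ _ _).comp
        ((ContinuousLinearMap.snd ℂ _ _).comp secondHalf)) _ hρ fun x hx => (hb x hx).2.1)
      (max_le (fam m ((ContinuousLinearMap.snd ℂ _ _).comp
        ((ContinuousLinearMap.snd ℂ _ _).comp firstHalf)) _ hδ fun x hx => (hb x hx).2.2.1)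
      (max_le (fam m ((ContinuousLinearMap.snd ℂ _ _).comp
        ((ContinuousLinearMap.snd ℂ _ _).comp secondHalf)) _ hδ fun x hx => (hb x hx).2.2.2.1)
      (max_le (one ((ContinuousLinearMap.fst ℂ _ _).comp firstHalf) _ hξ
        fun x hx => (hb x hx).2.2.2.2.1)
      (one ((ContinuousLinearMap.fst ℂ _ _).comp secondHalf) _ hr
        fun x hx => (hb x hx).2.2.2.2.2)))))

end HamiltonianFlow

end NormalForm

namespace NormalForm

variable {n m : ℕ}

/-! ### Frequencies, and the Lie derivative of the unperturbed Hamiltonian. -/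

section Frequencies

open Set

variable {h₀ : ℂ × (Fin n → ℂ) × (Fin m → ℂ) → ℂ} {u : ℂ × (Fin n → ℂ) × (Fin m → ℂ)}

lemma omegaY_eq (h : DifferentiableAt ℂ h₀ u) :
    omegaY h₀ u = fderiv ℂ h₀ u (halfVec (.inl ())) := by
  have h1 : HasDerivAt (fun t : ℂ => (t, u.2.1, u.2.2)) (halfVec (.inl ())) u.1 :=
    (hasDerivAt_id _).prodMk ((hasDerivAt_const _ _).prodMk (hasDerivAt_const _ _))
  exact (HasFDerivAt.comp_hasDerivAt (l := h₀) (l' := fderiv ℂ h₀ u) u.1 h.hasFDerivAt h1).deriv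

lemma omegaI_eq (h : DifferentiableAt ℂ h₀ u) (i : Fin n) :
    omegaI h₀ i u = fderiv ℂ h₀ u (halfVec (.inr (.inl i))) := by
  have h1 : HasDerivAt (fun t : ℂ => (u.1, Function.update u.2.1 i t, u.2.2))
      (halfVec (.inr (.inl i))) (u.2.1 i) :=
    (hasDerivAt_const _ _).prodMk ((hasDerivAt_update _ _ _).prodMk (hasDerivAt_const _ _))
  have e : (u.1, Function.update u.2.1 i (u.2.1 i), u.2.2) = u := by simp
  exact (HasFDerivAt.comp_hasDerivAt (l := h₀) (l' := fderiv ℂ h₀ u) (u.2.1 i)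
    (by rw [e]; exact h.hasFDerivAt) h1).deriv

lemma omegaJ_eq (h : DifferentiableAt ℂ h₀ u) (i : Fin m) :
    omegaJ h₀ i u = fderiv ℂ h₀ u (halfVec (.inr (.inr i))) := by
  have h1 : HasDerivAt (fun t : ℂ => (u.1, u.2.1, Function.update u.2.2 i t))
      (halfVec (.inr (.inr i))) (u.2.2 i) :=
    (hasDerivAt_const _ _).prodMk ((hasDerivAt_const _ _).prodMk (hasDerivAt_update _ _ _))
  have e : (u.1, u.2.1, Function.update u.2.2 i (u.2.2 i)) = u := by simp
  exact (HasFDerivAt.comp_hasDerivAt (l := h₀) (l' := fderiv ℂ h₀ u) (u.2.2 i)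
    (by rw [e]; exact h.hasFDerivAt) h1).deriv

lemma fderiv_comp_yIJ {z : Phase n m} (h : DifferentiableAt ℂ h₀ z.yIJ) (v : Phase n m) :
    fderiv ℂ (fun z : Phase n m => h₀ z.yIJ) z v = v.y * omegaY h₀ z.yIJ +
      (∑ i, v.I i * omegaI h₀ i z.yIJ +
        ∑ i, (v.p i * z.q i + z.p i * v.q i) * omegaJ h₀ i z.yIJ) := by
  have hJ : Differentiable ℂ (fun z : Phase n m => z.yIJ) := by
    unfold Phase.yIJ Phase.J Phase.y Phase.I Phase.p Phase.q
    fun_prop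
  have hline : HasDerivAt (fun t : ℂ => (z + t • v).yIJ)
      (v.y, v.I, fun i => v.p i * z.q i + z.p i * v.q i) 0 := by
    have hc : ∀ a b : ℂ, HasDerivAt (fun t : ℂ => a + t * b) b 0 := fun a b => by
      simpa using ((hasDerivAt_id (0 : ℂ)).mul_const b).const_add a
    refine (hc z.y v.y).prodMk (HasDerivAt.prodMk (hasDerivAt_pi.2 fun i => hc (z.I i) (v.I i))
      (hasDerivAt_pi.2 fun i => ?_))
    have := (hc (z.p i) (v.p i)).mul (hc (z.q i) (v.q i))
    simp only [zero_mul, add_zero] at this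
    exact this
  have e0 : (z + (0 : ℂ) • v).yIJ = z.yIJ := by simp
  have h1 : HasDerivAt (fun t : ℂ => h₀ (z + t • v).yIJ) _ 0 :=
    HasFDerivAt.comp_hasDerivAt (l := h₀) (l' := fderiv ℂ h₀ z.yIJ) (0 : ℂ)
      (by rw [e0]; exact h.hasFDerivAt) hline
  rw [fderiv_apply_of_line (f := fun z : Phase n m => h₀ z.yIJ)
    (DifferentiableAt.comp z h hJ.differentiableAt) h1]
  conv_lhs => rw [← sum_halfCoord_smul (v.y, v.I, fun i => v.p i * z.q i + z.p i * v.q i)]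
  simp only [Fintype.sum_sum_type, omegaY_eq h, omegaI_eq h,
    omegaJ_eq h]
  simp [halfCoord]

/-- The homological equation in terms of the Lie derivative of the unperturbed Hamiltonian. -/
lemma lieDeriv_yIJ_of_charVec {χ : Phase n m → ℂ} {z : Phase n m} {F : ℂ}
    (h : DifferentiableAt ℂ h₀ z.yIJ) (hω : omegaY h₀ z.yIJ ≠ 0)
    (hχ : fderiv ℂ χ z (charVec (fun i u => omegaI h₀ i u / omegaY h₀ u)
      (fun i u => omegaJ h₀ i u / omegaY h₀ u) z) = F / omegaY h₀ z.yIJ) :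
    lieDeriv (hamField χ) (fun z : Phase n m => h₀ z.yIJ) z = -F := by
  -- The claim becomes the identity L_χ h₀ = -ω_y times the derivative of χ along `charVec`, which
  -- is checked coordinate by coordinate.
  have hF : F = omegaY h₀ z.yIJ * (F / omegaY h₀ z.yIJ) := by field_simp
  rw [hF, ← hχ, clm_apply_eq_sum, lieDeriv, fderiv_comp_yIJ h]
  simp only [Fintype.sum_sum_type, halfCoord, charVec, hamField, Phase.y, Phase.I, Phase.p,
    Phase.q, smul_eq_mul, Finset.univ_unique, Finset.sum_singleton,
    ContinuousLinearMap.coe_comp, ContinuousLinearMap.coe_fst', ContinuousLinearMap.coe_snd',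
    Function.comp_apply, ContinuousLinearMap.proj_apply, Pi.zero_apply, zero_mul, zero_add]
  simp only [mul_add, Finset.mul_sum, neg_add, ← Finset.sum_neg_distrib]
  congr 1
  · ring_nf
  · congr 1
    · refine Finset.sum_congr rfl fun i _ => ?_
      field_simp
    · refine Finset.sum_congr rfl fun i _ => ?_
      field_simp
      ring

end Frequencies

/-! ### One step of averaging. -/

section Step

open Set

variable {D : Base n} {w : Widths}

lemma lieDeriv_iterate_congr {E : Type*} [NormedAddCommGroup E] [NormedSpace ℂ E] {X : E → E}
    {U : Set E} (hU : IsOpen U) {G G' : E → ℂ} (h : ∀ z ∈ U, G z = G' z) (k : ℕ) :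
    ∀ z ∈ U, (lieDeriv X)^[k] G z = (lieDeriv X)^[k] G' z := by
  induction k with
  | zero => exact h
  | succ k ih =>
    intro z hz
    rw [Function.iterate_succ_apply', Function.iterate_succ_apply']
    have : (lieDeriv X)^[k] G =ᶠ[nhds z] (lieDeriv X)^[k] G' :=
      Filter.eventually_of_mem (hU.mem_nhds hz) ih
    simp only [lieDeriv, this.fderiv_eq]

lemma IsCanonical.mono_target {w₁ w₂ w₃ : Widths} {Ψ : Phase n m → Phase n m}
    (h : IsCanonical D w₁ w₂ Ψ) (hle : w₂.Le w₃) : IsCanonical D w₁ w₃ Ψ :=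
  ⟨h.holomorphic, h.mapsTo.mono_right (domain_mono D hle), h.injOn, h.symplectic, h.periodic⟩

/-- The remainder of the Lie series of `H + P`, when the Lie derivative of `H` is `-F`. -/
lemma hasSum_lie_remainder {X : Phase n m → Phase n m} {U : Set (Phase n m)} (hU : IsOpen U)
    {H P F : Phase n m → ℂ} (hHF : ∀ z ∈ U, lieDeriv X H z = -F z) {z : Phase n m} (hz : z ∈ U)
    {a b : ℂ} (hH : HasSum (fun k : ℕ => ((k.factorial : ℂ))⁻¹ * (lieDeriv X)^[k] H z) a)
    (hP : HasSum (fun k : ℕ => ((k.factorial : ℂ))⁻¹ * (lieDeriv X)^[k] P z) b) :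
    HasSum (fun k : ℕ => (((k + 1).factorial : ℂ))⁻¹ * (lieDeriv X)^[k] (lieDeriv X P) z -
      (((k + 2).factorial : ℂ))⁻¹ * (lieDeriv X)^[k] (lieDeriv X F) z)
      (a + b - (H z + P z - F z)) := by
  -- From the first derivative on, the series of H is a shifted series of -F. Two terms of the
  -- series of H and one of that of P are split off; the rest involves Lie derivatives of P and F
  -- alone, and no bound on H.
  have hneg : ∀ k, (lieDeriv X)^[k] (lieDeriv X H) z = -(lieDeriv X)^[k] F z := by
    intro k
    rw [lieDeriv_iterate_congr hU (G' := fun z => -F z) hHF k z hz]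
    clear hHF hH hP hz
    induction k generalizing z with
    | zero => rfl
    | succ k ih =>
      rw [Function.iterate_succ_apply', Function.iterate_succ_apply']
      have : (lieDeriv X)^[k] (fun z => -F z) = fun z => -(lieDeriv X)^[k] F z := funext fun z => ih
      simp only [this, lieDeriv, fderiv_fun_neg, neg_apply]
  have h1 := (hasSum_nat_add_iff' 1).2 hP
  have h2 := (hasSum_nat_add_iff' 2).2 hH
  have h3 := h2.add h1
  have hval : a + b - (H z + P z - F z) =
      a - ∑ i ∈ Finset.range 2, ((i.factorial : ℂ))⁻¹ * (lieDeriv X)^[i] H z +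
        (b - ∑ i ∈ Finset.range 1, ((i.factorial : ℂ))⁻¹ * (lieDeriv X)^[i] P z) := by
    have e : (lieDeriv X)^[1] H z = -F z := hHF z hz
    rw [Finset.sum_range_succ, Finset.sum_range_one, Finset.sum_range_one, e]
    simp
    ring
  rw [hval]
  refine (congrArg (fun s : ℕ → ℂ => HasSum s _) (funext fun k => ?_)).mpr h3
  rw [show (lieDeriv X)^[k + 2] H z = (lieDeriv X)^[k + 1] (lieDeriv X H) z from rfl, hneg,
    show (lieDeriv X)^[k + 1] P z = (lieDeriv X)^[k] (lieDeriv X P) z from rfl,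
    show (lieDeriv X)^[k + 1] F z = (lieDeriv X)^[k] (lieDeriv X F) z from rfl]
  ring

/-- Removing κ from lam ≤ 1 is a relative loss κ/lam ≥ κ ≥ b, and 1 - κ/lam ≤ e^{-κ/lam}. Thus the
fraction κ of δ pays for the factor e^{𝒳β} of the homological equation. -/
lemma exp_scale_le {κ lam b : ℝ} (hκ : 0 ≤ κ) (hlam : 0 < lam) (hlam1 : lam ≤ 1) (hb : b ≤ κ) :
    (lam - κ) * Real.exp b ≤ lam := by
  have h1 : 1 - κ / lam ≤ Real.exp (-(κ / lam)) := by
    have := Real.add_one_le_exp (-(κ / lam)); linarith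
  have h2 : κ ≤ κ / lam := by
    rw [le_div_iff₀ hlam]; nlinarith
  have h3 : lam - κ = lam * (1 - κ / lam) := by field_simp
  calc (lam - κ) * Real.exp b ≤ lam * Real.exp (-(κ / lam)) * Real.exp b := by
        rw [h3]; gcongr
    _ = lam * Real.exp (b - κ / lam) := by rw [mul_assoc, ← Real.exp_add]; ring_nf
    _ ≤ lam * 1 := by
        gcongr; rw [Real.exp_le_one_iff]; linarith
    _ = lam := mul_one _

/-- The data of the unperturbed problem that stay fixed along the iteration. -/
structure Unperturbed (D : Base n) (w : Widths) (h₀ : ℂ × (Fin n → ℂ) × (Fin m → ℂ) → ℂ)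
    (X κ : ℝ) : Prop where
  pos : w.Pos
  diff : DifferentiableOn ℂ h₀ (actionDomain m D w)
  omega_ne : ∀ u ∈ actionDomain m D w, omegaY h₀ u ≠ 0
  convex : Convex ℝ D.Ξ
  center : ∃ x₀ ∈ D.Ξ, ∀ x ∈ nhd₁ D.Ξ w.ξ, ‖x - (x₀ : ℂ)‖ ≤ X
  X_nonneg : 0 ≤ X
  κ_nonneg : 0 ≤ κ
  slope_I : ∃ α, X * α ≤ κ * w.s ∧ ∀ l, HasMajorant univ D w
    (fun z : Phase n m => omegaI h₀ l z.yIJ / omegaY h₀ z.yIJ) α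
  slope_J : ∃ β, X * β ≤ κ ∧ ∀ l, HasMajorant univ D w
    (fun z : Phase n m => omegaJ h₀ l z.yIJ / omegaY h₀ z.yIJ) β

variable {h₀ : ℂ × (Fin n → ℂ) × (Fin m → ℂ) → ℂ} {X κ : ℝ}

/-- One step of the averaging procedure. -/
theorem Unperturbed.exists_step (hu : Unperturbed D w h₀ X κ) {lam t σ η ε K L G : ℝ}
    (hlam : lam ≤ 1) (hσ : 0 < σ) (hη : 0 < η) (ht : lam = t + σ + κ) (htη : 2 * η ≤ t)
    {S₁ S₂ S₃ S₄ : Set (Idx n m)} {g fb ft : Phase n m → ℂ}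
    (hg : HasMajorant S₁ D (w.scale lam) g G) (hgL : HasGradient D w t g L)
    (hfb : HasMajorant S₂ D (w.scale lam) fb ε) (hft : HasMajorant S₃ D (w.scale lam) ft ε)
    (hK : HasMajorant S₄ D (w.scale lam) (fun z => ft z / omegaY h₀ z.yIJ) K)
    (hsmall : 24 * (2 * (1 + n + m)) * (X * K) ≤ σ * η * w.d) :
    ∃ (Φ : Phase n m → Phase n m) (f' : Phase n m → ℂ),
      IsCanonical D (w.scale (t - 2 * η)) (w.scale t) Φ ∧
      (∀ z ∈ domain m D (w.scale (t - 2 * η)), symplDist w (Φ z) z ≤ X * K / σ) ∧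
      HasMajorant univ D (w.scale (t - 2 * η)) f'
        (2 * (2 * (1 + n + m)) * (L + 3 * (ε / σ)) * (X * K) / (σ * w.d)) ∧
      ∀ z ∈ domain m D (w.scale (t - 2 * η)),
        h₀ (Φ z).yIJ + (g (Φ z) + fb (Φ z) + ft (Φ z)) = h₀ z.yIJ + (g z + fb z + f' z) := by
  obtain ⟨hw, hh, hω, hΞ, ⟨x₀, hx₀, hX⟩, hX0, hκ, ⟨α, hα, hA⟩, ⟨β, hβ, hB⟩⟩ := hu
  have ht0 : 0 < t := by linarith
  have hlam0 : 0 < lam := by linarith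
  have hd := d_pos hw
  obtain ⟨hr, hρ, hξ, hs, hδ⟩ := id hw
  have hscale1 : ∀ {r : ℝ}, r ≤ 1 → (w.scale r).Le w := fun {r} hr => by
    simpa [Widths.scale_one] using Widths.scale_le_scale hw hr
  have hδl : ∀ {r : ℝ}, 0 ≤ r → 0 ≤ (w.scale r).δ := fun hr => Widths.scale_δ_nonneg hw hr
  -- Budget of the widths: κ for the homological equation, σ for the gradient of χ, then η for the
  -- Lie series and 2η in all for injectivity of the flow.
  obtain ⟨χ, hχM, hχ⟩ := exists_homological (w := w.scale lam) (w' := w.scale (t + σ))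
    (A := fun i u => omegaI h₀ i u / omegaY h₀ u) (B := fun i u => omegaJ h₀ i u / omegaY h₀ u)
    hΞ hx₀ (X := X) (fun x hx => hX x (nhd₁_mono _ (hscale1 hlam).2.2.1 hx)) hX0
    (Widths.scale_le_scale hw (by linarith)) (Widths.scale_s_nonneg hw (by linarith))
    (hδl (by linarith)) (fun l => (hA l).restrict (hscale1 hlam) (hδl hlam0.le))
    (fun l => (hB l).restrict (hscale1 hlam) (hδl hlam0.le))
    (by simp only [Widths.scale]; rw [ht]; linarith)
    (by
      have := exp_scale_le hκ hlam0 hlam hβ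
      simp only [Widths.scale]
      rw [show t + σ = lam - κ by linarith]
      nlinarith) hK
  set M := X * K with hM
  have hM0 : 0 ≤ M := hχM.nonneg (hδl (by linarith))
  set C : ℝ := 2 * (1 + n + m) with hC
  have hn0 := Nat.cast_nonneg (α := ℝ) n
  have hm0 := Nat.cast_nonneg (α := ℝ) m
  have hC0 : 0 < C := by positivity
  obtain ⟨Φ, hΦ, hsum, hdisp⟩ := exists_hamiltonian_timeOne hw hσ hη htη hχM (by
    refine le_trans ?_ hsmall
    gcongr
    rw [hC]
    linarith)
  have hχL : HasGradient D w t χ (M / σ) := by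
    simpa using hχM.hasGradient hw ht0.le (by linarith)
  set U := domain m D (w.scale t) with hU
  have hUo : IsOpen U := isOpen_domain D _
  have hUlam : U ⊆ domain m D (w.scale lam) :=
    domain_mono D (Widths.scale_le_scale hw (by linarith))
  have hUw : U ⊆ domain m D w := hUlam.trans (domain_mono D (hscale1 hlam))
  set H : Phase n m → ℂ := fun z => h₀ z.yIJ with hH
  have hh' : ∀ z ∈ U, DifferentiableAt ℂ h₀ z.yIJ := fun z hz =>
    (hh _ (yIJ_mem_actionDomain (hUw hz))).differentiableAt
      ((isOpen_actionDomain D w).mem_nhds (yIJ_mem_actionDomain (hUw hz)))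
  have hyIJ : Differentiable ℂ (fun z : Phase n m => z.yIJ) := by
    unfold Phase.yIJ Phase.J Phase.y Phase.I Phase.p Phase.q
    fun_prop
  have hHd : DifferentiableOn ℂ H U := fun z hz =>
    (DifferentiableAt.comp z (hh' z hz) hyIJ.differentiableAt).differentiableWithinAt
  have hLH : ∀ z ∈ U, lieDeriv (hamField χ) H z = -ft z := fun z hz =>
    lieDeriv_yIJ_of_charVec (hh' z hz) (hω _ (yIJ_mem_actionDomain (hUw hz)))
      (hχ z (domain_mono D (Widths.scale_le_scale hw (by linarith)) hz))
  set P : Phase n m → ℂ := fun z => g z + fb z + ft z with hP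
  have hgd := hg.differentiableOn.mono hUlam
  have hfbd := hfb.differentiableOn.mono hUlam
  have hftd := hft.differentiableOn.mono hUlam
  have hPd : DifferentiableOn ℂ P U := (hgd.add hfbd).add hftd
  have hε0 : 0 ≤ ε := hfb.nonneg (hδl hlam0.le)
  have hεσ : ε / (lam - t) ≤ ε / σ := by
    apply div_le_div_of_nonneg_left hε0 hσ; linarith
  have hftL := (hft.hasGradient hw ht0.le (by linarith : t < lam)).le hw hεσ
  have hfbL := (hfb.hasGradient hw ht0.le (by linarith : t < lam)).le hw hεσ
  -- The gradient of g is a separate hypothesis, not a Cauchy estimate from its size G: with σ of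
  -- order 1/N the latter would cost a factor `N` in every step.
  have hPL : HasGradient D w t P (L + ε / σ + ε / σ) :=
    (hgL.add hw ht0.le hfbL hgd hfbd).add hw ht0.le hftL (hgd.add hfbd) hftd
  have hLP := hPL.lieDeriv hw ht0.le hχL
  have hLf := hftL.lieDeriv hw ht0.le hχL
  have hL0 := hgL.nonneg hw ht0.le
  -- Ratio of the Lie series. The smallness condition gives θ ≤ 1/8; with 1/2 the series sums to
  -- twice its first term.
  set θ := 3 * C * (M / σ / (η * w.d)) with hθ
  have hθ0 : 0 ≤ θ := by positivity
  have hθ2 : θ ≤ 1 / 2 := by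
    have : M / σ / (η * w.d) ≤ 1 / (24 * C) := by
      rw [div_div, div_le_div_iff₀ (by positivity) (by positivity)]
      linarith
    calc θ ≤ 3 * C * (1 / (24 * C)) := by rw [hθ]; gcongr
      _ = 1 / 8 := by field_simp; norm_num
      _ ≤ 1 / 2 := by norm_num
  set KP := C * ((L + ε / σ + ε / σ) * (M / σ) / w.d) with hKP
  set Kf := C * (ε / σ * (M / σ) / w.d) with hKf
  have hKP0 : 0 ≤ KP := by positivity
  have hKf0 : 0 ≤ Kf := by positivity
  have fac : ∀ (k i : ℕ) (F : Phase n m → ℂ) (K' : ℝ), 0 ≤ K' →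
      HasMajorant univ D (w.scale (t - η)) (fun z => ((k.factorial : ℂ))⁻¹ * F z) K' →
      HasMajorant univ D (w.scale (t - η)) (fun z => (((k + i).factorial : ℂ))⁻¹ * F z) K' := by
    intro k i F K' hK' h
    have h1 : (0 : ℝ) < (k + i).factorial := by exact_mod_cast Nat.factorial_pos _
    have h2 : (k.factorial : ℂ) ≠ 0 := by exact_mod_cast (Nat.factorial_pos _).ne'
    have h3 : (k.factorial : ℝ) ≤ (k + i).factorial := by
      exact_mod_cast Nat.factorial_le (Nat.le_add_right k i)
    refine ((h.const_mul ((k.factorial : ℂ) / ((k + i).factorial : ℂ))).congr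
      fun z _ => ?_).le ?_
    · field_simp
    · rw [norm_div, Complex.norm_natCast, Complex.norm_natCast]
      exact mul_le_of_le_one_left hK' ((div_le_one h1).2 h3)
  have hterm : ∀ k : ℕ, HasMajorant univ D (w.scale (t - η)) (fun z =>
      (((k + 1).factorial : ℂ))⁻¹ * (lieDeriv (hamField χ))^[k] (lieDeriv (hamField χ) P) z -
        (((k + 2).factorial : ℂ))⁻¹ * (lieDeriv (hamField χ))^[k] (lieDeriv (hamField χ) ft) z)
      ((KP + Kf) * (1 / 2) ^ k) := by
    intro k
    rw [add_mul]
    have hpow : θ ^ k ≤ (1 / 2) ^ k := by gcongr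
    refine HasMajorant.sub (hδl (by linarith)) (fac k 1 _ _ (by positivity) ?_)
      (fac k 2 _ _ (by positivity) ?_)
    · exact (HasMajorant.lieDeriv_iterate hw hη (by linarith) hLP hχL k).le (by gcongr)
    · exact (HasMajorant.lieDeriv_iterate hw hη (by linarith) hLf hχL k).le (by gcongr)
  have hVU : domain m D (w.scale (t - η)) ⊆ U :=
    domain_mono D (Widths.scale_le_scale hw (by linarith))
  have hV' : domain m D (w.scale (t - 2 * η)) ⊆ domain m D (w.scale (t - η)) :=
    domain_mono D (Widths.scale_le_scale hw (by linarith))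
  have hrem := fun z (hz : z ∈ domain m D (w.scale (t - η))) =>
    hasSum_lie_remainder hUo hLH (hVU hz) (hsum H hHd z hz) (hsum P hPd z hz)
  have hf' := HasMajorant.tsum (hδl (by linarith)) hterm
    (summable_geometric_two.mul_left _) hrem
  refine ⟨Φ, fun z => H (Φ z) + P (Φ z) - (H z + P z - ft z), hΦ, fun z hz => hdisp z (hV' hz),
    ((hf'.restrict (Widths.scale_le_scale hw (by linarith)) (hδl (by linarith))).le
      (le_of_eq ?_)), fun z _ => ?_⟩
  · rw [tsum_mul_left, tsum_geometric_two, hKP, hKf]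
    field_simp
    ring
  · simp only [hP, hH]
    ring

end Step

end NormalForm

namespace NormalForm

variable {n m : ℕ}

/-! ### The iteration. -/

section Iteration

open Set

variable {D : Base n} {w : Widths}

lemma symplDist_triangle (hw : w.Pos) (z₁ z₂ z₃ : Phase n m) :
    symplDist w z₁ z₃ ≤ symplDist w z₁ z₂ + symplDist w z₂ z₃ := by
  obtain ⟨hr, hρ, hξ, hs, hδ⟩ := hw
  have key : ∀ {k : ℕ} (a : ℝ) (u v x : Fin k → ℂ), 0 < a →
      a * euclNorm (u - x) ≤ a * euclNorm (u - v) + a * euclNorm (v - x) := by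
    intro k a u v x ha
    rw [← mul_add, ← sub_add_sub_cancel u v x]
    exact mul_le_mul_of_nonneg_left (euclNorm_add_le _ _) ha.le
  have key' : ∀ (a : ℝ) (u v x : ℂ), 0 < a →
      a * ‖u - x‖ ≤ a * ‖u - v‖ + a * ‖v - x‖ := by
    intro a u v x ha
    rw [← mul_add, ← sub_add_sub_cancel u v x]
    exact mul_le_mul_of_nonneg_left (norm_add_le _ _) ha.le
  simp only [symplDist]
  refine max_le ((key _ _ z₂.I _ hs).trans ?_) (max_le ((key _ _ z₂.φ _ hρ).trans ?_)
    (max_le ((key _ _ z₂.p _ hδ).trans ?_) (max_le ((key _ _ z₂.q _ hδ).trans ?_)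
      (max_le ((key' _ _ z₂.y _ hξ).trans ?_) ((key' _ _ z₂.x _ hr).trans ?_))))) <;>
    refine add_le_add ?_ ?_ <;> simp

lemma IsCanonical.comp {w₁ w₂ w₃ : Widths} {Φ Ψ : Phase n m → Phase n m}
    (hΦ : IsCanonical D w₁ w₂ Φ) (hΨ : IsCanonical D w₂ w₃ Ψ) : IsCanonical D w₁ w₃ (Ψ ∘ Φ) where
  holomorphic := hΨ.holomorphic.comp hΦ.holomorphic hΦ.mapsTo
  mapsTo := hΨ.mapsTo.comp hΦ.mapsTo
  injOn := hΨ.injOn.comp hΦ.injOn hΦ.mapsTo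
  symplectic := by
    intro z hz u v
    rw [fderiv_comp z ((hΨ.holomorphic _ (hΦ.mapsTo hz)).differentiableAt
      ((isOpen_domain D w₂).mem_nhds (hΦ.mapsTo hz)))
      ((hΦ.holomorphic z hz).differentiableAt ((isOpen_domain D w₁).mem_nhds hz))]
    exact (hΨ.symplectic _ (hΦ.mapsTo hz) _ _).trans (hΦ.symplectic z hz u v)
  periodic := by
    intro z hz l
    simp only [Function.comp_apply]
    rw [hΦ.periodic z hz l, hΨ.periodic _ (hΦ.mapsTo hz) l]

/-- A stage of the iteration: `Ψ` conjugates `h₀ + f₀` to `h₀ + a + g + f`. -/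
structure Stage (D : Base n) (w : Widths) (h₀ : ℂ × (Fin n → ℂ) × (Fin m → ℂ) → ℂ)
    (f₀ a : Phase n m → ℂ) (lam G L ε B : ℝ) (Ψ : Phase n m → Phase n m) (g f : Phase n m → ℂ) :
    Prop where
  canonical : IsCanonical D (w.scale lam) w Ψ
  disp : ∀ z ∈ domain m D (w.scale lam), symplDist w (Ψ z) z ≤ B
  resonant : HasMajorant resonant D (w.scale lam) g G
  gradient : HasGradient D w lam (fun z => a z + g z) L
  remainder : HasMajorant univ D (w.scale lam) f ε
  eq : ∀ z ∈ domain m D (w.scale lam),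
    h₀ (Ψ z).yIJ + f₀ (Ψ z) = h₀ z.yIJ + (a z + g z) + f z

variable {h₀ : ℂ × (Fin n → ℂ) × (Fin m → ℂ) → ℂ} {X κ : ℝ} {f₀ a : Phase n m → ℂ}

/-- The resonant part of the remainder joins g and the other part is removed by
`Unperturbed.exists_step` with σ = η = τ. Only the increment of g contributes to the gradient, by
ε/τ. -/
theorem Unperturbed.exists_next_stage (hu : Unperturbed D w h₀ X κ)
    {lam G L ε B τ A ε₀ : ℝ} {Ψ : Phase n m → Phase n m} {g f : Phase n m → ℂ}
    (st : Stage D w h₀ f₀ a lam G L ε B Ψ g f) (ha : HasMajorant resonant D w a ε₀)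
    (hA : HasMajorant univ D w (fun z : Phase n m => 1 / omegaY h₀ z.yIJ) A)
    (hlam : lam ≤ 1) (hτ : 0 < τ) (hlam' : κ + 3 * τ ≤ lam)
    (hsmall : 24 * (2 * (1 + n + m)) * (X * (A * ε)) ≤ τ * τ * w.d)
    (hcontr : 2 * (2 * (1 + n + m)) * (L + 3 * (ε / τ)) * (X * (A * ε)) / (τ * w.d) ≤ ε / 4) :
    ∃ (Ψ' : Phase n m → Phase n m) (g' f' : Phase n m → ℂ),
      Stage D w h₀ f₀ a (lam - κ - 3 * τ) (G + ε) (L + ε / τ) (ε / 4) (B + X * (A * ε) / τ)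
        Ψ' g' f' := by
  have hw := hu.pos
  have hκ := hu.κ_nonneg
  have hlam0 : 0 < lam := by linarith
  have hscale1 : (w.scale lam).Le w := by
    simpa [Widths.scale_one] using Widths.scale_le_scale hw hlam
  have hδl : ∀ {r : ℝ}, 0 ≤ r → 0 ≤ (w.scale r).δ := fun hr => Widths.scale_δ_nonneg hw hr
  obtain ⟨fb, ft, hfb, hft, hsplit⟩ := st.remainder.split (hδl hlam0.le) NormalForm.resonant
  have hag := (ha.restrict hscale1 (hδl hlam0.le)).add (hδl hlam0.le) st.resonant
  have hK : HasMajorant univ D (w.scale lam) (fun z => ft z / omegaY h₀ z.yIJ) (A * ε) := by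
    have := HasMajorant.mul (Widths.scale_s_nonneg hw hlam0.le) (hδl hlam0.le)
      (hA.restrict hscale1 (hδl hlam0.le)) hft.univ
    exact this.congr fun z _ => by ring
  obtain ⟨Φ, f', hΦ, hdisp, hf', heq⟩ := hu.exists_step (t := lam - κ - τ) hlam hτ hτ (by ring)
    (by linarith) hag (st.gradient.restrict hw (by linarith) (by linarith)) hfb hft hK hsmall
  have et : lam - κ - τ - 2 * τ = lam - κ - 3 * τ := by ring
  rw [et] at hΦ hdisp hf' heq
  have h0 : 0 ≤ lam - κ - 3 * τ := by linarith
  have hle : (w.scale (lam - κ - 3 * τ)).Le (w.scale lam) :=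
    Widths.scale_le_scale hw (by linarith)
  have hΦ' := hΦ.mono_target (Widths.scale_le_scale hw (by linarith : lam - κ - τ ≤ lam))
  have hε0 : 0 ≤ ε := hfb.nonneg (hδl hlam0.le)
  refine ⟨Ψ ∘ Φ, fun z => g z + fb z, f', hΦ'.comp st.canonical, fun z hz => ?_,
    (st.resonant.restrict hle (hδl h0)).add (hδl h0) (hfb.restrict hle (hδl h0)), ?_,
    hf'.le hcontr, fun z hz => ?_⟩
  · exact (symplDist_triangle hw _ (Φ z) _).trans
      (add_le_add (st.disp _ (hΦ'.mapsTo hz)) (hdisp z hz))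
  · have h1 := (hfb.hasGradient hw h0 (by linarith : lam - κ - 3 * τ < lam)).le hw
      (div_le_div_of_nonneg_left hε0 hτ (by linarith : τ ≤ lam - (lam - κ - 3 * τ)))
    have hsub := domain_mono (m := m) D hle
    have := (st.gradient.restrict hw h0 (by linarith)).add hw h0 h1
      (hag.differentiableOn.mono hsub) (hfb.differentiableOn.mono hsub)
    simpa only [add_assoc] using this
  · have h1 := st.eq _ (hΦ'.mapsTo hz)
    have h2 := heq z hz
    have h3 := hsplit _ (hΦ'.mapsTo hz)
    simp only [Function.comp_apply]
    rw [h1, h3]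
    linear_combination h2

/-- The first stage, where the averaging is applied with a width loss independent of `N`. -/
theorem Unperturbed.exists_first_stage (hu : Unperturbed D w h₀ X κ) {ε₀ K : ℝ}
    {b : Phase n m → ℂ} {S S' : Set (Idx n m)} (ha : HasMajorant resonant D w a ε₀)
    (hb : HasMajorant S D w b ε₀) (hab : ∀ z, f₀ z = a z + b z)
    (hK : HasMajorant S' D w (fun z => b z / omegaY h₀ z.yIJ) K) (hκ : κ ≤ 1 / 4)
    (hsmall : 24 * (2 * (1 + n + m)) * (X * K) ≤ 1 / 288 * w.d) :
    ∃ (Ψ : Phase n m → Phase n m) (f : Phase n m → ℂ),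
      Stage D w h₀ f₀ a (1 - κ - 1 / 3 - 1 / 48) 0 (3 * ε₀)
        (54 * (2 * (1 + n + m)) * ε₀ * (X * K) / w.d) (3 * (X * K)) Ψ (fun _ => 0) f := by
  have hw := hu.pos
  have hκ0 := hu.κ_nonneg
  have hd := d_pos hw
  have e1 : w.scale 1 = w := Widths.scale_one w
  have hδl : ∀ {r : ℝ}, 0 ≤ r → 0 ≤ (w.scale r).δ := fun hr => Widths.scale_δ_nonneg hw hr
  have hε0 : 0 ≤ ε₀ := ha.nonneg hw.2.2.2.2.le
  -- All of f₀ is treated as perturbation, with a as its resonant part and g = 0. The loss σ = 1/3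
  -- yields the displacement 3XK, and later the gradient 3ε₀ of a; the value η = 1/96 costs 1/48 of
  -- the widths.
  obtain ⟨Φ, f, hΦ, hdisp, hf, heq⟩ := hu.exists_step (lam := 1) (t := 1 - κ - 1 / 3)
    (σ := 1 / 3) (η := 1 / 96) (L := 0) (G := 0) (g := fun _ => 0) (S₁ := univ) le_rfl
    (by norm_num) (by norm_num) (by ring) (by linarith) (HasMajorant.zero le_rfl)
    (fun c => (HasMajorant.zero (M := 0 / width w c) (by simp)).congr fun z _ => by simp)
    (e1.symm ▸ ha) (e1.symm ▸ hb) (e1.symm ▸ hK) (by linarith)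
  have et : 1 - κ - 1 / 3 - 2 * (1 / 96) = 1 - κ - 1 / 3 - 1 / 48 := by norm_num [sub_sub]
  rw [et] at hΦ hdisp hf heq
  have hle1 : ∀ {r : ℝ}, r ≤ 1 → (w.scale r).Le w := fun {r} hr => by
    simpa [Widths.scale_one] using Widths.scale_le_scale hw hr
  refine ⟨Φ, f, hΦ.mono_target (hle1 (by linarith)), fun z hz => (hdisp z hz).trans (by linarith),
    HasMajorant.zero le_rfl, ?_, hf.le (le_of_eq ?_), fun z hz => ?_⟩
  · have h1 : HasMajorant NormalForm.resonant D (w.scale 1) a ε₀ := e1.symm ▸ ha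
    have h2 := (h1.hasGradient hw (by linarith : 0 ≤ 1 - κ - 1 / 3 - 1 / 48) (by linarith)).le hw
      (div_le_div_of_nonneg_left hε0 (by norm_num : (0 : ℝ) < 1 / 3)
        (by linarith : 1 / 3 ≤ 1 - (1 - κ - 1 / 3 - 1 / 48)))
    simp only [add_zero]
    exact h2.le hw (by linarith)
  · field_simp
    ring
  · have := heq z hz
    rw [hab]
    linear_combination this

set_option maxHeartbeats 1000000 in
/-- The normal form in terms of majorants. -/
theorem Unperturbed.exists_normalForm {N : ℕ} (hN : 1 ≤ N)
    (hu : Unperturbed D w h₀ X (1 / (4 * N))) {ε₀ K A : ℝ} {b : Phase n m → ℂ}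
    {S S' : Set (Idx n m)} (ha : HasMajorant resonant D w a ε₀)
    (hb : HasMajorant S D w b ε₀) (hab : ∀ z, f₀ z = a z + b z)
    (hK : HasMajorant S' D w (fun z => b z / omegaY h₀ z.yIJ) K)
    (hA : HasMajorant univ D w (fun z : Phase n m => 1 / omegaY h₀ z.yIJ) A)
    (hKA : K ≤ A * ε₀)
    (hsmall : 24000 * (2 * (1 + n + m)) * N * (X / w.d) * A * ε₀ ≤ 1) :
    ∃ (lam : ℝ) (Ψ : Phase n m → Phase n m) (g f : Phase n m → ℂ), 1 / 3 < lam ∧ lam ≤ 1 ∧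
      IsCanonical D (w.scale lam) w Ψ ∧
      (∀ z ∈ domain m D (w.scale lam), symplDist w (Ψ z) z ≤ 4 * (X * K)) ∧
      HasMajorant resonant D (w.scale lam) g (108 * (2 * (1 + n + m)) * (X * K / w.d) * ε₀) ∧
      HasMajorant univ D (w.scale lam) f (ε₀ / 4 ^ N) ∧
      ∀ z ∈ domain m D (w.scale lam),
        h₀ (Ψ z).yIJ + f₀ (Ψ z) = h₀ z.yIJ + (a z + g z) + f z := by
  have hw := hu.pos
  have hd := d_pos hw
  have hX0 := hu.X_nonneg
  have hN' : (1 : ℝ) ≤ N := by exact_mod_cast hN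
  have hN0 : (0 : ℝ) < N := by linarith
  have hδ0 := hw.2.2.2.2.le
  have hε0 : 0 ≤ ε₀ := ha.nonneg hδ0
  have hK0 : 0 ≤ K := hK.nonneg hδ0
  have hA0 : 0 ≤ A := hA.nonneg hδ0
  set C : ℝ := 2 * (1 + n + m) with hC
  have hC2 : 2 ≤ C := by
    have := Nat.cast_nonneg (α := ℝ) n
    have := Nat.cast_nonneg (α := ℝ) m
    rw [hC]; linarith
  have hC0 : 0 < C := by linarith
  -- With κ = 48τ a later step costs 51τ. The first step and N - 1 later ones leave the fraction 1 -
  -- 1/3 - 1/48 - 51/192 + 3τ = 73/192 + 3τ of the widths, which exceeds 1/3.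
  set τ : ℝ := 1 / (192 * N) with hτ
  have hτ0 : 0 < τ := by positivity
  have hτN : 192 * N * τ = 1 := by rw [hτ]; field_simp
  have hκτ : 1 / (4 * (N : ℝ)) = 48 * τ := by rw [hτ]; field_simp; norm_num
  rw [hκτ] at hu
  set q : ℝ := X / w.d * A * ε₀ with hq
  have hq0 : 0 ≤ q := by positivity
  -- The smallness hypothesis in the form used below; 24000 = 125 · 192.
  have hCq : 125 * C * q ≤ τ := by
    have : 24000 * C * N * q ≤ 1 := by rw [hq]; linarith
    have h2 : 24000 * C * N * q * τ ≤ 1 * τ := by gcongr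
    have h3 : 24000 * C * N * q * τ = 125 * C * q * (192 * N * τ) := by ring
    rw [h3, hτN] at h2
    linarith
  have hτ1 : τ ≤ 1 / 192 := by
    nlinarith
  set M := X * K with hM
  have hM0 : 0 ≤ M := by positivity
  have hMq : M / w.d ≤ q := by
    rw [hM, hq]
    calc X * K / w.d ≤ X * (A * ε₀) / w.d := by gcongr
      _ = X / w.d * A * ε₀ := by ring
  set ε₁ := 54 * C * ε₀ * M / w.d with hε₁
  have hε₁0 : 0 ≤ ε₁ := by positivity
  have hε₁q : ε₁ ≤ 54 * C * q * ε₀ := by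
    calc ε₁ = 54 * C * (M / w.d) * ε₀ := by rw [hε₁]; ring
      _ ≤ _ := by gcongr
  -- The gain q of the first stage compensates the factor 1/τ, so the later increments of g keep a
  -- gradient of order ε₀, uniformly in `N`.
  have hε₁τ : ε₁ / τ ≤ ε₀ / 2 := by
    rw [div_le_iff₀ hτ0]
    nlinarith
  have hε₁4 : ε₁ ≤ ε₀ / 4 := by
    nlinarith
  have hXAε : X * (A * ε₀) = q * w.d := by rw [hq]; field_simp
  have hXAε₁ : X * (A * ε₁) = 54 * C * q * M := by
    rw [hε₁, hq]; field_simp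
  have hMqd : M ≤ q * w.d := by
    rw [← hXAε]; exact mul_le_mul_of_nonneg_left hKA hX0
  clear_value C τ q ε₁ M
  -- The remainders ε₁/4^j with j < i add up to 4/3 of ε₁ - ε₁/4^i; the factor 2 leaves some room
  -- and telescopes in the induction.
  have key : ∀ i : ℕ, i + 1 ≤ N → ∃ (Ψ : Phase n m → Phase n m) (g f : Phase n m → ℂ),
      Stage D w h₀ f₀ a (1 - 48 * τ - 1 / 3 - 1 / 48 - i * (51 * τ)) (2 * (ε₁ - ε₁ / 4 ^ i))
        (3 * ε₀ + 2 * (ε₁ - ε₁ / 4 ^ i) / τ) (ε₁ / 4 ^ i)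
        (3 * M + 2 * (X * (A * (ε₁ - ε₁ / 4 ^ i))) / τ) Ψ g f := by
    intro i
    induction i with
    | zero =>
      intro _
      have h0 : 24 * C * M ≤ 1 / 288 * w.d := by
        have h2 : 24 * C * q ≤ 1 / 288 := by linarith [mul_nonneg hC0.le hq0]
        calc 24 * C * M ≤ 24 * C * (q * w.d) := by gcongr
          _ = 24 * C * q * w.d := by ring
          _ ≤ 1 / 288 * w.d := by gcongr
      obtain ⟨Ψ, f, h⟩ := hu.exists_first_stage ha hb hab hK (by linarith)
        (by rw [← hC, ← hM]; exact h0)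
      rw [← hC, ← hM, ← hε₁] at h
      refine ⟨Ψ, fun _ => 0, f, ?_⟩
      simpa only [pow_zero, div_one, sub_self, mul_zero, zero_div, add_zero, Nat.cast_zero,
        zero_mul, sub_zero] using h
    | succ i ih =>
      intro hi
      obtain ⟨Ψ, g, f, st⟩ := ih (by omega)
      set e := ε₁ / 4 ^ i with he
      have he0 : 0 ≤ e := by positivity
      have hee : e ≤ ε₁ := div_le_self hε₁0 (one_le_pow₀ (by norm_num))
      have hp : ε₁ / 4 ^ (i + 1) = e / 4 := by rw [he, pow_succ]; field_simp
      clear_value e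
      clear ih
      have hi' : (i : ℝ) + 1 + 1 ≤ N := by exact_mod_cast hi
      have hiτ : ((i : ℝ) + 1 + 1) * τ ≤ 1 / 192 := by nlinarith
      have hi0 := mul_nonneg (Nat.cast_nonneg (α := ℝ) i) hτ0.le
      have hXAe : X * (A * e) ≤ 54 * C * q * (q * w.d) := by
        calc X * (A * e) ≤ X * (A * ε₁) := by gcongr
          _ = 54 * C * q * M := hXAε₁
          _ ≤ 54 * C * q * (q * w.d) := by gcongr
      have hL : 3 * ε₀ + 2 * (ε₁ - e) / τ + 3 * (e / τ) ≤ 5 * ε₀ := by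
        have h1 : e / τ ≤ ε₁ / τ := by gcongr
        have h2 : 2 * (ε₁ - e) / τ = 2 * (ε₁ / τ) - 2 * (e / τ) := by ring
        rw [h2]; linarith
      -- The right side is of order 1/N². A condition linear in `N` suffices because after the first
      -- stage the left side is quadratic in q.
      have hs1 : 24 * C * (X * (A * e)) ≤ τ * τ * w.d := by
        have h1 : (125 * C * q) * (125 * C * q) ≤ τ * τ := by gcongr
        have h4 : 0 ≤ (125 * C * q) * (125 * C * q) := by positivity
        calc 24 * C * (X * (A * e)) ≤ 24 * C * (54 * C * q * (q * w.d)) := by gcongr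
          _ = 1296 / 15625 * ((125 * C * q) * (125 * C * q)) * w.d := by ring
          _ ≤ τ * τ * w.d := mul_le_mul_of_nonneg_right (by linarith) hd.le
      have hs2 : 2 * C * (3 * ε₀ + 2 * (ε₁ - e) / τ + 3 * (e / τ)) * (X * (A * e)) / (τ * w.d) ≤
          e / 4 := by
        rw [div_le_iff₀ (by positivity)]
        have h3 : 10 * C * q ≤ τ / 4 := by linarith [mul_nonneg hC0.le hq0]
        calc 2 * C * (3 * ε₀ + 2 * (ε₁ - e) / τ + 3 * (e / τ)) * (X * (A * e))
            ≤ 2 * C * (5 * ε₀) * (X * (A * e)) := by gcongr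
          _ = 10 * C * e * (X * (A * ε₀)) := by ring
          _ = 10 * C * q * (e * w.d) := by rw [hXAε]; ring
          _ ≤ τ / 4 * (e * w.d) := by gcongr
          _ = e / 4 * (τ * w.d) := by ring
      obtain ⟨Ψ', g', f', st'⟩ := hu.exists_next_stage st ha hA (by linarith) hτ0 (by linarith)
        (by rw [← hC]; exact hs1) (by rw [← hC]; exact hs2)
      refine ⟨Ψ', g', f', ?_⟩
      have elam : 1 - 48 * τ - 1 / 3 - 1 / 48 - i * (51 * τ) - 48 * τ - 3 * τ =
          1 - 48 * τ - 1 / 3 - 1 / 48 - ((i + 1 : ℕ) : ℝ) * (51 * τ) := by push_cast; ring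
      rw [elam] at st'
      rw [hp]
      refine ⟨st'.canonical, fun z hz => (st'.disp z hz).trans ?_, st'.resonant.le ?_,
        st'.gradient.le hw ?_, st'.remainder, st'.eq⟩
      · have : 0 ≤ X * (A * e) / τ := by positivity
        have e2 : 2 * (X * (A * (ε₁ - e / 4))) / τ =
          2 * (X * (A * (ε₁ - e))) / τ + 3 / 2 * (X * (A * e) / τ) := by ring
        rw [e2]; linarith
      · linarith
      · have : 0 ≤ e / τ := by positivity
        have e2 : 2 * (ε₁ - e / 4) / τ = 2 * (ε₁ - e) / τ + 3 / 2 * (e / τ) := by ring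
        rw [e2]; linarith
  -- N - 1 steps follow the first one, and ε₁ ≤ ε₀/4 supplies the missing factor of 4^N.
  obtain ⟨k, rfl⟩ : ∃ k, N = k + 1 := ⟨N - 1, by omega⟩
  obtain ⟨Ψ, g, f, st⟩ := key k le_rfl
  push_cast at hτN
  have he0 : 0 ≤ ε₁ / 4 ^ k := by positivity
  have hk0 := mul_nonneg (Nat.cast_nonneg (α := ℝ) k) hτ0.le
  refine ⟨_, Ψ, g, f, ?_, ?_, st.canonical, fun z hz => (st.disp z hz).trans ?_,
    st.resonant.le ?_, st.remainder.le ?_, st.eq⟩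
  · nlinarith
  · linarith
  · have h1 : 2 * (X * (A * (ε₁ - ε₁ / 4 ^ k))) / τ ≤ 2 * (X * (A * ε₁)) / τ := by
      gcongr
      linarith
    have h2 : 2 * (X * (A * ε₁)) / τ ≤ M := by
      rw [hXAε₁, div_le_iff₀ hτ0]
      nlinarith
    linarith
  · calc 2 * (ε₁ - ε₁ / 4 ^ k) ≤ 2 * ε₁ := by linarith
      _ = _ := by rw [hε₁]; ring
  · rw [pow_succ, ← div_div, div_right_comm]
    gcongr

end Iteration

end NormalForm

namespace NormalForm

variable {n m : ℕ}

/-! ### Consequences of the hypotheses of the theorem. -/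

section Setting

open Set

variable {D : Base n} {w : Widths}

lemma relDist_le_symplDist (hw : w.Pos) (z z' : Phase n m) :
    w.d * relDist w z z' ≤ symplDist w z z' := by
  have hd := (d_pos hw).le
  obtain ⟨hr, hρ, hξ, hs, hδ⟩ := hw
  have h1 : w.d ≤ w.ρ * w.s := min_le_left _ _
  have h2 : w.d ≤ w.r * w.ξ := (min_le_right _ _).trans (min_le_left _ _)
  have h3 : w.d ≤ w.δ ^ 2 := (min_le_right _ _).trans (min_le_right _ _)
  have key : ∀ a b c : ℝ, 0 < a → 0 ≤ c → w.d ≤ a * b → w.d * (c / a) ≤ b * c := by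
    intro a b c ha hc h
    rw [mul_div_assoc', div_le_iff₀ ha]
    nlinarith
  simp only [relDist, symplDist, mul_max_of_nonneg _ _ hd]
  refine max_le_max (key _ _ _ hρ (euclNorm_nonneg _) h1) (max_le_max
    (key _ _ _ hs (euclNorm_nonneg _) (by linarith)) (max_le_max
    (key _ _ _ hδ (euclNorm_nonneg _) (by linarith)) (max_le_max
    (key _ _ _ hδ (euclNorm_nonneg _) (by linarith)) (max_le_max
    (key _ _ _ hr (norm_nonneg _) h2) (key _ _ _ hξ (norm_nonneg _) (by linarith))))))

lemma supX_ne_top (hΞ : Bornology.IsBounded D.Ξ) : supX D w ≠ ⊤ := by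
  obtain ⟨R, hR⟩ := hΞ.exists_norm_le
  refine ne_top_of_le_ne_top (b := ENNReal.ofReal (R + w.ξ)) ENNReal.ofReal_ne_top ?_
  refine iSup₂_le fun x hx => ?_
  obtain ⟨a, ha, hxa⟩ := hx
  rw [← ofReal_norm]
  refine ENNReal.ofReal_le_ofReal ?_
  have h1 := hR a ha
  have h2 : ‖x‖ ≤ ‖x - (a : ℂ)‖ + ‖(a : ℂ)‖ := by simpa using norm_add_le (x - (a : ℂ)) a
  rw [Complex.norm_real] at h2
  linarith

lemma norm_le_supX (hΞ : Bornology.IsBounded D.Ξ) {x : ℂ} (hx : x ∈ nhd₁ D.Ξ w.ξ) :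
    ‖x‖ ≤ (supX D w).toReal := by
  have h : ‖x‖ₑ ≤ supX D w := le_iSup₂ (f := fun (x : ℂ) (_ : x ∈ nhd₁ D.Ξ w.ξ) => ‖x‖ₑ) x hx
  have := ENNReal.toReal_mono (supX_ne_top hΞ) h
  simpa using this

/-- The points a ± t with t < ξ lie in Ξ_ξ; the sign is chosen so as to move away from 0, and t
tends to ξ. -/
lemma abs_add_le_supX (hw : w.Pos) (hΞ : Bornology.IsBounded D.Ξ) {a : ℝ} (ha : a ∈ D.Ξ) :
    |a| + w.ξ ≤ (supX D w).toReal := by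
  have hξ := hw.2.2.1
  refine le_of_forall_lt_imp_le_of_dense fun c hc => ?_
  set t := max 0 (c - |a|) with ht
  have ht0 : 0 ≤ t := le_max_left _ _
  have htξ : t < w.ξ := max_lt hξ (by linarith)
  have hct : c ≤ |a| + t := by linarith [le_max_right 0 (c - |a|)]
  have key : ∀ e : ℝ, |e| = t → |a + e| ≤ (supX D w).toReal := by
    intro e he
    have := norm_le_supX (w := w) hΞ (x := ((a + e : ℝ) : ℂ)) ⟨a, ha, by
      rw [← Complex.ofReal_sub, Complex.norm_real, add_sub_cancel_left, Real.norm_eq_abs, he]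
      exact htξ⟩
    rwa [Complex.norm_real, Real.norm_eq_abs] at this
  refine hct.trans ?_
  rcases le_total 0 a with h | h
  · have := key t (abs_of_nonneg ht0)
    rwa [abs_of_nonneg (by linarith), ← abs_of_nonneg h] at this
  · have := key (-t) (by rw [abs_neg, abs_of_nonneg ht0])
    rw [abs_of_nonpos (by linarith)] at this
    rw [abs_of_nonpos h]
    linarith

/-- The midpoint of `Ξ` is a centre from which `Ξ_ξ` has radius at most `𝒳`. -/
lemma exists_center (hw : w.Pos) (hc : IsConnected D.Ξ) (hΞ : Bornology.IsBounded D.Ξ) :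
    ∃ x₀ ∈ D.Ξ, ∀ x ∈ nhd₁ D.Ξ w.ξ, ‖x - (x₀ : ℂ)‖ ≤ (supX D w).toReal := by
  set X := (supX D w).toReal with hX
  have hb := hΞ.bddBelow
  have ha := hΞ.bddAbove
  set i := sInf D.Ξ with hi
  set S := sSup D.Ξ with hS
  have hbd : ∀ a ∈ D.Ξ, i ≤ a ∧ a ≤ S := fun a h => ⟨csInf_le hb h, le_csSup ha h⟩
  -- Ξ is contained in [-(𝒳 - ξ), 𝒳 - ξ], so it lies within 𝒳 - ξ of its midpoint and Ξ_ξ within 𝒳.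
  -- An arbitrary x₀ would give only a multiple of 𝒳.
  have hi' : -(X - w.ξ) ≤ i := le_csInf hc.nonempty fun a h => by
    linarith [abs_add_le_supX hw hΞ h, neg_abs_le a]
  have hS' : S ≤ X - w.ξ := csSup_le hc.nonempty fun a h => by
    linarith [abs_add_le_supX hw hΞ h, le_abs_self a]
  obtain ⟨a₀, ha₀⟩ := hc.nonempty
  have h0 := hbd a₀ ha₀
  refine ⟨(i + S) / 2, ?_, fun x hx => ?_⟩
  -- Connectedness puts the midpoint in Ξ when it lies strictly between infimum and supremum; the
  -- other case is a single point.
  · rcases (h0.1.trans h0.2).eq_or_lt with h | h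
    · have : (i + S) / 2 = a₀ := by linarith
      rwa [this]
    · exact hc.Ioo_csInf_csSup_subset hb ha ⟨by linarith, by linarith⟩
  · obtain ⟨a, haΞ, hxa⟩ := hx
    have h1 := hbd a haΞ
    have h2 : ‖(a : ℂ) - (((i + S) / 2 : ℝ) : ℂ)‖ ≤ X - w.ξ := by
      rw [← Complex.ofReal_sub, Complex.norm_real, Real.norm_eq_abs, abs_le]
      constructor <;> linarith
    linarith [norm_sub_le_norm_sub_add_norm_sub x (a : ℂ) (((i + S) / 2 : ℝ) : ℂ)]

lemma domain_nonempty (hw : w.Pos) (h1 : D.Υ.Nonempty) (h2 : D.𝓘.Nonempty) (h3 : D.Ξ.Nonempty) :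
    (domain m D w).Nonempty := by
  obtain ⟨hr, hρ, hξ, hs, hδ⟩ := hw
  obtain ⟨y, hy⟩ := h1
  obtain ⟨I, hI⟩ := h2
  obtain ⟨x, hx⟩ := h3
  refine ⟨((y, fun i => I i, 0), (x, 0, 0)), ⟨⟨y, hy, ?_⟩, ⟨I, hI, ?_⟩, ⟨x, hx, ?_⟩⟩, ?_, ?_, ?_⟩
  · simpa [Phase.yIx, Phase.y] using hr
  · simpa [Phase.yIx, Phase.I, euclNorm] using hρ
  · simpa [Phase.yIx, Phase.x] using hξ
  · simpa [Phase.φ] using fun _ => hs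
  · simpa [Phase.p] using fun _ => hδ
  · simpa [Phase.q] using fun _ => hδ

lemma HasMajorant.classO {S : Set (Idx n m)} {w' : Widths} (hlt : w.Lt w') {F : Phase n m → ℂ}
    {M : ℝ} (h : HasMajorant S D w' F M) : ClassO D w F :=
  ⟨w', hlt, h.differentiableOn, fun _ hz l => h.shift hz l⟩

lemma HasMajorant.classN (hw : w.Pos) {w' : Widths} (hlt : w.Lt w') {F : Phase n m → ℂ}
    {M : ℝ} (h : HasMajorant resonant D w' F M) : ClassN D w F := by
  refine ⟨h.classO hlt, fun z hz => ?_⟩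
  rw [average, (h.restrict hlt.le hw.2.2.2.2.le).offAverage_eq_zero hw hz, sub_zero]

lemma IsCanonical.classO_comp {w₁ w₂ w₃ : Widths} {Ψ : Phase n m → Phase n m}
    (hΨ : IsCanonical D w₂ w₃ Ψ) (hlt : w₁.Lt w₂) {F : Phase n m → ℂ} (hF : ClassO D w₃ F) :
    ClassO D w₁ (F ∘ Ψ) := by
  obtain ⟨w', hw', hd, hper⟩ := hF
  have hmaps : MapsTo Ψ (domain m D w₂) (domain m D w') :=
    hΨ.mapsTo.mono_right (domain_mono D hw'.le)
  refine ⟨w₂, hlt, hd.comp hΨ.holomorphic hmaps, fun z hz l => ?_⟩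
  simp only [Function.comp_apply]
  rw [hΨ.periodic z hz l, hper _ (hmaps hz) l]

lemma Widths.third_pos (hw : w.Pos) : w.third.Pos := by
  obtain ⟨hr, hρ, hξ, hs, hδ⟩ := hw
  exact ⟨by simpa [third] using hr, by simpa [third] using hρ, by simpa [third] using hξ,
    by simpa [third] using hs, by simpa [third] using hδ⟩

lemma Widths.third_lt_scale (hw : w.Pos) {t : ℝ} (ht : 1 / 3 < t) : w.third.Lt (w.scale t) := by
  rw [third_eq_scale]
  exact scale_lt_scale hw ht

lemma isCanonical_id (w : Widths) : IsCanonical D w w (id : Phase n m → Phase n m) where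
  holomorphic := differentiableOn_id
  mapsTo := fun _ hz => hz
  injOn := Function.injective_id.injOn
  symplectic := by simp
  periodic := fun _ _ _ => rfl

variable {h₀ : ℂ × (Fin n → ℂ) × (Fin m → ℂ) → ℂ}

lemma differentiable_yIJ : Differentiable ℂ (fun z : Phase n m => z.yIJ) := by
  unfold Phase.yIJ Phase.J Phase.y Phase.I Phase.p Phase.q
  fun_prop

lemma HolomorphicAction.differentiableOn (hw : w.Pos) (h : HolomorphicAction D w h₀) :
    DifferentiableOn ℂ h₀ (actionDomain m D w) := by
  obtain ⟨w', hlt, hd⟩ := h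
  refine hd.mono fun u hu => ?_
  have hle := hlt.le
  refine ⟨nhd₁_mono _ hle.1 hu.1, ?_, fun i => (hu.2.2 i).trans_le ?_⟩
  · obtain ⟨a, ha, h⟩ := hu.2.1
    exact ⟨a, ha, h.trans_le hle.2.1⟩
  · exact pow_le_pow_left₀ hw.2.2.2.2.le hle.2.2.2.2 2

lemma differentiableOn_frequencies (hd : DifferentiableOn ℂ h₀ (actionDomain m D w)) :
    DifferentiableOn ℂ (fun z : Phase n m => omegaY h₀ z.yIJ) (domain m D w) ∧
    (∀ i, DifferentiableOn ℂ (fun z : Phase n m => omegaI h₀ i z.yIJ) (domain m D w)) ∧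
    ∀ i, DifferentiableOn ℂ (fun z : Phase n m => omegaJ h₀ i z.yIJ) (domain m D w) := by
  have ho := isOpen_actionDomain (m := m) D w
  have hat : ∀ u ∈ actionDomain m D w, DifferentiableAt ℂ h₀ u := fun u hu =>
    (hd u hu).differentiableAt (ho.mem_nhds hu)
  have key : ∀ c : Half n m, DifferentiableOn ℂ
      (fun z : Phase n m => fderiv ℂ h₀ z.yIJ (halfVec c)) (domain m D w) := fun c =>
    (DifferentiableOn.fderiv_apply ho hd (halfVec c)).comp differentiable_yIJ.differentiableOn
      fun z hz => yIJ_mem_actionDomain hz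
  exact ⟨(key _).congr fun z hz => omegaY_eq (hat _ (yIJ_mem_actionDomain hz)),
    fun i => (key _).congr fun z hz => omegaI_eq (hat _ (yIJ_mem_actionDomain hz)) i,
    fun i => (key _).congr fun z hz => omegaJ_eq (hat _ (yIJ_mem_actionDomain hz)) i⟩

lemma differentiableOn_div {E : Type*} [NormedAddCommGroup E] [NormedSpace ℂ E] {F G : E → ℂ}
    {U : Set E} (hF : DifferentiableOn ℂ F U) (hG : DifferentiableOn ℂ G U)
    (h0 : ∀ z ∈ U, G z ≠ 0) : DifferentiableOn ℂ (fun z => F z / G z) U := by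
  simp only [div_eq_mul_inv]
  exact hF.mul (hG.inv h0)

/-- Majorants from the bound of a finite family of norms. -/
lemma exists_majorant_of_iSup_lt (hw : w.Pos) {ι : Type*} {F : ι → Phase n m → ℂ}
    (hF : ∀ i, DifferentiableOn ℂ (F i) (domain m D w)) {N : ℕ} (hN : 1 ≤ N) {Y : ℝ≥0∞}
    (hY0 : Y ≠ 0) {s : ℝ}
    (h : 4 * (N : ℝ≥0∞) * Y * (⨆ i, norm D w (F i)) < ENNReal.ofReal s) :
    ∃ α, Y.toReal * α ≤ 1 / (4 * N) * s ∧ ∀ i, HasMajorant univ D w (F i) α := by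
  have hN0 : (N : ℝ≥0∞) ≠ 0 := by exact_mod_cast (by omega : N ≠ 0)
  -- Finiteness is read off the inequality, which requires the other factors to be nonzero, as 0 · ⊤
  -- = 0.
  have htop : (⨆ i, norm D w (F i)) ≠ ⊤ := by
    intro ht
    rw [ht, ENNReal.mul_top (by simp [hN0, hY0])] at h
    exact not_top_lt h
  refine ⟨(⨆ i, norm D w (F i)).toReal, ?_, fun i => ?_⟩
  · have h1 := ENNReal.toReal_mono ENNReal.ofReal_ne_top h.le
    have hs : 0 ≤ s := by
      by_contra hs
      rw [ENNReal.ofReal_of_nonpos (not_le.1 hs).le] at h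
      exact not_lt_zero h
    rw [ENNReal.toReal_ofReal hs, ENNReal.toReal_mul, ENNReal.toReal_mul, ENNReal.toReal_mul] at h1
    simp only [ENNReal.toReal_ofNat, ENNReal.toReal_natCast] at h1
    have : (0 : ℝ) < N := by exact_mod_cast (by omega : 0 < N)
    rw [one_div, ← div_eq_inv_mul, le_div_iff₀ (by positivity)]
    linarith
  · have hle : norm D w (F i) ≤ ⨆ i, norm D w (F i) := le_iSup (fun i => norm D w (F i)) i
    exact (hasMajorant_norm hw (hF i) (ne_top_of_le_ne_top htop hle)).le
      (ENNReal.toReal_mono htop hle)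

/-- The trivial case of a vanishing perturbation. -/
lemma offAverage_eq_zero_of_norm_eq_zero (hw : w.Pos) {f₀ : Phase n m → ℂ}
    (hf : DifferentiableOn ℂ f₀ (domain m D w)) (h0 : norm D w f₀ = 0) {z : Phase n m}
    (hz : z ∈ domain m D w) : offAverage D w f₀ z = 0 := by
  have := (hasMajorant_offAverage hw hf (by simp [h0])).norm_le hz
  simpa [h0] using this

/-- The norm of `f̃ / ω_y` does not exceed that of `f / ω_y`. -/
lemma norm_offAverage_div_le (hw : w.Pos) {f₀ : Phase n m → ℂ}
    {W : ℂ × (Fin n → ℂ) × (Fin m → ℂ) → ℂ} {A ε : ℝ} (hf : HasMajorant univ D w f₀ ε)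
    (hA : HasMajorant univ D w (fun z : Phase n m => 1 / W z.yIJ) A) :
    norm D w (fun z => offAverage D w f₀ z / W z.yIJ) ≤ norm D w (fun z => f₀ z / W z.yIJ) := by
  have hprod := HasMajorant.mul hw.2.2.2.1.le hw.2.2.2.2.le hf hA
  have e : (fun z => f₀ z / W z.yIJ) = fun z : Phase n m => f₀ z * (1 / W z.yIJ) :=
    funext fun z => div_eq_mul_one_div _ _
  rw [e]
  have hfin := ne_top_of_le_ne_top ENNReal.ofReal_ne_top (hprod.norm_le_ofReal hw)
  have h1 := hasMajorant_offAverage hw hprod.differentiableOn hfin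
  -- Division by a function of y, I, J commutes with the off-average, and the off-average of a
  -- function has no larger norm than the function.
  have h2 := (h1.congr (G := fun z => offAverage D w f₀ z / W z.yIJ) fun z hz => by
    rw [offAverage_mul_of_invariant hf.exists_isExpansion hprod.exists_isExpansion
      (fun θ z => by rw [yIJ_resRot]) hz, div_eq_mul_one_div]).norm_le_ofReal hw
  rwa [ENNReal.ofReal_toReal hfin] at h2

lemma norm_zero_fun (hw : w.Pos) : norm D w (fun _ : Phase n m => 0) = 0 := by
  have h := (HasMajorant.zero (n := n) (m := m) (S := univ) (D := D) (w := w) le_rfl).norm_le_ofReal hw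
  simpa using h

end Setting

end NormalForm

end

/-- The content is in `Unperturbed.exists_normalForm`. What is left is to deduce from the
inequalities in [0, ∞] that the norms are finite, and to carry the estimates back. -/
theorem lemma2p1 (n m : ℕ) :
    ∃ c : ℝ, 1 ≤ c ∧
      ∀ (D : NormalForm.Base n) (w : NormalForm.Widths)
        (h₀ : ℂ × (Fin n → ℂ) × (Fin m → ℂ) → ℂ) (f₀ : NormalForm.Phase n m → ℂ) (N : ℕ),
        D.Υ.Nonempty → Bornology.IsBounded D.Υ →
        D.𝓘.Nonempty → Bornology.IsBounded D.𝓘 →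
        IsConnected D.Ξ → Bornology.IsBounded D.Ξ →
        w.Pos →
        NormalForm.HolomorphicAction D w h₀ →
        NormalForm.ClassO D w f₀ →
        (∀ u ∈ NormalForm.actionDomain m D w, NormalForm.omegaY h₀ u ≠ 0) →
        1 ≤ N →
        4 * (N : ℝ≥0∞) * NormalForm.supX D w *
            (⨆ i : Fin n, NormalForm.norm D w (fun z : NormalForm.Phase n m =>
              NormalForm.omegaI h₀ i z.yIJ / NormalForm.omegaY h₀ z.yIJ)) <
          ENNReal.ofReal w.s →
        4 * (N : ℝ≥0∞) * NormalForm.supX D w *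
            (⨆ i : Fin m, NormalForm.norm D w (fun z : NormalForm.Phase n m =>
              NormalForm.omegaJ h₀ i z.yIJ / NormalForm.omegaY h₀ z.yIJ)) < 1 →
        ENNReal.ofReal c * (N : ℝ≥0∞) * (NormalForm.supX D w / ENNReal.ofReal w.d) *
            NormalForm.norm D w
              (fun z : NormalForm.Phase n m => 1 / NormalForm.omegaY h₀ z.yIJ) *
            NormalForm.norm D w f₀ < 1 →
        ∃ (w' : NormalForm.Widths) (Ψ : NormalForm.Phase n m → NormalForm.Phase n m)
          (g f : NormalForm.Phase n m → ℂ),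
          w.third.Lt w' ∧
          NormalForm.IsCanonical D w' w Ψ ∧
          (∀ F : NormalForm.Phase n m → ℂ, NormalForm.ClassO D w F →
            NormalForm.ClassO D w.third (F ∘ Ψ)) ∧
          NormalForm.ClassN D w.third g ∧
          NormalForm.ClassO D w.third f ∧
          (∀ z ∈ NormalForm.domain m D w.third,
            h₀ (Ψ z).yIJ + f₀ (Ψ z) =
              h₀ z.yIJ + NormalForm.average D w f₀ z + g z + f z) ∧
          NormalForm.norm D w.third g ≤
            ENNReal.ofReal c * (NormalForm.supX D w / ENNReal.ofReal w.d) *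
              NormalForm.norm D w (fun z : NormalForm.Phase n m =>
                NormalForm.offAverage D w f₀ z / NormalForm.omegaY h₀ z.yIJ) *
              NormalForm.norm D w f₀ ∧
          NormalForm.norm D w.third f ≤ (1 / 2 ^ (N + 1)) * NormalForm.norm D w f₀ ∧
          (∀ z ∈ NormalForm.domain m D w.third,
            w.d * NormalForm.relDist w (Ψ z) z ≤ NormalForm.symplDist w (Ψ z) z ∧
            ENNReal.ofReal (NormalForm.symplDist w (Ψ z) z) ≤
              4 * NormalForm.supX D w *
                NormalForm.norm D w (fun z : NormalForm.Phase n m =>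
                  f₀ z / NormalForm.omegaY h₀ z.yIJ)) := by
  set C : ℝ := 2 * (1 + n + m) with hC
  have hC2 : 2 ≤ C := by
    have := Nat.cast_nonneg (α := ℝ) n
    have := Nat.cast_nonneg (α := ℝ) m
    rw [hC]; linarith
  -- The constant is dictated by the smallness condition; it exceeds by far the factor 108 C of the
  -- bound for g.
  refine ⟨24000 * C, by linarith, ?_⟩
  intro D w h₀ f₀ N hΥ _ hI _ hΞc hΞb hw hh hf₀ hω hN hαI hβJ hsmall
  have hth := NormalForm.Widths.third_pos hw
  have hd := NormalForm.d_pos hw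
  have hd' := hh.differentiableOn hw
  obtain ⟨wf, hwf, hfd, -⟩ := id hf₀
  have hfd : DifferentiableOn ℂ f₀ (NormalForm.domain m D w) :=
    hfd.mono (NormalForm.domain_mono D hwf.le)
  -- If ‖f₀‖ = 0 the smallness condition holds even when ‖1/ω_y‖ is infinite, because 0 · ⊤ = 0.
  -- This case is settled by the identity.
  by_cases hf0 : NormalForm.norm D w f₀ = 0
  · have hlt : w.third.Lt w := by
      simpa [NormalForm.Widths.scale_one] using
        NormalForm.Widths.third_lt_scale hw (by norm_num : (1 : ℝ) / 3 < 1)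
    have hcan := NormalForm.isCanonical_id (n := n) (m := m) (D := D) w
    have hzero : NormalForm.HasMajorant (n := n) (m := m) NormalForm.resonant D w (fun _ => 0) 0 :=
      NormalForm.HasMajorant.zero le_rfl
    refine ⟨w, id, fun _ => 0, fun _ => 0, hlt, hcan, fun F hF => hcan.classO_comp hlt hF,
      hzero.classN hth hlt, hzero.classO hlt, fun z hz => ?_, ?_, ?_, fun z hz =>
        ⟨NormalForm.relDist_le_symplDist hw _ _, ?_⟩⟩
    · simp [NormalForm.average, NormalForm.offAverage_eq_zero_of_norm_eq_zero hw hfd hf0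
        (NormalForm.domain_mono D hlt.le hz)]
    · rw [NormalForm.norm_zero_fun hth]; exact zero_le
    · rw [NormalForm.norm_zero_fun hth]; exact zero_le
    · simp [NormalForm.symplDist, NormalForm.euclNorm]
  set Y := NormalForm.supX D w with hY
  have hYtop : Y ≠ ⊤ := NormalForm.supX_ne_top hΞb
  have hX0 : 0 < Y.toReal := by
    obtain ⟨a, ha⟩ := hΞc.nonempty
    linarith [NormalForm.abs_add_le_supX hw hΞb ha, abs_nonneg a, hw.2.2.1]
  have hY0 : Y ≠ 0 := fun h => by rw [h] at hX0; simp at hX0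
  have hdω : ∀ z ∈ NormalForm.domain m D w, NormalForm.omegaY h₀ z.yIJ ≠ 0 := fun z hz =>
    hω _ (NormalForm.yIJ_mem_actionDomain hz)
  obtain ⟨hdy, hdI, hdJ⟩ := NormalForm.differentiableOn_frequencies hd'
  have hN0 : (N : ℝ≥0∞) ≠ 0 := by exact_mod_cast (by omega : N ≠ 0)
  set A' := NormalForm.norm D w
    (fun z : NormalForm.Phase n m => 1 / NormalForm.omegaY h₀ z.yIJ) with hA'
  have hd1 : DifferentiableOn ℂ (fun z : NormalForm.Phase n m => 1 / NormalForm.omegaY h₀ z.yIJ)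
      (NormalForm.domain m D w) :=
    NormalForm.differentiableOn_div (differentiableOn_const 1) hdy hdω
  have hc0 : ENNReal.ofReal (24000 * C) ≠ 0 := by
    simp only [ne_eq, ENNReal.ofReal_eq_zero, not_le]; linarith
  have hYd0 : Y / ENNReal.ofReal w.d ≠ 0 := ENNReal.div_ne_zero.2 ⟨hY0, ENNReal.ofReal_ne_top⟩
  have hpre : ENNReal.ofReal (24000 * C) * (N : ℝ≥0∞) * (Y / ENNReal.ofReal w.d) ≠ 0 :=
    mul_ne_zero (mul_ne_zero hc0 hN0) hYd0
  have hA'top : A' ≠ ⊤ := by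
    intro h
    rw [h, ENNReal.mul_top hpre, ENNReal.top_mul hf0] at hsmall
    exact not_top_lt hsmall
  have hA := NormalForm.hasMajorant_norm hw hd1 hA'top
  -- Needed to infer that ‖f₀‖ is finite; a function that vanishes at no point of a nonempty domain
  -- has nonzero norm.
  have hA'0 : A' ≠ 0 := by
    intro h
    obtain ⟨z, hz⟩ := NormalForm.domain_nonempty (m := m) hw hΥ hI hΞc.nonempty
    have := hA.norm_le hz
    rw [← hA', h] at this
    simp at this
    exact hdω z hz this
  have hftop : NormalForm.norm D w f₀ ≠ ⊤ := by
    intro h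
    rw [h, ENNReal.mul_top (mul_ne_zero hpre hA'0)] at hsmall
    exact not_top_lt hsmall
  have hav := NormalForm.hasMajorant_average hw hfd hftop
  have hoff := NormalForm.hasMajorant_offAverage hw hfd hftop
  have hf := NormalForm.hasMajorant_norm hw hfd hftop
  have hprod : NormalForm.HasMajorant Set.univ D w (fun z : NormalForm.Phase n m =>
      NormalForm.offAverage D w f₀ z / NormalForm.omegaY h₀ z.yIJ)
      (A'.toReal * (NormalForm.norm D w f₀).toReal) :=
    (NormalForm.HasMajorant.mul hw.2.2.2.1.le hw.2.2.2.2.le hA hoff.univ).congr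
      fun z _ => by ring
  set K' := NormalForm.norm D w (fun z : NormalForm.Phase n m =>
    NormalForm.offAverage D w f₀ z / NormalForm.omegaY h₀ z.yIJ) with hK'
  have hK'le : K' ≤ ENNReal.ofReal (A'.toReal * (NormalForm.norm D w f₀).toReal) :=
    hprod.norm_le_ofReal hw
  have hK'top : K' ≠ ⊤ := ne_top_of_le_ne_top ENNReal.ofReal_ne_top hK'le
  have hK := NormalForm.hasMajorant_norm hw hprod.differentiableOn hK'top
  have hu : NormalForm.Unperturbed D w h₀ Y.toReal (1 / (4 * N)) :=
    { pos := hw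
      diff := hd'
      omega_ne := hω
      convex := hΞc.isPreconnected.ordConnected.convex
      center := NormalForm.exists_center hw hΞc hΞb
      X_nonneg := hX0.le
      κ_nonneg := by positivity
      slope_I := NormalForm.exists_majorant_of_iSup_lt hw
          (fun i => NormalForm.differentiableOn_div (hdI i) hdy hdω) hN hY0 hαI
      slope_J := by
        have := NormalForm.exists_majorant_of_iSup_lt hw
          (fun i => NormalForm.differentiableOn_div (hdJ i) hdy hdω) hN hY0
          (s := 1) (by simpa using hβJ)
        simpa using this }
  set E' := NormalForm.norm D w f₀ with hE'
  have hreal : 24000 * C * N * (Y.toReal / w.d) * A'.toReal * E'.toReal ≤ 1 := by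
    have := ENNReal.toReal_mono ENNReal.one_ne_top hsmall.le
    simpa [ENNReal.toReal_mul, ENNReal.toReal_div, hd.le,
      ENNReal.toReal_ofReal (by linarith : 0 ≤ C)] using this
  obtain ⟨lam, Ψ, g, f, hlam, hlam1, hcan, hdisp, hg, hfm, heq⟩ := hu.exists_normalForm hN hav hoff
    (f₀ := f₀) (fun z => by simp [NormalForm.average]) hK hA
    (by
      have := ENNReal.toReal_mono ENNReal.ofReal_ne_top hK'le
      rwa [ENNReal.toReal_ofReal (by positivity)] at this) hreal
  have hlt := NormalForm.Widths.third_lt_scale hw hlam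
  have hsub := NormalForm.domain_mono (m := m) D hlt.le
  refine ⟨w.scale lam, Ψ, g, f, hlt, hcan, fun F hF => hcan.classO_comp hlt hF,
    hg.classN hth hlt, hfm.classO hlt, fun z hz => ?_, ?_, ?_, fun z hz =>
      ⟨NormalForm.relDist_le_symplDist hw _ _, ?_⟩⟩
  · rw [heq z (hsub hz)]
    ring
  · refine ((hg.restrict hlt.le hth.2.2.2.2.le).norm_le_ofReal hth).trans ?_
    have hrhs : ENNReal.ofReal (24000 * C) * (Y / ENNReal.ofReal w.d) * K' * E' =
        ENNReal.ofReal (24000 * C * (Y.toReal / w.d) * K'.toReal * E'.toReal) := by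
      conv_rhs =>
        rw [ENNReal.ofReal_mul (by positivity), ENNReal.ofReal_mul (by positivity),
          ENNReal.ofReal_mul (by positivity), ENNReal.ofReal_div_of_pos hd,
          ENNReal.ofReal_toReal hYtop, ENNReal.ofReal_toReal hK'top, ENNReal.ofReal_toReal hftop]
    rw [hrhs]
    refine ENNReal.ofReal_le_ofReal ?_
    have h0 : 0 ≤ C * (Y.toReal / w.d) * K'.toReal * E'.toReal := by positivity
    calc 108 * C * (Y.toReal * K'.toReal / w.d) * E'.toReal
        = 108 * (C * (Y.toReal / w.d) * K'.toReal * E'.toReal) := by ring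
      _ ≤ 24000 * (C * (Y.toReal / w.d) * K'.toReal * E'.toReal) := by linarith
      _ = _ := by ring
  · refine ((hfm.restrict hlt.le hth.2.2.2.2.le).norm_le_ofReal hth).trans ?_
    have hrhs : (1 / 2 ^ (N + 1)) * E' = ENNReal.ofReal (1 / 2 ^ (N + 1) * E'.toReal) := by
      rw [ENNReal.ofReal_mul (by positivity), ENNReal.ofReal_toReal hftop,
        ENNReal.ofReal_div_of_pos (by positivity), ENNReal.ofReal_pow (by norm_num)]
      simp
    rw [hrhs]
    refine ENNReal.ofReal_le_ofReal ?_
    rw [div_eq_inv_mul, ← one_div]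
    have h4 : (4 : ℝ) ^ N = 2 ^ (2 * N) := by rw [pow_mul]; norm_num
    -- Here N ≥ 1 is used: N + 1 ≤ 2N.
    have hle : (1 : ℝ) / 4 ^ N ≤ 1 / 2 ^ (N + 1) := by
      rw [h4]
      exact one_div_le_one_div_of_le (by positivity)
        (pow_le_pow_right₀ (by norm_num) (by omega))
    exact mul_le_mul_of_nonneg_right hle ENNReal.toReal_nonneg
  · refine (ENNReal.ofReal_le_ofReal (hdisp z (hsub hz))).trans ?_
    have hlhs : ENNReal.ofReal (4 * (Y.toReal * K'.toReal)) = 4 * Y * K' := by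
      rw [ENNReal.ofReal_mul (by norm_num), ENNReal.ofReal_mul (by positivity),
        ENNReal.ofReal_toReal hYtop, ENNReal.ofReal_toReal hK'top, mul_assoc]
      simp
    rw [hlhs]
    -- The displacement is bounded in terms of f̃₀/ω_y; the statement has f₀/ω_y, whose norm is at
    -- least as large.
    exact mul_le_mul_right (NormalForm.norm_offAverage_div_le hw hf hA) _
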